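/- **Setting.** Let $E$ be a smooth (Hausdorff, second countable) 4-manifold with a smooth surjective submersion $t:E\to\mathbb R$ ("time"; units of time and length and an origin of time are fixed). Write $V_x=\ker d_xt$, and let $VE\to E$ be the vertical bundle, endowed with a smooth Riemannian metric $g$ and a smooth orientation, with volume form $\eta$. Let $K$ be a *spacetime connection*: a smooth torsion-free linear connection $\nabla$ of $TE\to E$ with $\nabla dt=0$, $\nabla g=0$, whose curvature $R(X,Y)=[\nabla_X,\nabla_Y]-\nabla_{[X,Y]}$ satisfies $g(u,R(w,X)Y)=g(w,R(u,Y)X)$ for $u,w$ vertical and $X,Y$ arbitrary. Let $m,\hbar>0$ and $\kappa=m/\hbar$. **Scalar theory.** The phase space is $J_1E=\{(x,v): v\in T_xE,\ dt(v)=1\}$; an observer is a section $o$ of $J_1E$. By means of $K$ write a tangent vector of $J_1E$ at $(x,v)$ as $(X,w)$, the horizontal lift of $X\in T_xE$ plus $w\in V_x$. Put $$\Omega\big((X,w),(X',w')\big)=\kappa\big[g(w,X'-dt(X')v)-g(w',X-dt(X)v)\big],\qquad \gamma(x,v)=(v,0).$$ The Poisson bracket is $\{f,f'\}=\xi_f.f'$,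 where $dt(\xi_f)=0$ and $i_{\xi_f}\Omega=df-(\gamma.f)\,dt$. A function $f$ on the part of $J_1E$ over an open $U\subset E$ is *special* if locally, for a smooth observer $o$, smooth functions $f^0,\breve f$ and a smooth vertical field $\vec f$, $$f(x,v)=\tfrac{\kappa}{2}\,f^0\,g(v-o,v-o)+\kappa\,g(\vec f,v-o)+\breve f;$$ then $X[f]=f^0\,o-\vec f$ is a vector field on $U$ that does not depend on $o$. The scalar special bracket is $$[\![f,f']\!]=\{f,f'\}+f^0\,\gamma.f'-f'^0\,\gamma.f .$$ **Spin theory.** A *spin special function* over $U$ is a function $f+\phi:(x,v,w)\mapsto f(x,v)+\phi_x(w)$ on the part over $U$ of the fibred product $J_1E\times_E VE$, with $f$ special and $\phi$ a smooth section of $V^*E$ over $U$. Let $\check R$ be the curvature of the connection induced by $K$ on $VE$; let $\triangleright:\operatorname{End}(VE)\to V^*E$ be the map with $(\triangleright A)_k=\sum_{ij}A_{ij}\varepsilon_{ijk}$ in positively oriented orthonormal frames; let $\rho=-\tfrac12\,\triangleright\check R$, a $V^*E$-valued 2-form; and let $(\phi\times\psi)_k=\sum_{ij}\varepsilon_{ijk}\phi_i\psi_j$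 be the cross product of vertical covectors. The extended special bracket is $$[\![f+\phi,f'+\phi']\!]=[\![f,f']\!]-\rho(X[f],X[f'])+\nabla_{X[f]}\phi'-\nabla_{X[f']}\phi+\phi'\times\phi .$$ **Claim.** For every open $U\subset E$ the spin special functions over $U$ form a real vector space which is closed under the extended special bracket; on it the bracket is bilinear and alternating and satisfies the Jacobi identity $$[\![F_1,[\![F_2,F_3]\!]]\!]+[\![F_2,[\![F_3,F_1]\!]]\!]+[\![F_3,[\![F_1,F_2]\!]]\!]=0 .$$ Restriction to smaller open sets preserves spin special functions and the bracket, and compatible families of spin special functions on the members of a family of open sets glue uniquely to a spin special function on their union. That is, the local spin special functions form a sheaf of real Lie algebras. -/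

import Mathlib

open scoped Manifold ContDiff
open TopologicalSpace

noncomputable section

namespace Galilei

variable {E : Type*} [TopologicalSpace E] [ChartedSpace (EuclideanSpace ℝ (Fin 4)) E]
  [IsManifold (𝓡 4) ∞ E]

/-- The (possibly only locally meaningful) vector field `X` is smooth on the set `U`. -/
def SmoothFieldOn (X : ∀ x : E, TangentSpace (𝓡 4) x) (U : Set E) : Prop :=
  ContMDiffOn (𝓡 4) (𝓡 4).tangent ∞ (fun x => (⟨x, X x⟩ : TangentBundle (𝓡 4) E)) U

/-- The vector field `X` is differentiable at the point `x`. -/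
def DiffFieldAt (X : ∀ x : E, TangentSpace (𝓡 4) x) (x : E) : Prop :=
  MDifferentiableAt (𝓡 4) (𝓡 4).tangent (fun y => (⟨y, X y⟩ : TangentBundle (𝓡 4) E)) x

/-- The real function `h` is smooth on the set `U`. -/
def SmoothFunOn (h : E → ℝ) (U : Set E) : Prop := ContMDiffOn (𝓡 4) 𝓘(ℝ, ℝ) ∞ h U

/-- The vertical space `V_x E`: the kernel of the differential of the time function `τ`. -/
def Vert (τ : E → ℝ) (x : E) : Submodule ℝ (TangentSpace (𝓡 4) x) :=
  LinearMap.ker (mvfderiv (𝓡 4) τ x : TangentSpace (𝓡 4) x →ₗ[ℝ] ℝ)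

variable (E) in
/-- A Galileian spacetime: a `4`-manifold fibred over the time axis by a surjective submersion,
with a smooth Riemannian metric and a smooth orientation of the (three-dimensional) fibres.
Units of time and length are fixed, and an origin of time, so that the oriented affine line of
times is `ℝ`.  The orientation of the fibres is recorded by the vertical volume form of the metric
that it determines: the alternating form with value `1` on every positively oriented orthonormal
frame and `-1` on every negatively oriented one. -/
structure Spacetime where
  time : E → ℝ
  time_smooth : ContMDiff (𝓡 4) 𝓘(ℝ, ℝ) ∞ time
  time_surjective : Function.Surjective time
  time_submersion : ∀ x, mvfderiv (𝓡 4) time x ≠ 0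
  metric : ∀ x, LinearMap.BilinForm ℝ (Vert time x)
  metric_symm : ∀ x u w, metric x u w = metric x w u
  metric_pos : ∀ x u, u ≠ 0 → 0 < metric x u u
  metric_smooth : ∀ (U : Set E), IsOpen U → ∀ u w : ∀ x, Vert time x,
    SmoothFieldOn (fun x => (u x : TangentSpace (𝓡 4) x)) U →
    SmoothFieldOn (fun x => (w x : TangentSpace (𝓡 4) x)) U →
    SmoothFunOn (fun x => metric x (u x) (w x)) U
  vol : ∀ x, (Vert time x) [⋀^Fin 3]→ₗ[ℝ] ℝ
  vol_sq : ∀ x (u : Fin 3 → Vert time x),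
    vol x u ^ 2 = (Matrix.of fun i j => metric x (u i) (u j)).det
  vol_smooth : ∀ (U : Set E), IsOpen U → ∀ u : Fin 3 → ∀ x, Vert time x,
    (∀ i, SmoothFieldOn (fun x => (u i x : TangentSpace (𝓡 4) x)) U) →
    SmoothFunOn (fun x => vol x fun i => u i x) U

namespace Spacetime

variable (G : Spacetime E)

/-- The time form `dt`. -/
def dt (x : E) : TangentSpace (𝓡 4) x →L[ℝ] ℝ := mvfderiv (𝓡 4) G.time x

/-- The vertical space at `x`. -/
abbrev V (x : E) : Submodule ℝ (TangentSpace (𝓡 4) x) := Vert G.time x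

/-- A vertical tangent vector, seen as an element of the vertical space. (The value `0` for a
vector that is not vertical is never used for the objects below.) -/
def toVert (x : E) (u : TangentSpace (𝓡 4) x) : G.V x :=
  open Classical in if h : u ∈ G.V x then ⟨u, h⟩ else 0

/-- The fibre at `x` of the phase space `J₁E`: the velocities `v` with `dt v = 1`. -/
def J (x : E) : Type := {v : TangentSpace (𝓡 4) x // G.dt x v = 1}

instance nonempty_J (x : E) : Nonempty (G.J x) := by
  have h : G.dt x ≠ 0 := G.time_submersion x
  obtain ⟨v, hv⟩ : ∃ v, G.dt x v ≠ 0 := by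
    by_contra hc
    push Not at hc
    exact h (ContinuousLinearMap.ext hc)
  exact ⟨⟨(G.dt x v)⁻¹ • v, by rw [map_smul, smul_eq_mul, inv_mul_cancel₀ hv]⟩⟩

variable {G}

/-- The difference `v - o` of two velocities at the same point is a vertical vector. -/
def J.sub {x : E} (v o : G.J x) : G.V x :=
  ⟨v.1 - o.1, by
    have h1 := v.2
    have h2 := o.2
    change G.dt x (v.1 - o.1) = 0
    rw [map_sub, h1, h2, sub_self]⟩

/-- The velocity `v + w`, for a velocity `v` and a vertical vector `w`. -/
def J.add {x : E} (v : G.J x) (w : G.V x) : G.J x :=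
  ⟨v.1 + w.1, by
    have h1 := v.2
    have h2 : G.dt x w.1 = 0 := w.2
    rw [map_add, h1, h2, add_zero]⟩

/-- The value `Y - dt(Y) v` at the tangent vector `Y` of the contact form at the velocity `v`;
in a spacetime chart its components are `(dxʲ - vʲ dx⁰)(Y)`. -/
def J.contact {x : E} (v : G.J x) (Y : TangentSpace (𝓡 4) x) : G.V x :=
  ⟨Y - G.dt x Y • v.1, by
    have h1 := v.2
    change G.dt x (Y - G.dt x Y • v.1) = 0
    rw [map_sub, map_smul, h1, smul_eq_mul, mul_one, sub_self]⟩

end Spacetime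

/-! ### Connections -/

section Connection

/-- A linear connection of `TE → E`; `K Y x X` is `(∇_X Y)(x)`. -/
abbrev Connection (E : Type*) [TopologicalSpace E] [ChartedSpace (EuclideanSpace ℝ (Fin 4)) E]
    [IsManifold (𝓡 4) ∞ E] :=
  CovariantDerivative (𝓡 4) (EuclideanSpace ℝ (Fin 4)) (fun x : E => TangentSpace (𝓡 4) x)

/-- The curvature `R(X, Y)Z = ∇_X ∇_Y Z - ∇_Y ∇_X Z - ∇_[X,Y] Z` at `x`, computed with local
extensions of the three vectors to vector fields that are smooth near `x`. -/
def curvature (K : Connection E) (x : E) (X Y Z : TangentSpace (𝓡 4) x) : TangentSpace (𝓡 4) x :=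
  let e : TangentSpace (𝓡 4) x → ∀ y : E, TangentSpace (𝓡 4) y := fun u =>
    FiberBundle.extend (EuclideanSpace ℝ (Fin 4)) u
  K (fun y => K (e Z) y (e Y y)) x X - K (fun y => K (e Z) y (e X y)) x Y
    - K (e Z) x (VectorField.mlieBracket (𝓡 4) (e X) (e Y) x)

/-- A spacetime connection of a Galileian spacetime: smooth, torsion-free, preserving `dt` and the
metric of the fibres, and with the curvature symmetry
`g(u, R(w, X)Y) = g(w, R(u, Y)X)` for `u`, `w` vertical and `X`, `Y` arbitrary. -/
structure SpacetimeConnection (G : Spacetime E) where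
  toConn : Connection E
  smooth : CovariantDerivative.ContMDiffCovariantDerivative toConn ∞
  torsion_free : ∀ (X Y : ∀ x : E, TangentSpace (𝓡 4) x) (x : E),
    DiffFieldAt X x → DiffFieldAt Y x →
      toConn Y x (X x) - toConn X x (Y x) = VectorField.mlieBracket (𝓡 4) X Y x
  dt_parallel : ∀ (Y : ∀ x : E, TangentSpace (𝓡 4) x) (x : E) (X : TangentSpace (𝓡 4) x),
    DiffFieldAt Y x → mvfderiv (𝓡 4) (fun y => G.dt y (Y y)) x X = G.dt x (toConn Y x X)
  metric_parallel : ∀ (u w : ∀ x : E, G.V x) (x : E) (X : TangentSpace (𝓡 4) x),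
    DiffFieldAt (fun y => (u y : TangentSpace (𝓡 4) y)) x →
    DiffFieldAt (fun y => (w y : TangentSpace (𝓡 4) y)) x →
      mvfderiv (𝓡 4) (fun y => G.metric y (u y) (w y)) x X =
        G.metric x (G.toVert x (toConn (fun y => (u y : TangentSpace (𝓡 4) y)) x X)) (w x) +
        G.metric x (u x) (G.toVert x (toConn (fun y => (w y : TangentSpace (𝓡 4) y)) x X))
  curvature_symm : ∀ (x : E) (u w : G.V x) (X Y : TangentSpace (𝓡 4) x),
    G.metric x u (G.toVert x (curvature toConn x w X Y)) =
      G.metric x w (G.toVert x (curvature toConn x u Y X))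

end Connection

/-! ### Phase functions, the form `Ω`, the Poisson bracket and the special bracket -/

section Phase

variable {G : Spacetime E} (K : SpacetimeConnection G)

/-- The derivative of the phase function `f` at `(x, v)` in the direction `w` of the fibre. -/
def vertDeriv (f : ∀ x, G.J x → ℝ) (x : E) (v : G.J x) (w : G.V x) : ℝ :=
  deriv (fun s : ℝ => f x (v.add (s • w))) 0

/-- An observer (section of `J₁E`) that is smooth at `x` and has the velocity `v` there. -/
def observerThrough (x : E) (v : G.J x) : ∀ y, G.J y :=
  Classical.epsilon fun o : ∀ y, G.J y =>
    ContMDiffAt (𝓡 4) (𝓡 4).tangent ∞ (fun y => (⟨y, (o y).1⟩ : TangentBundle (𝓡 4) E)) x ∧ o x = v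

/-- The derivative of `f` at `(x, v)` along the horizontal lift, with respect to `K`, of the
tangent vector `X` of `E`.  For an observer `o` with `o(x) = v`, the tangent map of `o` sends `X`
to the sum of the horizontal lift of `X` and of the vertical vector `∇_X o`. -/
def horDeriv (f : ∀ x, G.J x → ℝ) (x : E) (v : G.J x) (X : TangentSpace (𝓡 4) x) : ℝ :=
  mvfderiv (𝓡 4) (fun y => f y (observerThrough x v y)) x X
    - vertDeriv f x v (G.toVert x (K.toConn (fun y => (observerThrough x v y).1) x X))

/-- The tangent space of `J₁E` at a point over `x`.  The pair `(X, w)` stands for the sum of the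
horizontal lift of `X` with respect to `K` and of the vertical vector `w`; in a spacetime chart
`w` has the components `dx₀ⁱ - (K_λⁱ_h x₀ʰ + K_λⁱ_0) dx^λ`. -/
abbrev PhaseTangent (G : Spacetime E) (x : E) : Type := TangentSpace (𝓡 4) x × G.V x

/-- The derivative of the phase function `f` at `(x, v)` along a tangent vector of `J₁E`. -/
def phaseDeriv (f : ∀ x, G.J x → ℝ) (x : E) (v : G.J x) (ξ : PhaseTangent G x) : ℝ :=
  horDeriv K f x v ξ.1 + vertDeriv f x v ξ.2

/-- The cosymplectic two-form `Ω = (m/ħ) g_ij (dx₀ⁱ - (K_λⁱ_h x₀ʰ + K_λⁱ_0) dx^λ) ∧ (dxʲ - x₀ʲ dx⁰)`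
of `J₁E`; the argument `κ` is `m/ħ`. -/
def Omega (κ : ℝ) {x : E} (v : G.J x) (ξ η : PhaseTangent G x) : ℝ :=
  κ * (G.metric x ξ.2 (v.contact η.1) - G.metric x η.2 (v.contact ξ.1))

/-- The second order connection `γ`, the vector field on `J₁E` with `dt(γ) = 1` and `i_γ Ω = 0`:
the horizontal lift of the velocity `v` at the point `(x, v)`. -/
def gammaField {x : E} (v : G.J x) : PhaseTangent G x := (v.1, 0)

/-- The Hamiltonian lift of `f` at `(x, v)`: the tangent vector `ξ` of `J₁E` with `dt(ξ) = 0` and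
`i_ξ Ω = df - (γ.f) dt`. -/
def hamiltonianLift (κ : ℝ) (f : ∀ x, G.J x → ℝ) (x : E) (v : G.J x) : PhaseTangent G x :=
  Classical.epsilon fun ξ : PhaseTangent G x => G.dt x ξ.1 = 0 ∧ ∀ η : PhaseTangent G x,
    Omega κ v ξ η = phaseDeriv K f x v η - phaseDeriv K f x v (gammaField v) * G.dt x η.1

/-- The Poisson bracket of phase functions, with the sign for which `{xⁱ, p_j} = δⁱ_j`, where
`p_j = (m/ħ) g_jk x₀ᵏ`. -/
def poisson (κ : ℝ) (f f' : ∀ x, G.J x → ℝ) (x : E) (v : G.J x) : ℝ :=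
  phaseDeriv K f' x v (hamiltonianLift K κ f x v)

/-- The pointwise form of a special phase function, relative to the value `o` of an observer:
`f(v) = (a κ/2) g(v - o, v - o) + κ g(b, v - o) + c`. -/
def HasSpecialForm (κ : ℝ) {x : E} (o : G.J x) (a : ℝ) (b : G.V x) (c : ℝ) (f : G.J x → ℝ) : Prop :=
  ∀ v : G.J x, f v = a * (κ / 2) * G.metric x (v.sub o) (v.sub o) + κ * G.metric x b (v.sub o) + c

/-- `f` is a special phase function of the scalar theory on `U`: near each point of `U` there are
a smooth observer `o` and smooth coefficients `f⁰ = a`, `fⁱ = bⁱ`, `f̆ = c` for which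
`f = f⁰ (κ/2) g_ij x₀ⁱ x₀ʲ + κ fⁱ g_ij x₀ʲ + f̆` in the charts adapted to `o`. -/
def IsSpecial (κ : ℝ) (U : Set E) (f : ∀ x, G.J x → ℝ) : Prop :=
  ∀ x ∈ U, ∃ W : Set E, IsOpen W ∧ x ∈ W ∧ W ⊆ U ∧
    ∃ (o : ∀ y, G.J y) (a : E → ℝ) (b : ∀ y, G.V y) (c : E → ℝ),
      SmoothFieldOn (fun y => (o y).1) W ∧ SmoothFunOn a W ∧
      SmoothFieldOn (fun y => (b y : TangentSpace (𝓡 4) y)) W ∧ SmoothFunOn c W ∧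
      ∀ y ∈ W, HasSpecialForm κ (o y) (a y) (b y) (c y) (f y)

/-- The vector field `X[f] = f⁰ ∂₀ - fⁱ ∂_i` of a special phase function: the vector `a o - b`
for coefficients of `f` relative to some observer `o`. (It does not depend on `o`.) -/
def fieldOf (κ : ℝ) (f : ∀ x, G.J x → ℝ) (x : E) : TangentSpace (𝓡 4) x :=
  open Classical in
  if h : ∃ p : G.J x × ℝ × G.V x × ℝ, HasSpecialForm κ p.1 p.2.1 p.2.2.1 p.2.2.2 (f x) then
    h.choose.2.1 • h.choose.1.1 - (h.choose.2.2.1 : TangentSpace (𝓡 4) x)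
  else 0

/-- The coefficient `f⁰ = dt(X[f])` of a special phase function. -/
def timeCoeff (κ : ℝ) (f : ∀ x, G.J x → ℝ) (x : E) : ℝ := G.dt x (fieldOf κ f x)

/-- The special bracket of the scalar theory, `⟦f, f'⟧ = {f, f'} + f⁰ γ.f' - f'⁰ γ.f`. -/
def scalarBracket (κ : ℝ) (f f' : ∀ x, G.J x → ℝ) (x : E) (v : G.J x) : ℝ :=
  poisson K κ f f' x v + timeCoeff κ f x * phaseDeriv K f' x v (gammaField v)
    - timeCoeff κ f' x * phaseDeriv K f x v (gammaField v)

end Phase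

/-! ### The spin part -/

section Spin

variable {G : Spacetime E} (K : SpacetimeConnection G)

/-- `φ` is a smooth section of the bundle `V*E` of vertical covectors on `U`. -/
def IsCovectorFieldOn (U : Set E) (φ : ∀ x, G.V x → ℝ) : Prop :=
  (∀ x ∈ U, IsLinearMap ℝ (φ x)) ∧
  ∀ W : Set E, IsOpen W → W ⊆ U → ∀ w : ∀ x, G.V x,
    SmoothFieldOn (fun x => (w x : TangentSpace (𝓡 4) x)) W → SmoothFunOn (fun x => φ x (w x)) W

/-- The vertical vector `φ♯` with `g(φ♯, w) = φ(w)`. -/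
def sharp {x : E} (φ : G.V x → ℝ) : G.V x :=
  Classical.epsilon fun a : G.V x => ∀ w, G.metric x a w = φ w

/-- The cross product of vertical covectors: `(φ × ψ)(z) = η(φ♯, ψ♯, z)`, with `η` the volume form
of the fibres. In a positively oriented orthonormal frame, `(φ × ψ)_k = ε_ijk φ_i ψ_j`. -/
def cross {x : E} (φ ψ : G.V x → ℝ) (z : G.V x) : ℝ := G.vol x ![sharp φ, sharp ψ, z]

/-- A `g`-orthonormal frame of the vertical space at `x`. -/
def orthonormalFrame (G : Spacetime E) (x : E) : Fin 3 → G.V x :=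
  Classical.epsilon fun e : Fin 3 → G.V x =>
    ∀ i j, G.metric x (e i) (e j) = if i = j then 1 else 0

/-- The map `▷ : End(VE) → V*E`: the second factor of `A ∈ VE ⊗ V*E` is raised with the metric and
the result is contracted with the volume form; `(▷A)_k = A_ij ε_ijk` in a positively oriented
orthonormal frame. -/
def triangle {x : E} (A : G.V x → G.V x) (z : G.V x) : ℝ :=
  ∑ j, G.vol x ![A (orthonormalFrame G x j), orthonormalFrame G x j, z]

/-- The curvature `Ř` of the connection induced by `K` on the vertical bundle. -/
def vertCurvature (x : E) (X Y : TangentSpace (𝓡 4) x) (w : G.V x) : G.V x :=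
  G.toVert x (curvature K.toConn x X Y w)

/-- The `V*E`-valued two-form `ρ` that corresponds to `Ř` under the isomorphism of Lie algebras
`-½ ▷` from the antisymmetric endomorphisms to the covectors with the cross product. -/
def rho (x : E) (X Y : TangentSpace (𝓡 4) x) (z : G.V x) : ℝ :=
  -(1 / 2) * triangle (vertCurvature K x X Y) z

/-- A vertical vector field that is smooth at `x` and has the value `w` there. -/
def vertExtension (x : E) (w : G.V x) : ∀ y, G.V y :=
  Classical.epsilon fun u : ∀ y, G.V y =>
    ContMDiffAt (𝓡 4) (𝓡 4).tangent ∞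
      (fun y => (⟨y, (u y : TangentSpace (𝓡 4) y)⟩ : TangentBundle (𝓡 4) E)) x ∧ u x = w

/-- The covariant derivative of a section of `V*E`, for the connection dual to the one induced by
`K` on the vertical bundle: `(∇_X φ)(w) = X.(φ(u)) - φ(∇_X u)` for a local vertical extension `u`
of `w`. -/
def covDual (φ : ∀ x, G.V x → ℝ) (x : E) (X : TangentSpace (𝓡 4) x) (w : G.V x) : ℝ :=
  mvfderiv (𝓡 4) (fun y => φ y (vertExtension x w y)) x X
    - φ x (G.toVert x (K.toConn (fun y => (vertExtension x w y : TangentSpace (𝓡 4) y)) x X))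

/-- The spin part of the bracket of `f + φ` and `f' + φ'`:
`-ρ(X[f], X[f']) + ∇_{X[f]} φ' - ∇_{X[f']} φ + φ' × φ`. -/
def spinPartBracket (κ : ℝ) (f : ∀ x, G.J x → ℝ) (φ : ∀ x, G.V x → ℝ)
    (f' : ∀ x, G.J x → ℝ) (φ' : ∀ x, G.V x → ℝ) (x : E) (w : G.V x) : ℝ :=
  -rho K x (fieldOf κ f x) (fieldOf κ f' x) w + covDual K φ' x (fieldOf κ f x) w
    - covDual K φ x (fieldOf κ f' x) w + cross (φ' x) (φ x) w

/-! ### Local spin phase functions -/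

/-- The phase space of a particle with spin, the fibred product of `J₁E` and `VE` over `E`. -/
structure SpinPhase (G : Spacetime E) where
  pt : E
  vel : G.J pt
  spin : G.V pt

/-- Real functions on the part of the spin phase space over the open set `U`. -/
abbrev LocalFun (G : Spacetime E) (U : Opens E) : Type _ := {p : SpinPhase G // p.pt ∈ U} → ℝ

/-- Restriction of functions to a smaller open set. -/
def LocalFun.res {U W : Opens E} (h : W ≤ U) (F : LocalFun G U) : LocalFun G W :=
  fun p => F ⟨p.1, h p.2⟩

/-- `F` is a local spin special function over `U`: `F = f ∘ pr₁ + φ ∘ pr₂`, with a special phase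
function `f` of the scalar theory and a smooth section `φ` of `V*E` over `U`. -/
def IsSpinSpecial (κ : ℝ) {U : Opens E} (F : LocalFun G U) : Prop :=
  ∃ (f : ∀ x, G.J x → ℝ) (φ : ∀ x, G.V x → ℝ),
    IsSpecial κ (U : Set E) f ∧ IsCovectorFieldOn (U : Set E) φ ∧
    ∀ p : {p : SpinPhase G // p.pt ∈ U}, F p = f p.1.pt p.1.vel + φ p.1.pt p.1.spin

/-- The component `f` of `F = f + φ`, that is `f(x, v) = F(x, v, 0)`, extended by `0` off `U`. -/
def scalarPart {U : Opens E} (F : LocalFun G U) (x : E) (v : G.J x) : ℝ :=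
  open Classical in if h : x ∈ U then F ⟨⟨x, v, 0⟩, h⟩ else 0

/-- The component `φ` of `F = f + φ`, that is `φ(x, w) = F(x, v, w) - F(x, v, 0)` with an arbitrary
velocity `v`, extended by `0` off `U`. -/
def spinPart {U : Opens E} (F : LocalFun G U) (x : E) (w : G.V x) : ℝ :=
  open Classical in
  if h : x ∈ U then
    F ⟨⟨x, Classical.arbitrary (G.J x), w⟩, h⟩ - F ⟨⟨x, Classical.arbitrary (G.J x), 0⟩, h⟩
  else 0

/-- The extended special bracket of local spin special functions. -/
def spinBracket (κ : ℝ) {U : Opens E} (F F' : LocalFun G U) : LocalFun G U := fun p =>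
  scalarBracket K κ (scalarPart F) (scalarPart F') p.1.pt p.1.vel
    + spinPartBracket K κ (scalarPart F) (spinPart F) (scalarPart F') (spinPart F') p.1.pt p.1.spin

end Spin

end Galilei

end

open scoped Manifold ContDiff Topology
open TopologicalSpace

noncomputable section

set_option linter.unusedSectionVars false

namespace Galilei

variable {E : Type*} [TopologicalSpace E] [ChartedSpace (EuclideanSpace ℝ (Fin 4)) E]
  [IsManifold (𝓡 4) ∞ E]

/-! ### Smooth functions and smooth vector fields on open sets -/

section Calculus

variable {W W' : Set E} {X Y Z : ∀ x : E, TangentSpace (𝓡 4) x} {f h : E → ℝ} {x : E}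

/-! Both halves of the bracket are described by data on `E` itself, and each half of the Jacobi
identity becomes a standard fact about connections.

Scalar half. A special function is quadratic in the velocity, so relative to an observer `o` it
amounts to a pair `(X, c)`: its vector field and its value along `o` (`specialFun`,
`specialFun_change`, `specialFun_injective`). Its fibre derivative is `-κ g(contact X, ·)`. This
determines the Hamiltonian lift, and the Poisson bracket together with the two `γ`-terms collapses
to `hor f'(X[f]) - hor f(X[f'])`, where `hor` is the derivative along horizontal lifts
(`scalarBracket_eq`). Since `dt` and `g` are parallel, the horizontal derivative along `Y` of the
function with field `X` is again quadratic, with field `∇_Y X`. As the torsion vanishes, the bracket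
is special with field `[X, X']`. Its value along `o` is `X.c' - X'.c` plus the pull-back `o^*Ω`
evaluated on `(X, X')` (`bracketValue`). So special functions are pairs (field, function) with a
bracket twisted by a two-form, and Jacobi holds exactly because that form is closed. Closure reduces
to the cyclic identity `curvature_cyclic`, which follows from the first Bianchi identity and the
assumed curvature symmetry.

Spin half. The metric turns covectors into vertical vectors `P`, and `ρ(X, Y)` into the vector `r`
with `r × w = Ř(X, Y) w` (`vcross_rotation`). Let the pair `(X, P)` act on vertical fields by `U ↦
∇_X U - P × U` (`lieOp`). Because the cross product is parallel and satisfies its own Jacobi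
identity, the commutator of two such operators is the operator of the bracket of the pairs
(`lieOp_bracket`). Operators satisfy Jacobi under commutators, vector fields under the Lie bracket,
and a vector whose cross product with everything is zero vanishes. This gives `spinValue_jacobi`
without writing out the second Bianchi identity.

Sheaf property. Specialness is a local condition and the bracket at a point depends only on germs,
so restriction and gluing follow from those of ordinary functions. Much of the remaining work shows
that values defined through arbitrary choices (extensions of vectors, observers through a velocity,
orthonormal frames) do not depend on the choice. -/

theorem SmoothFunOn.mono (hf : SmoothFunOn f W) (hW : W' ⊆ W) : SmoothFunOn f W' :=
  ContMDiffOn.mono hf hW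

theorem SmoothFieldOn.mono (hX : SmoothFieldOn X W) (hW : W' ⊆ W) : SmoothFieldOn X W' :=
  ContMDiffOn.mono hX hW

theorem SmoothFunOn.congr (hf : SmoothFunOn f W) (hh : ∀ y ∈ W, h y = f y) : SmoothFunOn h W :=
  ContMDiffOn.congr hf hh

theorem SmoothFieldOn.congr (hX : SmoothFieldOn X W) (hY : ∀ y ∈ W, Y y = X y) :
    SmoothFieldOn Y W :=
  ContMDiffOn.congr hX fun y hy => by rw [hY y hy]

theorem smoothFunOn_of_forall (hf : ∀ x ∈ W, ∃ U, IsOpen U ∧ x ∈ U ∧ SmoothFunOn f (W ∩ U)) :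
    SmoothFunOn f W :=
  contMDiffOn_of_locally_contMDiffOn hf

theorem smoothFieldOn_of_forall
    (hX : ∀ x ∈ W, ∃ U, IsOpen U ∧ x ∈ U ∧ SmoothFieldOn X (W ∩ U)) : SmoothFieldOn X W :=
  contMDiffOn_of_locally_contMDiffOn hX

theorem SmoothFunOn.contMDiffAt (hf : SmoothFunOn f W) (hW : IsOpen W) (hx : x ∈ W) :
    ContMDiffAt (𝓡 4) 𝓘(ℝ, ℝ) ∞ f x :=
  ContMDiffOn.contMDiffAt hf (hW.mem_nhds hx)

theorem SmoothFunOn.mdiffAt (hf : SmoothFunOn f W) (hW : IsOpen W) (hx : x ∈ W) :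
    MDifferentiableAt (𝓡 4) 𝓘(ℝ, ℝ) f x :=
  (hf.contMDiffAt hW hx).mdifferentiableAt (by simp)

theorem SmoothFieldOn.contMDiffAt (hX : SmoothFieldOn X W) (hW : IsOpen W) (hx : x ∈ W) :
    ContMDiffAt (𝓡 4) (𝓡 4).tangent ∞ (fun y => (⟨y, X y⟩ : TangentBundle (𝓡 4) E)) x :=
  ContMDiffOn.contMDiffAt hX (hW.mem_nhds hx)

theorem SmoothFieldOn.diffAt (hX : SmoothFieldOn X W) (hW : IsOpen W) (hx : x ∈ W) :
    DiffFieldAt X x :=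
  (hX.contMDiffAt hW hx).mdifferentiableAt (by simp)

theorem SmoothFunOn.const (a : ℝ) : SmoothFunOn (fun _ : E => a) W := contMDiffOn_const

theorem SmoothFunOn.add (hf : SmoothFunOn f W) (hh : SmoothFunOn h W) :
    SmoothFunOn (fun y => f y + h y) W := ContMDiffOn.add hf hh

theorem SmoothFunOn.sub (hf : SmoothFunOn f W) (hh : SmoothFunOn h W) :
    SmoothFunOn (fun y => f y - h y) W := ContMDiffOn.sub hf hh

theorem SmoothFunOn.mul (hf : SmoothFunOn f W) (hh : SmoothFunOn h W) :
    SmoothFunOn (fun y => f y * h y) W := ContMDiffOn.mul hf hh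

theorem SmoothFunOn.comp {φ : ℝ → ℝ} (hf : SmoothFunOn f W)
    (hφ : ∀ y ∈ W, ContDiffAt ℝ ∞ φ (f y)) : SmoothFunOn (fun y => φ (f y)) W :=
  fun y hy => (hφ y hy).contMDiffAt.comp_contMDiffWithinAt y (hf y hy)

theorem SmoothFieldOn.zero : SmoothFieldOn (fun y : E => (0 : TangentSpace (𝓡 4) y)) W :=
  (Bundle.contMDiff_zeroSection ℝ (fun x : E => TangentSpace (𝓡 4) x)).contMDiffOn

theorem SmoothFieldOn.add (hX : SmoothFieldOn X W) (hY : SmoothFieldOn Y W) :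
    SmoothFieldOn (fun y => X y + Y y) W := ContMDiffOn.add_section hX hY

theorem SmoothFieldOn.sub (hX : SmoothFieldOn X W) (hY : SmoothFieldOn Y W) :
    SmoothFieldOn (fun y => X y - Y y) W := ContMDiffOn.sub_section hX hY

theorem SmoothFieldOn.neg (hX : SmoothFieldOn X W) : SmoothFieldOn (fun y => -X y) W :=
  ContMDiffOn.neg_section hX

theorem SmoothFieldOn.smul (hf : SmoothFunOn f W) (hX : SmoothFieldOn X W) :
    SmoothFieldOn (fun y => f y • X y) W := ContMDiffOn.smul_section hf hX

theorem SmoothFieldOn.const_smul (a : ℝ) (hX : SmoothFieldOn X W) :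
    SmoothFieldOn (fun y => a • X y) W := ContMDiffOn.const_smul_section hX

theorem SmoothFieldOn.sum {ι : Type*} {s : Finset ι} {Y : ι → ∀ x : E, TangentSpace (𝓡 4) x}
    (hY : ∀ i ∈ s, SmoothFieldOn (Y i) W) : SmoothFieldOn (fun y => ∑ i ∈ s, Y i y) W :=
  ContMDiffOn.sum_section hY

theorem DiffFieldAt.add (hX : DiffFieldAt X x) (hY : DiffFieldAt Y x) :
    DiffFieldAt (fun y => X y + Y y) x := mdifferentiableAt_add_section hX hY

theorem DiffFieldAt.sub (hX : DiffFieldAt X x) (hY : DiffFieldAt Y x) :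
    DiffFieldAt (fun y => X y - Y y) x := mdifferentiableAt_sub_section hX hY

theorem DiffFieldAt.smul (hf : MDifferentiableAt (𝓡 4) 𝓘(ℝ, ℝ) f x) (hX : DiffFieldAt X x) :
    DiffFieldAt (fun y => f y • X y) x := MDifferentiableAt.smul_section hf hX

theorem mvfderiv_congr (hW : IsOpen W) (hx : x ∈ W) (e : ∀ y ∈ W, f y = h y) :
    mvfderiv (𝓡 4) f x = mvfderiv (𝓡 4) h x := by
  have e' := Filter.EventuallyEq.mfderiv_eq (I := 𝓡 4) (I' := 𝓘(ℝ, ℝ))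
    (Filter.eventuallyEq_of_mem (hW.mem_nhds hx) e)
  exact ContinuousLinearMap.ext fun v => congrArg (fun L : TangentSpace (𝓡 4) x →L[ℝ] ℝ => L v) e'

/-- The derivative of a smooth function along a smooth vector field is smooth. -/
theorem SmoothFunOn.deriv (hW : IsOpen W) (hf : SmoothFunOn f W) (hX : SmoothFieldOn X W) :
    SmoothFunOn (fun y => mvfderiv (𝓡 4) f y (X y)) W := by
  have h1 := ContMDiffOn.contMDiffOn_tangentMapWithin (m := ∞) hf (by simp) hW.uniqueMDiffOn
  have h2 := h1.comp hX (fun y hy => hy)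
  have h3 := (contMDiff_snd_tangentBundle_modelSpace ℝ 𝓘(ℝ, ℝ) (n := ∞)).comp_contMDiffOn h2
  refine ContMDiffOn.congr h3 fun y hy => ?_
  simp only [Function.comp, tangentMapWithin, mfderivWithin_of_isOpen hW hy]
  rfl

theorem isManifold_of_coe (n : ℕ) : IsManifold (𝓡 4) n E :=
  IsManifold.of_le (n := ∞) (WithTop.coe_le_coe.2 le_top)

theorem SmoothFieldOn.mlieBracket (hW : IsOpen W) (hX : SmoothFieldOn X W)
    (hY : SmoothFieldOn Y W) : SmoothFieldOn (VectorField.mlieBracket (𝓡 4) X Y) W := by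
  intro y hy
  refine ContMDiffAt.contMDiffWithinAt ?_
  have : IsManifold (𝓡 4) (minSmoothness ℝ 2) E := by simpa using isManifold_of_coe 2
  have : IsManifold (𝓡 4) (((⊤ : ℕ∞) : ℕ∞ω) + 1) E := by simpa
  exact ContMDiffAt.mlieBracket_vectorField (m := ⊤) (n := ⊤) (hX.contMDiffAt hW hy)
    (hY.contMDiffAt hW hy) (by simp)

theorem mlieBracket_jacobi (hW : IsOpen W) (hX : SmoothFieldOn X W) (hY : SmoothFieldOn Y W)
    (hZ : SmoothFieldOn Z W) (hx : x ∈ W) :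
    VectorField.mlieBracket (𝓡 4) X (VectorField.mlieBracket (𝓡 4) Y Z) x =
      VectorField.mlieBracket (𝓡 4) (VectorField.mlieBracket (𝓡 4) X Y) Z x +
      VectorField.mlieBracket (𝓡 4) Y (VectorField.mlieBracket (𝓡 4) X Z) x := by
  have h2 : minSmoothness ℝ 2 ≤ ∞ := by simpa using (WithTop.coe_le_coe.2 le_top : ((2 : ℕ∞) : ℕ∞ω) ≤ ∞)
  have : IsManifold (𝓡 4) (minSmoothness ℝ 3) E := by simpa using isManifold_of_coe 3
  exact VectorField.leibniz_identity_mlieBracket_apply ((hX.contMDiffAt hW hx).of_le h2)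
    ((hY.contMDiffAt hW hx).of_le h2) ((hZ.contMDiffAt hW hx).of_le h2)

theorem mlieBracket_congr {X' Y' : ∀ x : E, TangentSpace (𝓡 4) x} (hW : IsOpen W) (hx : x ∈ W)
    (hX : ∀ y ∈ W, X y = X' y) (hY : ∀ y ∈ W, Y y = Y' y) :
    VectorField.mlieBracket (𝓡 4) X Y x = VectorField.mlieBracket (𝓡 4) X' Y' x :=
  Filter.EventuallyEq.mlieBracket_vectorField_eq
    (Filter.eventuallyEq_of_mem (hW.mem_nhds hx) hX) (Filter.eventuallyEq_of_mem (hW.mem_nhds hx) hY)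

theorem mlieBracket_fun_add_right (hY : DiffFieldAt Y x) (hZ : DiffFieldAt Z x) :
    VectorField.mlieBracket (𝓡 4) X (fun y => Y y + Z y) x =
      VectorField.mlieBracket (𝓡 4) X Y x + VectorField.mlieBracket (𝓡 4) X Z x :=
  have : IsManifold (𝓡 4) 2 E := isManifold_of_coe 2
  VectorField.mlieBracket_add_right hY hZ

theorem mlieBracket_fun_smul_right (hf : MDifferentiableAt (𝓡 4) 𝓘(ℝ, ℝ) f x)
    (hY : DiffFieldAt Y x) :
    VectorField.mlieBracket (𝓡 4) X (fun y => f y • Y y) x =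
      mvfderiv (𝓡 4) f x (X x) • Y x + f x • VectorField.mlieBracket (𝓡 4) X Y x :=
  have : IsManifold (𝓡 4) 2 E := isManifold_of_coe 2
  VectorField.mlieBracket_smul_right hf hY

/-- Every tangent vector extends to a vector field that is smooth near its base point. -/
theorem exists_smoothField (x : E) (z : TangentSpace (𝓡 4) x) :
    ∃ W : Set E, IsOpen W ∧ x ∈ W ∧ SmoothFieldOn (FiberBundle.extend (EuclideanSpace ℝ (Fin 4)) z) W := by
  obtain ⟨s, hs, h⟩ := FiberBundle.exists_contMDiffOn_extend (k := ∞) (𝓡 4) (EuclideanSpace ℝ (Fin 4)) z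
  obtain ⟨t, hts, ht, hxt⟩ := mem_nhds_iff.1 hs
  exact ⟨t, ht, hxt, h.mono hts⟩

/-- The Lie bracket of vector fields acts on functions as the commutator of derivations. -/
theorem mvfderiv_mlieBracket (hW : IsOpen W) (hx : x ∈ W) (hf : SmoothFunOn f W)
    (hX : SmoothFieldOn X W) (hY : SmoothFieldOn Y W) :
    mvfderiv (𝓡 4) f x (VectorField.mlieBracket (𝓡 4) X Y x) =
      mvfderiv (𝓡 4) (fun y => mvfderiv (𝓡 4) f y (Y y)) x (X x) -
      mvfderiv (𝓡 4) (fun y => mvfderiv (𝓡 4) f y (X y)) x (Y x) := by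
  obtain ⟨z, hz⟩ : ∃ z : TangentSpace (𝓡 4) x, z ≠ 0 :=
    exists_ne (0 : EuclideanSpace ℝ (Fin 4))
  obtain ⟨U, hU, hxU, hZ⟩ := exists_smoothField x z
  have hZx : FiberBundle.extend (EuclideanSpace ℝ (Fin 4)) z x = z := by simp
  revert hZ hZx
  generalize (FiberBundle.extend (EuclideanSpace ℝ (Fin 4)) z : ∀ y : E, TangentSpace (𝓡 4) y) = Z
  intro hZ hZx
  have hO := hW.inter hU
  have hxO : x ∈ W ∩ U := ⟨hx, hxU⟩
  replace hf := hf.mono (Set.inter_subset_left (t := U))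
  replace hX := hX.mono (Set.inter_subset_left (t := U))
  replace hY := hY.mono (Set.inter_subset_left (t := U))
  replace hZ := hZ.mono (Set.inter_subset_right (s := W))
  have hXf := hf.deriv hO hX
  have hYf := hf.deriv hO hY
  -- The Jacobi identity for `X`, `Y` and `f • Z`, expanded by the Leibniz rule: modulo the identity
  -- for `X`, `Y`, `Z` only a multiple of `Z` survives, whose coefficient is the claim. Hence the
  -- need for a field with nonzero value `z` at `x`.
  have key := mlieBracket_jacobi hO hX hY (SmoothFieldOn.smul hf hZ) hxO
  have e : ∀ (A : ∀ x : E, TangentSpace (𝓡 4) x), ∀ y ∈ W ∩ U,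
      VectorField.mlieBracket (𝓡 4) A (fun y => f y • Z y) y =
      mvfderiv (𝓡 4) f y (A y) • Z y + f y • VectorField.mlieBracket (𝓡 4) A Z y := fun A y hy =>
    mlieBracket_fun_smul_right (hf.mdiffAt hO hy) (hZ.diffAt hO hy)
  have e2 : ∀ (A B : ∀ x : E, TangentSpace (𝓡 4) x), SmoothFieldOn A (W ∩ U) →
      SmoothFieldOn B (W ∩ U) → 
      VectorField.mlieBracket (𝓡 4) A (VectorField.mlieBracket (𝓡 4) B (fun y => f y • Z y)) x =
      (mvfderiv (𝓡 4) (fun y => mvfderiv (𝓡 4) f y (B y)) x (A x) • z +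
        mvfderiv (𝓡 4) f x (B x) • VectorField.mlieBracket (𝓡 4) A Z x) +
      (mvfderiv (𝓡 4) f x (A x) • VectorField.mlieBracket (𝓡 4) B Z x +
        f x • VectorField.mlieBracket (𝓡 4) A (VectorField.mlieBracket (𝓡 4) B Z) x) := by
    intro A B hA hB
    have hBf := hf.deriv hO hB
    have hBZ := hB.mlieBracket hO hZ
    rw [mlieBracket_congr hO hxO (fun y _ => rfl) (e B),
      mlieBracket_fun_add_right ((SmoothFieldOn.smul hBf hZ).diffAt hO hxO)
        ((SmoothFieldOn.smul hf hBZ).diffAt hO hxO),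
      mlieBracket_fun_smul_right (hBf.mdiffAt hO hxO) (hZ.diffAt hO hxO),
      mlieBracket_fun_smul_right (hf.mdiffAt hO hxO) (hBZ.diffAt hO hxO), hZx]
  rw [e2 X Y hX hY, e2 Y X hY hX, e _ x hxO, hZx, mlieBracket_jacobi hO hX hY hZ hxO] at key
  have h0 : (mvfderiv (𝓡 4) f x (VectorField.mlieBracket (𝓡 4) X Y x) -
      (mvfderiv (𝓡 4) (fun y => mvfderiv (𝓡 4) f y (Y y)) x (X x) -
      mvfderiv (𝓡 4) (fun y => mvfderiv (𝓡 4) f y (X y)) x (Y x))) • z = 0 := by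
    linear_combination (norm := module) (-1 : ℝ) • key
  exact sub_eq_zero.1 ((smul_eq_zero.1 h0).resolve_right hz)

/-- The Jacobi identity for vector fields, in cyclic form. -/
theorem mlieBracket_cyclic (hW : IsOpen W) (hX : SmoothFieldOn X W) (hY : SmoothFieldOn Y W)
    (hZ : SmoothFieldOn Z W) (hx : x ∈ W) :
    VectorField.mlieBracket (𝓡 4) (VectorField.mlieBracket (𝓡 4) X Y) Z x +
      VectorField.mlieBracket (𝓡 4) (VectorField.mlieBracket (𝓡 4) Y Z) X x +
      VectorField.mlieBracket (𝓡 4) (VectorField.mlieBracket (𝓡 4) Z X) Y x = 0 := by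
  have : IsManifold (𝓡 4) 2 E := isManifold_of_coe 2
  have j := mlieBracket_jacobi hW hX hY hZ hx
  have h : VectorField.mlieBracket (𝓡 4) X Z =
      (-1 : ℝ) • VectorField.mlieBracket (𝓡 4) Z X := by
    rw [VectorField.mlieBracket_swap]; simp
  rw [h, VectorField.mlieBracket_swap_apply (V := X),
    VectorField.mlieBracket_swap_apply (V := Y),
    VectorField.mlieBracket_const_smul_left ((hZ.mlieBracket hW hX).diffAt hW hx)] at j
  linear_combination (norm := module) (-1 : ℝ) • j

end Calculus

/-! ### Linear connections and their curvature -/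

section LinearConnection

variable {W : Set E} {X Y Z X' Y' Z' : ∀ x : E, TangentSpace (𝓡 4) x} {f : E → ℝ} {x : E}
  (D : Connection E)

theorem conn_congr (hW : IsOpen W) (hx : x ∈ W) (hX : DiffFieldAt X x)
    (h : ∀ y ∈ W, Y y = X y) : D Y x = D X x := by
  have hY : DiffFieldAt Y x := MDifferentiableAt.congr_of_eventuallyEq hX
    (Filter.eventuallyEq_of_mem (hW.mem_nhds hx) fun y hy => by rw [h y hy])
  exact D.isCovariantDerivativeOn.congr_of_eqOn (s := W) hY hX (hW.mem_nhds hx) h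

theorem conn_add (hX : DiffFieldAt X x) (hY : DiffFieldAt Y x) :
    D (fun y => X y + Y y) x = D X x + D Y x :=
  D.isCovariantDerivativeOnUniv.add hX hY

theorem conn_smul (hf : MDifferentiableAt (𝓡 4) 𝓘(ℝ, ℝ) f x) (hX : DiffFieldAt X x)
    (v : TangentSpace (𝓡 4) x) :
    D (fun y => f y • X y) x v = f x • D X x v + mvfderiv (𝓡 4) f x v • X x := by
  have h := D.isCovariantDerivativeOnUniv.leibniz hX hf
  exact congrArg (fun L : TangentSpace (𝓡 4) x →L[ℝ] TangentSpace (𝓡 4) x => L v) h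

theorem conn_sub (hX : DiffFieldAt X x) (hY : DiffFieldAt Y x) :
    D (fun y => X y - Y y) x = D X x - D Y x := by
  have h := conn_add D (hX.sub hY) hY
  simp only [sub_add_cancel] at h
  exact eq_sub_of_add_eq h.symm

variable {D}

/-- A smooth connection, applied to a section that is smooth on an open set. -/
theorem contMDiffAt_conn [T2Space E]
    (hD : CovariantDerivative.ContMDiffCovariantDerivative D ∞)
    (hW : IsOpen W) (hx : x ∈ W) (hY : SmoothFieldOn Y W) :
    ContMDiffAt (𝓡 4) ((𝓡 4).prod 𝓘(ℝ, EuclideanSpace ℝ (Fin 4) →L[ℝ] EuclideanSpace ℝ (Fin 4)))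
      ∞ (fun y => (⟨y, D Y y⟩ : Bundle.TotalSpace
        (EuclideanSpace ℝ (Fin 4) →L[ℝ] EuclideanSpace ℝ (Fin 4))
        (fun y : E => TangentSpace (𝓡 4) y →L[ℝ] TangentSpace (𝓡 4) y))) x := by
  -- Smoothness of the connection concerns global sections. Cutting `Y` off by a bump function that
  -- equals `1` near `x` gives such a section without changing its covariant derivative near `x`.
  obtain ⟨ψ, hψ, -⟩ := (SmoothBumpFunction.nhds_basis_support (I := 𝓡 4)
    (hW.mem_nhds hx)).mem_iff.1 (hW.mem_nhds hx)
  have hs : ContMDiff (𝓡 4) (𝓡 4).tangent ∞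
      (fun y => (⟨y, ((ψ : E → ℝ) • Y) y⟩ : TangentBundle (𝓡 4) E)) :=
    ContMDiffOn.smul_section_of_tsupport (u := W) ψ.contMDiff.contMDiffOn hW hψ hY
  have hsm := hD.contMDiff.contMDiff (σ := (ψ : E → ℝ) • Y) (by simpa using hs.contMDiffOn)
  refine (ContMDiffOn.contMDiffAt hsm Filter.univ_mem).congr_of_eventuallyEq ?_
  obtain ⟨V, hV1, hV, hxV⟩ := mem_nhds_iff.1 (Filter.inter_mem (hW.mem_nhds hx) ψ.eventuallyEq_one)
  refine Filter.eventuallyEq_of_mem (hV.mem_nhds hxV) fun y hy => ?_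
  have hd : DiffFieldAt ((ψ : E → ℝ) • Y) y := (hs y).mdifferentiableAt (by simp)
  rw [conn_congr D hV hy hd (Y := Y) fun z hz => ?_]
  have h1 : ψ z = 1 := (hV1 hz).2
  simp [h1]

theorem SmoothFieldOn.conn [T2Space E]
    (hD : CovariantDerivative.ContMDiffCovariantDerivative D ∞)
    (hW : IsOpen W) (hX : SmoothFieldOn X W) (hY : SmoothFieldOn Y W) :
    SmoothFieldOn (fun y => D Y y (X y)) W := fun _ hy =>
  ContMDiffAt.contMDiffWithinAt
    (ContMDiffAt.clm_bundle_apply (contMDiffAt_conn hD hW hy hY) (hX.contMDiffAt hW hy))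

theorem DiffFieldAt.conn [T2Space E]
    (hD : CovariantDerivative.ContMDiffCovariantDerivative D ∞)
    (hW : IsOpen W) (hx : x ∈ W) (hX : DiffFieldAt X x) (hY : SmoothFieldOn Y W) :
    DiffFieldAt (fun y => D Y y (X y)) x :=
  MDifferentiableAt.clm_bundle_apply
    ((contMDiffAt_conn hD hW hx hY).mdifferentiableAt (by simp)) hX

variable (D) in
/-- The curvature of a connection as an operator on vector fields. -/
def curvOp (X Y Z : ∀ x : E, TangentSpace (𝓡 4) x) (x : E) : TangentSpace (𝓡 4) x :=
  D (fun y => D Z y (Y y)) x (X x) - D (fun y => D Z y (X y)) x (Y x)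
    - D Z x (VectorField.mlieBracket (𝓡 4) X Y x)

variable (D) in
theorem curvOp_antisymm : curvOp D X Y Z x = -curvOp D Y X Z x := by
  simp only [curvOp]
  rw [VectorField.mlieBracket_swap_apply (V := X), map_neg]
  abel

/-- When `X` is replaced by `f X`, the derivative of `f` arises once from the second covariant
derivative and once from the Lie bracket, and the two cancel. `Z` must be smooth so that `∇Z` can be
differentiated again, while `X` need only be differentiable at the point. -/
theorem tensorialAt_curvOp [T2Space E]
    (hD : CovariantDerivative.ContMDiffCovariantDerivative D ∞)
    (hW : IsOpen W) (hx : x ∈ W) (hZ : SmoothFieldOn Z W) :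
    TensorialAt (𝓡 4) (EuclideanSpace ℝ (Fin 4))
      (fun X : ∀ x : E, TangentSpace (𝓡 4) x => curvOp D X Y Z x) x where
  smul {f X} hf hX := by
    have : IsManifold (𝓡 4) 2 E := isManifold_of_coe 2
    have h : (fun y => D Z y ((f • X) y)) = fun y => f y • D Z y (X y) := by
      funext y; exact map_smul (D Z y) (f y) (X y)
    have hX' := hX
    simp only [curvOp]
    rw [h, conn_smul D hf (DiffFieldAt.conn hD hW hx hX hZ), Pi.smul_apply',
      VectorField.mlieBracket_smul_left hf hX, map_add, map_smul, map_smul, map_smul]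
    module
  add {X X'} hX hX' := by
    have : IsManifold (𝓡 4) 2 E := isManifold_of_coe 2
    have h : (fun y => D Z y ((X + X') y)) = fun y => D Z y (X y) + D Z y (X' y) := by
      funext y; exact map_add (D Z y) (X y) (X' y)
    simp only [curvOp]
    rw [h, conn_add D (DiffFieldAt.conn hD hW hx hX hZ) (DiffFieldAt.conn hD hW hx hX' hZ),
      Pi.add_apply, VectorField.mlieBracket_add_left hX hX', map_add, map_add,
      add_apply]
    abel

theorem curvOp_congr_left [T2Space E]
    (hD : CovariantDerivative.ContMDiffCovariantDerivative D ∞)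
    (hW : IsOpen W) (hx : x ∈ W) (hZ : SmoothFieldOn Z W) (hX : DiffFieldAt X x)
    (hX' : DiffFieldAt X' x) (h : X x = X' x) : curvOp D X Y Z x = curvOp D X' Y Z x :=
  (tensorialAt_curvOp (Y := Y) hD hW hx hZ).pointwise hX hX' h

theorem curvOp_congr_mid [T2Space E]
    (hD : CovariantDerivative.ContMDiffCovariantDerivative D ∞)
    (hW : IsOpen W) (hx : x ∈ W) (hZ : SmoothFieldOn Z W) (hY : DiffFieldAt Y x)
    (hY' : DiffFieldAt Y' x) (h : Y x = Y' x) : curvOp D X Y Z x = curvOp D X Y' Z x := by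
  rw [curvOp_antisymm, curvOp_congr_left hD hW hx hZ hY hY' h, ← curvOp_antisymm]

/-- The first Bianchi identity. -/
theorem curvOp_bianchi [T2Space E]
    (hD : CovariantDerivative.ContMDiffCovariantDerivative D ∞)
    (hT : ∀ (X Y : ∀ x : E, TangentSpace (𝓡 4) x) (x : E),
      DiffFieldAt X x → DiffFieldAt Y x →
      D Y x (X x) - D X x (Y x) = VectorField.mlieBracket (𝓡 4) X Y x)
    (hW : IsOpen W) (hx : x ∈ W) (hX : SmoothFieldOn X W) (hY : SmoothFieldOn Y W)
    (hZ : SmoothFieldOn Z W) :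
    curvOp D X Y Z x + curvOp D Y Z X x + curvOp D Z X Y x = 0 := by
  -- Vanishing torsion as an equality of fields near `x`, differentiated once more along `A`.
  have e : ∀ A B C : ∀ x : E, TangentSpace (𝓡 4) x, SmoothFieldOn A W → SmoothFieldOn B W →
      SmoothFieldOn C W →
      D (fun y => D C y (B y)) x (A x) - D (fun y => D B y (C y)) x (A x) =
        D (VectorField.mlieBracket (𝓡 4) B C) x (A x) := by
    intro A B C hA hB hC
    have h1 := (SmoothFieldOn.conn hD hW hB hC).diffAt hW hx
    have h2 := (SmoothFieldOn.conn hD hW hC hB).diffAt hW hx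
    rw [conn_congr D hW hx (h1.sub h2) (Y := VectorField.mlieBracket (𝓡 4) B C) fun y hy =>
      (hT B C y (hB.diffAt hW hy) (hC.diffAt hW hy)).symm, conn_sub D h1 h2]
    rfl
  -- Torsion-freeness for the pair `A`, `[B, C]`. After both substitutions the cyclic sum is that of
  -- the double Lie brackets.
  have t : ∀ A B C : ∀ x : E, TangentSpace (𝓡 4) x, SmoothFieldOn A W → SmoothFieldOn B W →
      SmoothFieldOn C W → D A x (VectorField.mlieBracket (𝓡 4) B C x) =
      D (VectorField.mlieBracket (𝓡 4) B C) x (A x) +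
      VectorField.mlieBracket (𝓡 4) (VectorField.mlieBracket (𝓡 4) B C) A x := by
    intro A B C hA hB hC
    rw [← hT _ A x ((hB.mlieBracket hW hC).diffAt hW hx) (hA.diffAt hW hx)]
    abel
  have j := mlieBracket_cyclic hW hX hY hZ hx
  have e1 := e X Y Z hX hY hZ
  have e2 := e Y Z X hY hZ hX
  have e3 := e Z X Y hZ hX hY
  have t1 := t X Y Z hX hY hZ
  have t2 := t Y Z X hY hZ hX
  have t3 := t Z X Y hZ hX hY
  simp only [curvOp]
  rw [t1, t2, t3]
  linear_combination (norm := module) e1 + e2 + e3 - j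

/-- The curvature operator is tensorial: on smooth fields it depends only on their values. -/
theorem curvOp_congr [T2Space E]
    (hD : CovariantDerivative.ContMDiffCovariantDerivative D ∞)
    (hT : ∀ (X Y : ∀ x : E, TangentSpace (𝓡 4) x) (x : E),
      DiffFieldAt X x → DiffFieldAt Y x →
      D Y x (X x) - D X x (Y x) = VectorField.mlieBracket (𝓡 4) X Y x)
    (hW : IsOpen W) (hx : x ∈ W) (hX : SmoothFieldOn X W) (hY : SmoothFieldOn Y W)
    (hZ : SmoothFieldOn Z W) (hX' : SmoothFieldOn X' W) (hY' : SmoothFieldOn Y' W)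
    (hZ' : SmoothFieldOn Z' W) (h1 : X x = X' x) (h2 : Y x = Y' x) (h3 : Z x = Z' x) :
    curvOp D X Y Z x = curvOp D X' Y' Z' x := by
  rw [curvOp_congr_left hD hW hx hZ (hX.diffAt hW hx) (hX'.diffAt hW hx) h1,
    curvOp_congr_mid hD hW hx hZ (hY.diffAt hW hx) (hY'.diffAt hW hx) h2]
  -- Tensoriality in the third slot comes from the first two: Bianchi expresses `R(X', Y')Z` by
  -- terms in which `Z` occupies one of the first two slots.
  have b := curvOp_bianchi hD hT hW hx hX' hY' hZ
  have b' := curvOp_bianchi hD hT hW hx hX' hY' hZ'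
  rw [curvOp_congr_mid hD hW hx hX' (hZ.diffAt hW hx) (hZ'.diffAt hW hx) h3,
    curvOp_congr_left hD hW hx hY' (hZ.diffAt hW hx) (hZ'.diffAt hW hx) h3, ← b'] at b
  simpa using b

/-- The curvature tensor computed with arbitrary smooth vector fields. -/
theorem curvature_eq_curvOp [T2Space E]
    (hD : CovariantDerivative.ContMDiffCovariantDerivative D ∞)
    (hT : ∀ (X Y : ∀ x : E, TangentSpace (𝓡 4) x) (x : E),
      DiffFieldAt X x → DiffFieldAt Y x →
      D Y x (X x) - D X x (Y x) = VectorField.mlieBracket (𝓡 4) X Y x)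
    (hW : IsOpen W) (hx : x ∈ W) (hX : SmoothFieldOn X W) (hY : SmoothFieldOn Y W)
    (hZ : SmoothFieldOn Z W) : curvature D x (X x) (Y x) (Z x) = curvOp D X Y Z x := by
  obtain ⟨U1, hU1, hx1, e1⟩ := exists_smoothField x (X x)
  obtain ⟨U2, hU2, hx2, e2⟩ := exists_smoothField x (Y x)
  obtain ⟨U3, hU3, hx3, e3⟩ := exists_smoothField x (Z x)
  have hO := hW.inter (hU1.inter (hU2.inter hU3))
  have s0 : W ∩ (U1 ∩ (U2 ∩ U3)) ⊆ W := fun y hy => hy.1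
  have s1 : W ∩ (U1 ∩ (U2 ∩ U3)) ⊆ U1 := fun y hy => hy.2.1
  have s2 : W ∩ (U1 ∩ (U2 ∩ U3)) ⊆ U2 := fun y hy => hy.2.2.1
  have s3 : W ∩ (U1 ∩ (U2 ∩ U3)) ⊆ U3 := fun y hy => hy.2.2.2
  rw [← curvOp_congr hD hT hO ⟨hx, hx1, hx2, hx3⟩ (e1.mono s1) (e2.mono s2) (e3.mono s3)
    (hX.mono s0) (hY.mono s0) (hZ.mono s0) (by simp) (by simp) (by simp)]
  simp only [curvature, curvOp, FiberBundle.extend_apply_self]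

end LinearConnection

/-! ### Observers, vertical fields and orthonormal frames -/

section Frames

variable {G : Spacetime E} {W : Set E} {x : E}

/-- A section of the vertical bundle that is smooth on `W`. -/
abbrev SmoothVertOn (u : ∀ y, G.V y) (W : Set E) : Prop :=
  SmoothFieldOn (fun y => (u y : TangentSpace (𝓡 4) y)) W

/-- An observer that is smooth on `W`. -/
abbrev SmoothObsOn (o : ∀ y, G.J y) (W : Set E) : Prop := SmoothFieldOn (fun y => (o y).1) W

/-- A section of the vertical bundle that is differentiable at `x`. -/
abbrev DiffVertAt (u : ∀ y, G.V y) (x : E) : Prop :=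
  DiffFieldAt (fun y => (u y : TangentSpace (𝓡 4) y)) x

theorem Spacetime.toVert_coe {Y : TangentSpace (𝓡 4) x} (h : Y ∈ G.V x) :
    (G.toVert x Y : TangentSpace (𝓡 4) x) = Y := by
  simp [Spacetime.toVert, h]

theorem Spacetime.toVert_eq {Y : TangentSpace (𝓡 4) x} {u : G.V x} (h : Y = u) :
    G.toVert x Y = u :=
  Subtype.ext (by rw [Spacetime.toVert_coe (by rw [h]; exact u.2), h])

theorem Spacetime.mem_V {Y : TangentSpace (𝓡 4) x} : Y ∈ G.V x ↔ G.dt x Y = 0 := Iff.rfl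

@[simp]
theorem Spacetime.dt_vert (u : G.V x) : G.dt x (u : TangentSpace (𝓡 4) x) = 0 := u.2

theorem Spacetime.dt_smooth {Y : ∀ y : E, TangentSpace (𝓡 4) y} (hW : IsOpen W)
    (hY : SmoothFieldOn Y W) : SmoothFunOn (fun y => G.dt y (Y y)) W :=
  SmoothFunOn.deriv hW G.time_smooth.contMDiffOn hY

@[simp]
theorem Spacetime.J.coe_contact (v : G.J x) (Y : TangentSpace (𝓡 4) x) :
    (v.contact Y : TangentSpace (𝓡 4) x) = Y - G.dt x Y • v.1 := rfl

@[simp]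
theorem Spacetime.J.coe_sub (v o : G.J x) : (v.sub o : TangentSpace (𝓡 4) x) = v.1 - o.1 := rfl

@[simp]
theorem Spacetime.J.coe_add (v : G.J x) (w : G.V x) :
    (v.add w).1 = v.1 + (w : TangentSpace (𝓡 4) x) := rfl

/-- The splitting of the tangent space into the vertical space and the line of `v`. It separates the
horizontal derivatives and the curvature into vertical and time-like contributions. -/
theorem Spacetime.J.eq_contact_add (v : G.J x) (Y : TangentSpace (𝓡 4) x) :
    Y = (v.contact Y : TangentSpace (𝓡 4) x) + G.dt x Y • v.1 := by simp

theorem Spacetime.J.contact_vert (v : G.J x) (u : G.V x) :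
    v.contact (u : TangentSpace (𝓡 4) x) = u := Subtype.ext (by simp)

theorem Spacetime.J.contact_add (v : G.J x) (Y Z : TangentSpace (𝓡 4) x) :
    v.contact (Y + Z) = v.contact Y + v.contact Z :=
  Subtype.ext (by
    simp only [Spacetime.J.coe_contact, Submodule.coe_add, map_add]
    module)

theorem Spacetime.J.contact_smul (v : G.J x) (a : ℝ) (Y : TangentSpace (𝓡 4) x) :
    v.contact (a • Y) = a • v.contact Y :=
  Subtype.ext (by
    simp only [Spacetime.J.coe_contact, Submodule.coe_smul, map_smul, smul_eq_mul]
    module)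

theorem Spacetime.J.contact_sub (v : G.J x) (Y Z : TangentSpace (𝓡 4) x) :
    v.contact (Y - Z) = v.contact Y - v.contact Z :=
  Subtype.ext (by
    simp only [Spacetime.J.coe_contact, Submodule.coe_sub, map_sub]
    module)

theorem Spacetime.J.contact_sum {ι : Type*} (v : G.J x) (s : Finset ι)
    (Y : ι → TangentSpace (𝓡 4) x) : v.contact (∑ i ∈ s, Y i) = ∑ i ∈ s, v.contact (Y i) :=
  map_sum (⟨⟨v.contact, v.contact_add⟩, v.contact_smul⟩ : TangentSpace (𝓡 4) x →ₗ[ℝ] G.V x) Y s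

theorem SmoothFieldOn.contact {o : ∀ y, G.J y} {Y : ∀ y : E, TangentSpace (𝓡 4) y}
    (hW : IsOpen W) (ho : SmoothObsOn o W) (hY : SmoothFieldOn Y W) :
    SmoothVertOn (fun y => (o y).contact (Y y)) W :=
  hY.sub (SmoothFieldOn.smul (Spacetime.dt_smooth hW hY) ho)

/-- The open subset of `W` on which a smooth function is positive. -/
theorem SmoothFunOn.isOpen_pos {f : E → ℝ} (hW : IsOpen W) (hf : SmoothFunOn f W) :
    IsOpen (W ∩ {y | 0 < f y}) :=
  (ContMDiffOn.continuousOn hf).isOpen_inter_preimage hW isOpen_Ioi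

/-- A smooth extension of the vector is divided by its own time component, which is `1` at `x` and
therefore positive nearby. -/
theorem exists_observer (x : E) (v : G.J x) :
    ∃ W : Set E, IsOpen W ∧ x ∈ W ∧ ∃ o : ∀ y, G.J y, SmoothObsOn o W ∧ o x = v := by
  classical
  obtain ⟨U, hU, hx, hY⟩ := exists_smoothField x v.1
  have hYx : FiberBundle.extend (EuclideanSpace ℝ (Fin 4)) v.1 x = v.1 := by simp
  revert hY hYx
  generalize (FiberBundle.extend (EuclideanSpace ℝ (Fin 4)) v.1 :
    ∀ y : E, TangentSpace (𝓡 4) y) = Y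
  intro hY hYx
  have hd : SmoothFunOn (fun y => G.dt y (Y y)) U := Spacetime.dt_smooth hU hY
  have h1 : G.dt x (Y x) = 1 := by rw [hYx]; exact v.2
  -- The arbitrary branch only makes `o` a total function; it lies outside the open set on which
  -- smoothness is claimed.
  let o : ∀ y, G.J y := fun y => if h : 0 < G.dt y (Y y) then
    ⟨(G.dt y (Y y))⁻¹ • Y y, by rw [map_smul, smul_eq_mul, inv_mul_cancel₀ h.ne']⟩
    else Classical.arbitrary _
  have ho : ∀ y, 0 < G.dt y (Y y) → (o y).1 = (G.dt y (Y y))⁻¹ • Y y := by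
    intro y hy
    have h : o y = ⟨(G.dt y (Y y))⁻¹ • Y y, by
      rw [map_smul, smul_eq_mul, inv_mul_cancel₀ hy.ne']⟩ := dif_pos hy
    rw [h]
  refine ⟨U ∩ {y | 0 < G.dt y (Y y)}, hd.isOpen_pos hU, ⟨hx, by simp [h1]⟩, o, ?_,
    Subtype.ext ?_⟩
  · have hi : SmoothFunOn (fun y => (G.dt y (Y y))⁻¹) (U ∩ {y | 0 < G.dt y (Y y)}) :=
      SmoothFunOn.comp (φ := fun t => t⁻¹) (hd.mono Set.inter_subset_left)
        fun y hy => contDiffAt_inv _ (ne_of_gt hy.2)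
    exact (SmoothFieldOn.smul hi (hY.mono Set.inter_subset_left)).congr fun y hy => ho y hy.2
  · rw [ho x (by rw [h1]; exact one_pos), h1, hYx]; simp

/-- A smooth extension is projected to the vertical bundle along a smooth observer; the projection
leaves the given vertical vector unchanged. -/
theorem exists_vert (x : E) (w : G.V x) :
    ∃ W : Set E, IsOpen W ∧ x ∈ W ∧ ∃ u : ∀ y, G.V y, SmoothVertOn u W ∧ u x = w := by
  obtain ⟨U, hU, hx, o, ho, -⟩ := exists_observer x (Classical.arbitrary (G.J x))
  obtain ⟨U', hU', hx', hY⟩ := exists_smoothField x (w : TangentSpace (𝓡 4) x)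
  refine ⟨U ∩ U', hU.inter hU', ⟨hx, hx'⟩, _, SmoothFieldOn.contact (hU.inter hU')
    (ho.mono Set.inter_subset_left) (hY.mono Set.inter_subset_right), ?_⟩
  simp only [FiberBundle.extend_apply_self]
  exact Spacetime.J.contact_vert _ w

theorem SmoothVertOn.metric {u w : ∀ y, G.V y} (hW : IsOpen W) (hu : SmoothVertOn u W)
    (hw : SmoothVertOn w W) : SmoothFunOn (fun y => G.metric y (u y) (w y)) W :=
  G.metric_smooth W hW u w hu hw

/-- An orthonormal family of vertical vectors at a point extends to an orthonormal family of
smooth vertical fields. -/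
theorem exists_orthonormal_extension (x : E) : ∀ (n : ℕ) (v : Fin n → G.V x),
    (∀ i j, G.metric x (v i) (v j) = if i = j then 1 else 0) →
    ∃ W : Set E, IsOpen W ∧ x ∈ W ∧ ∃ e : Fin n → ∀ y, G.V y, (∀ i, SmoothVertOn (e i) W) ∧
      (∀ y ∈ W, ∀ i j, G.metric y (e i y) (e j y) = if i = j then 1 else 0) ∧
      ∀ i, e i x = v i := by
  intro n
  induction n with
  | zero => exact fun v _ => ⟨Set.univ, isOpen_univ, trivial, fun i => i.elim0,
      fun i => i.elim0, fun y _ i => i.elim0, fun i => i.elim0⟩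
  | succ n ih =>
    intro v hv
    obtain ⟨U, hU, hxU, e, he, hon, hex⟩ := ih (fun i => v i.castSucc) (fun i j => by
      rw [hv]; simp)
    obtain ⟨U', hU', hxU', u, hu, hux⟩ := exists_vert x (v (Fin.last n))
    have hO := hU.inter hU'
    have he' : ∀ i, SmoothVertOn (e i) (U ∩ U') := fun i => (he i).mono Set.inter_subset_left
    have hu' : SmoothVertOn u (U ∩ U') := hu.mono Set.inter_subset_right
    -- A Gram–Schmidt step carried out on fields.
    let p : ∀ y, G.V y := fun y => u y - ∑ i, G.metric y (u y) (e i y) • e i y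
    have hp : SmoothVertOn p (U ∩ U') := by
      have h : SmoothFieldOn (fun y => (u y : TangentSpace (𝓡 4) y) - ∑ i,
          G.metric y (u y) (e i y) • (e i y : TangentSpace (𝓡 4) y)) (U ∩ U') :=
        hu'.sub (SmoothFieldOn.sum fun i _ =>
          SmoothFieldOn.smul (SmoothVertOn.metric hO hu' (he' i)) (he' i))
      refine h.congr fun y _ => ?_
      simp [p]
    have hpe : ∀ y ∈ U ∩ U', ∀ j, G.metric y (p y) (e j y) = 0 := by
      intro y hy j
      simp [p, map_sub, map_sum, hon y hy.1]
    -- The given vectors are already orthonormal at `x`, so neither the projection nor the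
    -- normalisation changes the prescribed value there. In particular the length of `p` is `1` at
    -- `x`, hence positive nearby.
    have hpx : p x = v (Fin.last n) := by
      simp only [p, hux, hex, hv, sub_eq_self]
      refine Finset.sum_eq_zero fun i _ => ?_
      rw [if_neg (Fin.castSucc_lt_last i).ne', zero_smul]
    have hpp := SmoothVertOn.metric hO hp hp
    have hr : SmoothFunOn (fun y => (√(G.metric y (p y) (p y)))⁻¹)
        (U ∩ U' ∩ {y | 0 < G.metric y (p y) (p y)}) :=
      SmoothFunOn.comp (φ := fun t => (√t)⁻¹) (hpp.mono Set.inter_subset_left) fun y hy =>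
        (Real.contDiffAt_sqrt (ne_of_gt hy.2)).inv (Real.sqrt_pos.2 hy.2).ne'
    let w : ∀ y, G.V y := fun y => (√(G.metric y (p y) (p y)))⁻¹ • p y
    have hw : SmoothVertOn w (U ∩ U' ∩ {y | 0 < G.metric y (p y) (p y)}) :=
      SmoothFieldOn.smul hr (hp.mono Set.inter_subset_left)
    have hwe : ∀ y ∈ U ∩ U', ∀ j, G.metric y (w y) (e j y) = 0 := by
      intro y hy j
      simp [w, hpe y hy j]
    have hww : ∀ y, 0 < G.metric y (p y) (p y) → G.metric y (w y) (w y) = 1 := by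
      intro y hy
      simp only [w, map_smul, LinearMap.smul_apply, smul_eq_mul]
      have h2 := Real.mul_self_sqrt hy.le
      have h3 := (Real.sqrt_pos.2 hy).ne'
      generalize √(G.metric y (p y) (p y)) = r at h2 h3
      rw [← h2]
      field_simp
    have h1 : G.metric x (p x) (p x) = 1 := by rw [hpx, hv, if_pos rfl]
    refine ⟨U ∩ U' ∩ {y | 0 < G.metric y (p y) (p y)}, hpp.isOpen_pos hO,
      ⟨⟨hxU, hxU'⟩, by simp [h1]⟩, Fin.snoc (α := fun _ => ∀ y, G.V y) e w, ?_, ?_, ?_⟩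
    · intro i
      induction i using Fin.lastCases with
      | last => simpa using hw
      | cast i => simpa using (he' i).mono Set.inter_subset_left
    · intro y hy i j
      induction i using Fin.lastCases with
      | last =>
        induction j using Fin.lastCases with
        | last => simpa using hww y hy.2
        | cast j => simpa [(Fin.castSucc_lt_last j).ne'] using hwe y hy.1 j
      | cast i =>
        induction j using Fin.lastCases with
        | last =>
          rw [G.metric_symm]
          simpa [(Fin.castSucc_lt_last i).ne] using hwe y hy.1 i
        | cast j => simpa using hon y hy.1.1 i j
    · intro i
      induction i using Fin.lastCases with
      | last => simp [w, hpx, hv]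
      | cast i => simpa using hex i

theorem finrank_V (G : Spacetime E) (x : E) : Module.finrank ℝ (G.V x) = 3 := by
  have : FiniteDimensional ℝ (TangentSpace (𝓡 4) x) :=
    inferInstanceAs (FiniteDimensional ℝ (EuclideanSpace ℝ (Fin 4)))
  have h0 : (mvfderiv (𝓡 4) G.time x : TangentSpace (𝓡 4) x →ₗ[ℝ] ℝ) ≠ 0 := by
    intro h
    refine G.time_submersion x (ContinuousLinearMap.ext fun v => ?_)
    exact congrArg (fun L : TangentSpace (𝓡 4) x →ₗ[ℝ] ℝ => L v) h
  have h := Module.Dual.finrank_ker_add_one_of_ne_zero h0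
  have h4 : Module.finrank ℝ (TangentSpace (𝓡 4) x) = 4 :=
    (finrank_euclideanSpace_fin : Module.finrank ℝ (EuclideanSpace ℝ (Fin 4)) = 4)
  rw [h4] at h
  exact Nat.succ_injective h

theorem finite_V (G : Spacetime E) (x : E) : Module.Finite ℝ (G.V x) :=
  Module.finite_of_finrank_pos (by rw [finrank_V]; norm_num)

theorem exists_orthonormal (G : Spacetime E) (x : E) : ∃ v : Fin 3 → G.V x,
    ∀ i j, G.metric x (v i) (v j) = if i = j then 1 else 0 := by
  have := finite_V G x
  obtain ⟨b, hb⟩ := LinearMap.BilinForm.exists_orthogonal_basis (B := G.metric x)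
    ⟨fun u w => G.metric_symm x u w⟩
  let c := b.reindex (finCongr (finrank_V G x))
  have hc : ∀ i j, i ≠ j → G.metric x (c i) (c j) = 0 := fun i j hij => by
    simp only [c, Module.Basis.reindex_apply]
    exact hb fun h => hij ((finCongr (finrank_V G x)).symm.injective h)
  refine ⟨fun i => (√(G.metric x (c i) (c i)))⁻¹ • c i, fun i j => ?_⟩
  simp only [map_smul, LinearMap.smul_apply, smul_eq_mul]
  split_ifs with h
  · subst h
    have hp := G.metric_pos x (c i) (c.ne_zero i)
    have h2 := Real.mul_self_sqrt hp.le
    have h3 := (Real.sqrt_pos.2 hp).ne'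
    generalize √(G.metric x (c i) (c i)) = r at h2 h3
    rw [← h2]
    field_simp
  · rw [hc i j h]; simp

/-- A smooth orthonormal frame of the vertical bundle exists near every point. -/
theorem exists_orthonormalFrame (G : Spacetime E) (x : E) :
    ∃ W : Set E, IsOpen W ∧ x ∈ W ∧ ∃ e : Fin 3 → ∀ y, G.V y, (∀ i, SmoothVertOn (e i) W) ∧
      ∀ y ∈ W, ∀ i j, G.metric y (e i y) (e j y) = if i = j then 1 else 0 := by
  obtain ⟨v, hv⟩ := exists_orthonormal G x
  obtain ⟨W, hW, hx, e, he, hon, -⟩ := exists_orthonormal_extension x 3 v hv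
  exact ⟨W, hW, hx, e, he, hon⟩

/-- Expansion of a vertical vector in an orthonormal frame. -/
theorem eq_sum_of_orthonormal {e : Fin 3 → G.V x}
    (he : ∀ i j, G.metric x (e i) (e j) = if i = j then 1 else 0) (u : G.V x) :
    u = ∑ i, G.metric x u (e i) • e i := by
  have := finite_V G x
  have hli : LinearIndependent ℝ e := by
    rw [Fintype.linearIndependent_iff]
    intro g hg i
    have h := congrArg (fun w => G.metric x w (e i)) hg
    simpa [map_sum, he] using h
  have hspan : ⊤ ≤ Submodule.span ℝ (Set.range e) :=
    (hli.span_eq_top_of_card_eq_finrank (by rw [finrank_V]; simp)).ge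
  let b := Module.Basis.mk hli hspan
  have hu := b.sum_repr u
  have hb : ∀ i, b i = e i := fun i => by simp [b]
  simp only [hb] at hu
  have hc : ∀ i, G.metric x u (e i) = b.repr u i := by
    intro i
    conv_lhs => rw [← hu]
    simp [map_sum, he]
  simp only [hc, hu]

theorem metric_ext {u w : G.V x} (h : ∀ z, G.metric x u z = G.metric x w z) : u = w := by
  have h1 : G.metric x (u - w) (u - w) = 0 := by
    rw [LinearMap.BilinForm.sub_left, h, sub_self]
  by_contra hne
  exact (G.metric_pos x (u - w) (sub_ne_zero.2 hne)).ne' h1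

/-- A vertical field that is differentiable at a point is, near the point, a combination of smooth
vertical fields with coefficients that are differentiable at the point. -/
theorem exists_decomposition {u : ∀ y, G.V y} (hu : DiffVertAt u x) :
    ∃ W : Set E, IsOpen W ∧ x ∈ W ∧ ∃ (c : Fin 4 → E → ℝ) (s : Fin 4 → ∀ y, G.V y),
      (∀ i, MDifferentiableAt (𝓡 4) 𝓘(ℝ, ℝ) (c i) x) ∧ (∀ i, SmoothVertOn (s i) W) ∧
      ∀ y ∈ W, u y = ∑ i, c i y • s i y := by
  obtain ⟨U, hU, hxU, o, ho, -⟩ := exists_observer x (Classical.arbitrary (G.J x))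
  let t := trivializationAt (EuclideanSpace ℝ (Fin 4)) (fun y : E => TangentSpace (𝓡 4) y) x
  let b := (EuclideanSpace.basisFun (Fin 4) ℝ).toBasis
  have hxt : x ∈ t.baseSet := FiberBundle.mem_baseSet_trivializationAt' x
  have hO := hU.inter t.open_baseSet
  have hs : ∀ i, SmoothFieldOn (t.localFrame b i) (U ∩ t.baseSet) := fun i y hy =>
    (contMDiffAt_localFrame_of_mem ∞ t b i hy.2).contMDiffWithinAt
  -- The coefficients of `u` in a local frame of `TE` are kept, while the frame is projected along
  -- an observer. Since `u` is fixed by the projection, the same coefficients express it through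
  -- vertical fields.
  refine ⟨U ∩ t.baseSet, hO, ⟨hxU, hxt⟩, fun i y => t.localFrameCoeff (𝓡 4) b i y (u y),
    fun i y => (o y).contact (t.localFrame b i y), fun i => ?_, fun i => ?_, fun y hy => ?_⟩
  · exact mdifferentiableAt_localFrameCoeff b hxt hu i
  · exact SmoothFieldOn.contact hO (ho.mono Set.inter_subset_left) (hs i)
  · have h := t.eq_sum_localFrameCoeff_smul (I := 𝓡 4) (b := b)
      (s := fun y => (u y : TangentSpace (𝓡 4) y)) hy.2
    conv_lhs => rw [← Spacetime.J.contact_vert (o y) (u y), h]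
    simp only [Spacetime.J.contact_sum, Spacetime.J.contact_smul]

theorem mdiffAt_sum {ι : Type*} {s : Finset ι} {f : ι → E → ℝ}
    (hf : ∀ i ∈ s, MDifferentiableAt (𝓡 4) 𝓘(ℝ, ℝ) (f i) x) :
    MDifferentiableAt (𝓡 4) 𝓘(ℝ, ℝ) (fun y => ∑ i ∈ s, f i y) x := by
  classical
  induction s using Finset.induction_on with
  | empty => simpa using mdifferentiableAt_const
  | insert a s ha ih =>
    simp only [Finset.sum_insert ha]
    exact (hf a (by simp)).add (ih fun i hi => hf i (by simp [hi]))

/-- The scalar product of two vertical fields that are differentiable at a point. -/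
theorem DiffVertAt.metric {u w : ∀ y, G.V y} (hu : DiffVertAt u x) (hw : DiffVertAt w x) :
    MDifferentiableAt (𝓡 4) 𝓘(ℝ, ℝ) (fun y => G.metric y (u y) (w y)) x := by
  obtain ⟨U, hU, hxU, c, s, hc, hs, hus⟩ := exists_decomposition hu
  obtain ⟨U', hU', hxU', c', s', hc', hs', hws⟩ := exists_decomposition hw
  have hO := hU.inter hU'
  have h : MDifferentiableAt (𝓡 4) 𝓘(ℝ, ℝ) (fun y => ∑ i, ∑ j, c i y * (c' j y *
      G.metric y (s i y) (s' j y))) x :=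
    mdiffAt_sum fun i _ => mdiffAt_sum fun j _ => (hc i).mul ((hc' j).mul
      ((SmoothVertOn.metric hO ((hs i).mono Set.inter_subset_left)
        ((hs' j).mono Set.inter_subset_right)).mdiffAt hO ⟨hxU, hxU'⟩))
  refine h.congr_of_eventuallyEq (Filter.eventuallyEq_of_mem (hO.mem_nhds ⟨hxU, hxU'⟩)
    fun y hy => ?_)
  simp only [hus y hy.1, hws y hy.2, map_sum, LinearMap.sum_apply, map_smul, LinearMap.smul_apply,
    smul_eq_mul]
  simp only [Finset.mul_sum]
  rw [Finset.sum_comm]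
  exact Finset.sum_congr rfl fun i _ => Finset.sum_congr rfl fun j _ => by ring

end Frames

/-! ### The tensor of curvature -/

section CurvatureTensor

variable [T2Space E] {G : Spacetime E} (K : SpacetimeConnection G) {x : E}

theorem exists_three_fields (x : E) (X Y Z : TangentSpace (𝓡 4) x) :
    ∃ W : Set E, IsOpen W ∧ x ∈ W ∧ ∃ A B C : ∀ y : E, TangentSpace (𝓡 4) y,
      SmoothFieldOn A W ∧ SmoothFieldOn B W ∧ SmoothFieldOn C W ∧ A x = X ∧ B x = Y ∧ C x = Z := by
  obtain ⟨U1, hU1, hx1, e1⟩ := exists_smoothField x X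
  obtain ⟨U2, hU2, hx2, e2⟩ := exists_smoothField x Y
  obtain ⟨U3, hU3, hx3, e3⟩ := exists_smoothField x Z
  exact ⟨U1 ∩ (U2 ∩ U3), hU1.inter (hU2.inter hU3), ⟨hx1, hx2, hx3⟩, _, _, _,
    e1.mono fun y hy => hy.1, e2.mono fun y hy => hy.2.1, e3.mono fun y hy => hy.2.2,
    by simp, by simp, by simp⟩

theorem SpacetimeConnection.curvature_eq {W : Set E} {X Y Z : ∀ y : E, TangentSpace (𝓡 4) y}
    (hW : IsOpen W) (hx : x ∈ W) (hX : SmoothFieldOn X W) (hY : SmoothFieldOn Y W)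
    (hZ : SmoothFieldOn Z W) :
    curvature K.toConn x (X x) (Y x) (Z x) = curvOp K.toConn X Y Z x :=
  curvature_eq_curvOp K.smooth K.torsion_free hW hx hX hY hZ

theorem SpacetimeConnection.curvature_antisymm (X Y Z : TangentSpace (𝓡 4) x) :
    curvature K.toConn x X Y Z = -curvature K.toConn x Y X Z := by
  obtain ⟨W, hW, hx, A, B, C, hA, hB, hC, rfl, rfl, rfl⟩ := exists_three_fields x X Y Z
  rw [K.curvature_eq hW hx hA hB hC, K.curvature_eq hW hx hB hA hC, curvOp_antisymm]

theorem SpacetimeConnection.curvature_bianchi (X Y Z : TangentSpace (𝓡 4) x) :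
    curvature K.toConn x X Y Z + curvature K.toConn x Y Z X + curvature K.toConn x Z X Y = 0 := by
  obtain ⟨W, hW, hx, A, B, C, hA, hB, hC, rfl, rfl, rfl⟩ := exists_three_fields x X Y Z
  rw [K.curvature_eq hW hx hA hB hC, K.curvature_eq hW hx hB hC hA, K.curvature_eq hW hx hC hA hB,
    curvOp_bianchi K.smooth K.torsion_free hW hx hA hB hC]

theorem SpacetimeConnection.curvature_smul_left (a : ℝ) (X Y Z : TangentSpace (𝓡 4) x) :
    curvature K.toConn x (a • X) Y Z = a • curvature K.toConn x X Y Z := by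
  obtain ⟨W, hW, hx, A, B, C, hA, hB, hC, rfl, rfl, rfl⟩ := exists_three_fields x X Y Z
  rw [K.curvature_eq hW hx hA hB hC]
  have h := K.curvature_eq hW hx (SmoothFieldOn.smul (SmoothFunOn.const a) hA) hB hC
  rw [h]
  exact (tensorialAt_curvOp (Y := B) K.smooth hW hx hC).smul (f := fun _ => a)
    mdifferentiableAt_const (hA.diffAt hW hx)

theorem SpacetimeConnection.curvature_add_left (X X' Y Z : TangentSpace (𝓡 4) x) :
    curvature K.toConn x (X + X') Y Z =
      curvature K.toConn x X Y Z + curvature K.toConn x X' Y Z := by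
  obtain ⟨W, hW, hx, A, B, C, hA, hB, hC, rfl, rfl, rfl⟩ := exists_three_fields x X Y Z
  obtain ⟨U, hU, hxU, A', -, -, hA', -, -, rfl, -, -⟩ := exists_three_fields x X' X' X'
  have hO := hW.inter hU
  have hxO : x ∈ W ∩ U := ⟨hx, hxU⟩
  replace hA := hA.mono (Set.inter_subset_left (t := U))
  replace hB := hB.mono (Set.inter_subset_left (t := U))
  replace hC := hC.mono (Set.inter_subset_left (t := U))
  replace hA' := hA'.mono (Set.inter_subset_right (s := W))
  rw [K.curvature_eq hO hxO hA hB hC, K.curvature_eq hO hxO hA' hB hC]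
  have h := K.curvature_eq hO hxO (hA.add hA') hB hC
  rw [h]
  exact (tensorialAt_curvOp (Y := B) K.smooth hO hxO hC).add (hA.diffAt hO hxO)
    (hA'.diffAt hO hxO)

theorem SpacetimeConnection.curvature_smul_mid (a : ℝ) (X Y Z : TangentSpace (𝓡 4) x) :
    curvature K.toConn x X (a • Y) Z = a • curvature K.toConn x X Y Z := by
  rw [K.curvature_antisymm, K.curvature_smul_left, K.curvature_antisymm X, smul_neg]

theorem SpacetimeConnection.curvature_add_mid (X Y Y' Z : TangentSpace (𝓡 4) x) :
    curvature K.toConn x X (Y + Y') Z =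
      curvature K.toConn x X Y Z + curvature K.toConn x X Y' Z := by
  rw [K.curvature_antisymm, K.curvature_add_left, K.curvature_antisymm X Y,
    K.curvature_antisymm X Y']
  abel

theorem SpacetimeConnection.curvature_self (X Z : TangentSpace (𝓡 4) x) :
    curvature K.toConn x X X Z = 0 := by
  have h : (2 : ℝ) • curvature K.toConn x X X Z = 0 := by
    linear_combination (norm := module) K.curvature_antisymm X X Z
  exact (smul_eq_zero.1 h).resolve_left two_ne_zero

/-- As `dt` is parallel, `dt(∇_A ∇_B C) = A.B.dt(C)`, so the curvature yields the commutator of `A`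
and `B` minus `[A, B]` on a function. This makes `toVert` of a curvature vector faithful. -/
theorem SpacetimeConnection.dt_curvature (X Y Z : TangentSpace (𝓡 4) x) :
    G.dt x (curvature K.toConn x X Y Z) = 0 := by
  obtain ⟨W, hW, hx, A, B, C, hA, hB, hC, rfl, rfl, rfl⟩ := exists_three_fields x X Y Z
  have e : ∀ {A B : ∀ y : E, TangentSpace (𝓡 4) y}, SmoothFieldOn A W → SmoothFieldOn B W →
      mvfderiv (𝓡 4) (fun y => mvfderiv (𝓡 4) (fun y => G.dt y (C y)) y (B y)) x (A x) =
      G.dt x (K.toConn (fun y => K.toConn C y (B y)) x (A x)) := by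
    intro A B hA hB
    rw [← K.dt_parallel _ _ _ ((SmoothFieldOn.conn K.smooth hW hB hC).diffAt hW hx)]
    rw [mvfderiv_congr hW hx fun y hy => K.dt_parallel C y (B y) (hC.diffAt hW hy)]
  rw [K.curvature_eq hW hx hA hB hC, curvOp, map_sub, map_sub, ← e hA hB, ← e hB hA,
    ← K.dt_parallel _ _ _ (hC.diffAt hW hx),
    mvfderiv_mlieBracket hW hx (Spacetime.dt_smooth hW hC) hA hB]
  ring

theorem SpacetimeConnection.coe_toVert_curvature (X Y Z : TangentSpace (𝓡 4) x) :
    (G.toVert x (curvature K.toConn x X Y Z) : TangentSpace (𝓡 4) x) =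
      curvature K.toConn x X Y Z :=
  Spacetime.toVert_coe (K.dt_curvature X Y Z)

/-- The closure of the phase two-form, as an identity for the curvature. -/
theorem SpacetimeConnection.curvature_cyclic (v : G.J x) (X Y Z : TangentSpace (𝓡 4) x) :
    G.metric x (v.contact X) (G.toVert x (curvature K.toConn x Y Z v.1)) +
      G.metric x (v.contact Y) (G.toVert x (curvature K.toConn x Z X v.1)) +
      G.metric x (v.contact Z) (G.toVert x (curvature K.toConn x X Y v.1)) = 0 := by
  -- `Y` and `Z` are split along `v`; the term with `v` in both of the first two slots vanishes.
  have e : ∀ Y Z : TangentSpace (𝓡 4) x, G.toVert x (curvature K.toConn x Y Z v.1) =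
      G.toVert x (curvature K.toConn x (v.contact Y) (v.contact Z) v.1) +
      G.dt x Z • G.toVert x (curvature K.toConn x (v.contact Y) v.1 v.1) -
      G.dt x Y • G.toVert x (curvature K.toConn x (v.contact Z) v.1 v.1) := by
    intro Y Z
    refine Subtype.ext ?_
    simp only [Submodule.coe_sub, Submodule.coe_add, Submodule.coe_smul, K.coe_toVert_curvature]
    conv_lhs => rw [v.eq_contact_add Y, v.eq_contact_add Z]
    rw [K.curvature_add_left, K.curvature_add_mid, K.curvature_add_mid, K.curvature_smul_left,
      K.curvature_smul_mid, K.curvature_smul_mid, K.curvature_smul_left, K.curvature_self,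
      K.curvature_antisymm v.1]
    module
  have b : ∀ u w : G.V x, G.toVert x (curvature K.toConn x u w v.1) =
      G.toVert x (curvature K.toConn x u v.1 w) - G.toVert x (curvature K.toConn x w v.1 u) := by
    intro u w
    refine Subtype.ext ?_
    simp only [Submodule.coe_sub, K.coe_toVert_curvature]
    have h := K.curvature_bianchi (u : TangentSpace (𝓡 4) x) (w : TangentSpace (𝓡 4) x) v.1
    rw [K.curvature_antisymm v.1] at h
    linear_combination (norm := module) h
  have a : ∀ u w : G.V x, G.toVert x (curvature K.toConn x u w v.1) =
      -G.toVert x (curvature K.toConn x w u v.1) := by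
    intro u w
    refine Subtype.ext ?_
    simp only [Submodule.coe_neg, K.coe_toVert_curvature]
    exact K.curvature_antisymm _ _ _
  rw [e Y Z, e Z X, e X Y]
  generalize v.contact X = u₁
  generalize v.contact Y = u₂
  generalize v.contact Z = u₃
  -- The `s`-identities say that `u ↦ R(u, v)v` is symmetric and remove the terms carrying a factor
  -- `dt`. In the purely vertical remainder, `t1` and `t2` move everything onto `u₃`, where Bianchi
  -- in the form `b` finishes.
  have s12 := K.curvature_symm x u₁ u₂ v.1 v.1
  have s13 := K.curvature_symm x u₁ u₃ v.1 v.1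
  have s23 := K.curvature_symm x u₂ u₃ v.1 v.1
  have t1 := K.curvature_symm x u₃ u₂ v.1 u₁
  have t2 := K.curvature_symm x u₃ u₁ v.1 u₂
  have hb := congrArg (fun z => G.metric x u₃ z) (b u₁ u₂)
  rw [a u₃ u₂, map_neg] at t2
  simp only [map_add, map_sub, map_smul, smul_eq_mul] at hb ⊢
  linear_combination hb - t1 + t2 + G.dt x Z * s12 - G.dt x Y * s13 + G.dt x X * s23

end CurvatureTensor

/-! ### The covariant derivative of vertical fields and observers -/

section Covariant

variable {G : Spacetime E} (K : SpacetimeConnection G) {W : Set E} {x : E}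
  {u w : ∀ y, G.V y} {o : ∀ y, G.J y} {X Y Z : ∀ y : E, TangentSpace (𝓡 4) y} {f : E → ℝ}

/-- The covariant derivative `∇_v Y` as a vertical vector, for `Y` with constant `dt(Y)`. -/
def SpacetimeConnection.cov (Y : ∀ y : E, TangentSpace (𝓡 4) y) (x : E)
    (v : TangentSpace (𝓡 4) x) : G.V x := G.toVert x (K.toConn Y x v)

/-- Since `dt` is parallel and `dt(u)` is constant, `∇u` is vertical and the default value in
`toVert` is never taken. The same applies to observers, where the constant is `1`. -/
theorem SpacetimeConnection.coe_cov_vert (hu : DiffVertAt u x) (v : TangentSpace (𝓡 4) x) :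
    (K.cov (fun y => (u y : TangentSpace (𝓡 4) y)) x v : TangentSpace (𝓡 4) x) =
      K.toConn (fun y => (u y : TangentSpace (𝓡 4) y)) x v := by
  refine Spacetime.toVert_coe ?_
  rw [Spacetime.mem_V, ← K.dt_parallel _ x v hu]
  simp only [Spacetime.dt_vert]
  rw [mvfderiv_const]; rfl

theorem SpacetimeConnection.coe_cov_obs (ho : DiffFieldAt (fun y => (o y).1) x)
    (v : TangentSpace (𝓡 4) x) :
    (K.cov (fun y => (o y).1) x v : TangentSpace (𝓡 4) x) = K.toConn (fun y => (o y).1) x v := by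
  refine Spacetime.toVert_coe ?_
  rw [Spacetime.mem_V, ← K.dt_parallel _ x v ho]
  have h : (fun y => G.dt y (o y).1) = fun _ => 1 := funext fun y => (o y).2
  rw [h, mvfderiv_const]; rfl

theorem SpacetimeConnection.cov_add_right (hu : DiffVertAt u x) (v v' : TangentSpace (𝓡 4) x) :
    K.cov (fun y => (u y : TangentSpace (𝓡 4) y)) x (v + v') =
      K.cov (fun y => (u y : TangentSpace (𝓡 4) y)) x v +
        K.cov (fun y => (u y : TangentSpace (𝓡 4) y)) x v' :=
  Subtype.ext (by simp only [Submodule.coe_add, K.coe_cov_vert hu, map_add])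

theorem SpacetimeConnection.cov_add (hu : DiffVertAt u x) (hw : DiffVertAt w x)
    (v : TangentSpace (𝓡 4) x) :
    K.cov (fun y => ((u y + w y : G.V y) : TangentSpace (𝓡 4) y)) x v =
      K.cov (fun y => (u y : TangentSpace (𝓡 4) y)) x v +
        K.cov (fun y => (w y : TangentSpace (𝓡 4) y)) x v := by
  refine Subtype.ext ?_
  have h : DiffVertAt (fun y => u y + w y) x := hu.add hw
  rw [Submodule.coe_add, K.coe_cov_vert hu, K.coe_cov_vert hw, K.coe_cov_vert h]
  simp only [Submodule.coe_add]
  rw [conn_add _ hu hw, add_apply]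

theorem SpacetimeConnection.cov_sub (hu : DiffVertAt u x) (hw : DiffVertAt w x)
    (v : TangentSpace (𝓡 4) x) :
    K.cov (fun y => ((u y - w y : G.V y) : TangentSpace (𝓡 4) y)) x v =
      K.cov (fun y => (u y : TangentSpace (𝓡 4) y)) x v -
        K.cov (fun y => (w y : TangentSpace (𝓡 4) y)) x v := by
  refine Subtype.ext ?_
  have h : DiffVertAt (fun y => u y - w y) x := hu.sub hw
  rw [Submodule.coe_sub, K.coe_cov_vert hu, K.coe_cov_vert hw, K.coe_cov_vert h]
  simp only [Submodule.coe_sub]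
  rw [conn_sub _ hu hw, sub_apply]

theorem SpacetimeConnection.cov_congr {Y Y' : ∀ y : E, TangentSpace (𝓡 4) y} (hW : IsOpen W)
    (hx : x ∈ W) (hY : DiffFieldAt Y x) (h : ∀ y ∈ W, Y' y = Y y) (v : TangentSpace (𝓡 4) x) :
    K.cov Y' x v = K.cov Y x v := by
  rw [SpacetimeConnection.cov, conn_congr _ hW hx hY h, SpacetimeConnection.cov]

theorem SpacetimeConnection.cov_obs_sub {o' : ∀ y, G.J y}
    (ho : DiffFieldAt (fun y => (o y).1) x) (ho' : DiffFieldAt (fun y => (o' y).1) x)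
    (v : TangentSpace (𝓡 4) x) :
    K.cov (fun y => ((o y).sub (o' y) : TangentSpace (𝓡 4) y)) x v =
      K.cov (fun y => (o y).1) x v - K.cov (fun y => (o' y).1) x v := by
  refine Subtype.ext ?_
  have h : DiffVertAt (fun y => (o y).sub (o' y)) x := ho.sub ho'
  rw [Submodule.coe_sub, K.coe_cov_obs ho, K.coe_cov_obs ho', K.coe_cov_vert h]
  simp only [Spacetime.J.coe_sub]
  rw [conn_sub _ ho ho', sub_apply]

theorem DiffFieldAt.contact (ho : DiffFieldAt (fun y => (o y).1) x) (hY : DiffFieldAt Y x)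
    (hd : MDifferentiableAt (𝓡 4) 𝓘(ℝ, ℝ) (fun y => G.dt y (Y y)) x) :
    DiffVertAt (fun y => (o y).contact (Y y)) x := hY.sub (DiffFieldAt.smul hd ho)

/-- The projection itself varies with the observer, which accounts for the correction `-dt(Y) ∇o`;
the derivative of the factor `dt(Y)` is absorbed by `dt(∇Y)`. -/
theorem SpacetimeConnection.cov_contact (ho : DiffFieldAt (fun y => (o y).1) x)
    (hY : DiffFieldAt Y x)
    (hd : MDifferentiableAt (𝓡 4) 𝓘(ℝ, ℝ) (fun y => G.dt y (Y y)) x)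
    (v : TangentSpace (𝓡 4) x) :
    K.cov (fun y => ((o y).contact (Y y) : TangentSpace (𝓡 4) y)) x v =
      (o x).contact (K.toConn Y x v) - G.dt x (Y x) • K.cov (fun y => (o y).1) x v := by
  refine Subtype.ext ?_
  rw [K.coe_cov_vert (ho.contact hY hd)]
  simp only [Submodule.coe_sub, Submodule.coe_smul, Spacetime.J.coe_contact, K.coe_cov_obs ho]
  rw [conn_sub _ hY (DiffFieldAt.smul hd ho), sub_apply, conn_smul _ hd ho,
    K.dt_parallel _ x v hY]
  abel

theorem SpacetimeConnection.mvfderiv_metric (hu : DiffVertAt u x) (hw : DiffVertAt w x)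
    (v : TangentSpace (𝓡 4) x) :
    mvfderiv (𝓡 4) (fun y => G.metric y (u y) (w y)) x v =
      G.metric x (K.cov (fun y => (u y : TangentSpace (𝓡 4) y)) x v) (w x) +
      G.metric x (u x) (K.cov (fun y => (w y : TangentSpace (𝓡 4) y)) x v) :=
  K.metric_parallel u w x v hu hw

variable {K} in
theorem SmoothVertOn.cov [T2Space E] (hW : IsOpen W) (hX : SmoothFieldOn X W)
    (hu : SmoothVertOn u W) :
    SmoothVertOn (fun y => K.cov (fun y => (u y : TangentSpace (𝓡 4) y)) y (X y)) W :=
  (SmoothFieldOn.conn K.smooth hW hX hu).congr fun _ hy => K.coe_cov_vert (hu.diffAt hW hy) _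

variable {K} in
theorem SmoothObsOn.cov [T2Space E] (hW : IsOpen W) (hX : SmoothFieldOn X W)
    (ho : SmoothObsOn o W) : SmoothVertOn (fun y => K.cov (fun y => (o y).1) y (X y)) W :=
  (SmoothFieldOn.conn K.smooth hW hX ho).congr fun _ hy => K.coe_cov_obs (ho.diffAt hW hy) _

theorem SpacetimeConnection.curvature_vert [T2Space E] (hW : IsOpen W) (hx : x ∈ W)
    (hX : SmoothFieldOn X W) (hY : SmoothFieldOn Y W) (hu : SmoothVertOn u W) :
    curvature K.toConn x (X x) (Y x) (u x) =
      ((K.cov (fun y => (K.cov (fun y => (u y : TangentSpace (𝓡 4) y)) y (Y y) :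
          TangentSpace (𝓡 4) y)) x (X x) -
        K.cov (fun y => (K.cov (fun y => (u y : TangentSpace (𝓡 4) y)) y (X y) :
          TangentSpace (𝓡 4) y)) x (Y x) -
        K.cov (fun y => (u y : TangentSpace (𝓡 4) y)) x
          (VectorField.mlieBracket (𝓡 4) X Y x) : G.V x) : TangentSpace (𝓡 4) x) := by
  have h := K.curvature_eq hW hx hX hY hu
  have h1 := SmoothVertOn.cov (K := K) hW hX hu
  have h2 := SmoothVertOn.cov (K := K) hW hY hu
  rw [h, curvOp]
  simp only [Submodule.coe_sub, K.coe_cov_vert (hu.diffAt hW hx),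
    K.coe_cov_vert (h1.diffAt hW hx), K.coe_cov_vert (h2.diffAt hW hx)]
  rw [conn_congr _ hW hx (h1.diffAt hW hx)
      (fun y hy => (K.coe_cov_vert (hu.diffAt hW hy) (X y)).symm),
    conn_congr _ hW hx (h2.diffAt hW hx)
      (fun y hy => (K.coe_cov_vert (hu.diffAt hW hy) (Y y)).symm)]

theorem SpacetimeConnection.curvature_obs [T2Space E] (hW : IsOpen W) (hx : x ∈ W)
    (hX : SmoothFieldOn X W) (hY : SmoothFieldOn Y W) (ho : SmoothObsOn o W) :
    curvature K.toConn x (X x) (Y x) (o x).1 =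
      ((K.cov (fun y => (K.cov (fun y => (o y).1) y (Y y) : TangentSpace (𝓡 4) y)) x (X x) -
        K.cov (fun y => (K.cov (fun y => (o y).1) y (X y) : TangentSpace (𝓡 4) y)) x (Y x) -
        K.cov (fun y => (o y).1) x
          (VectorField.mlieBracket (𝓡 4) X Y x) : G.V x) : TangentSpace (𝓡 4) x) := by
  have h := K.curvature_eq hW hx hX hY ho
  have h1 := SmoothObsOn.cov (K := K) hW hX ho
  have h2 := SmoothObsOn.cov (K := K) hW hY ho
  rw [h, curvOp]
  simp only [Submodule.coe_sub, K.coe_cov_obs (ho.diffAt hW hx),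
    K.coe_cov_vert (h1.diffAt hW hx), K.coe_cov_vert (h2.diffAt hW hx)]
  rw [conn_congr _ hW hx (h1.diffAt hW hx)
      (fun y hy => (K.coe_cov_obs (ho.diffAt hW hy) (X y)).symm),
    conn_congr _ hW hx (h2.diffAt hW hx)
      (fun y hy => (K.coe_cov_obs (ho.diffAt hW hy) (Y y)).symm)]

end Covariant

/-! ### Pointwise rules for derivatives of real functions -/

section Derivation

variable {f h : E → ℝ} {x : E} (v : TangentSpace (𝓡 4) x)

theorem mvfderiv_add_apply (hf : MDifferentiableAt (𝓡 4) 𝓘(ℝ, ℝ) f x)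
    (hh : MDifferentiableAt (𝓡 4) 𝓘(ℝ, ℝ) h x) :
    mvfderiv (𝓡 4) (fun y => f y + h y) x v = mvfderiv (𝓡 4) f x v + mvfderiv (𝓡 4) h x v := by
  rw [mvfderiv_fun_add hf hh]; rfl

theorem mvfderiv_sub_apply (hf : MDifferentiableAt (𝓡 4) 𝓘(ℝ, ℝ) f x)
    (hh : MDifferentiableAt (𝓡 4) 𝓘(ℝ, ℝ) h x) :
    mvfderiv (𝓡 4) (fun y => f y - h y) x v = mvfderiv (𝓡 4) f x v - mvfderiv (𝓡 4) h x v := by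
  rw [mvfderiv_fun_sub hf hh]; rfl

theorem mvfderiv_mul_apply (hf : MDifferentiableAt (𝓡 4) 𝓘(ℝ, ℝ) f x)
    (hh : MDifferentiableAt (𝓡 4) 𝓘(ℝ, ℝ) h x) :
    mvfderiv (𝓡 4) (fun y => f y * h y) x v =
      f x * mvfderiv (𝓡 4) h x v + h x * mvfderiv (𝓡 4) f x v := by
  rw [mvfderiv_fun_mul hf hh]; rfl

theorem mvfderiv_const_mul_apply (a : ℝ) (hf : MDifferentiableAt (𝓡 4) 𝓘(ℝ, ℝ) f x) :
    mvfderiv (𝓡 4) (fun y => a * f y) x v = a * mvfderiv (𝓡 4) f x v := by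
  rw [mvfderiv_mul_apply v mdifferentiableAt_const hf, mvfderiv_const]
  simp

end Derivation

/-! ### Special phase functions -/

section Special

variable {G : Spacetime E} {κ : ℝ} {x : E}

/-- The special function with vector field value `X` and value `c` at the velocity `o`. -/
def specialFun (κ : ℝ) (o : G.J x) (X : TangentSpace (𝓡 4) x) (c : ℝ) (v : G.J x) : ℝ :=
  G.dt x X * (κ / 2) * G.metric x (v.sub o) (v.sub o)
    - κ * G.metric x (o.contact X) (v.sub o) + c

theorem Spacetime.J.sub_self (v : G.J x) : v.sub v = 0 := Subtype.ext (by simp)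

theorem Spacetime.J.add_sub (v : G.J x) (w : G.V x) : (v.add w).sub v = w := Subtype.ext (by simp)

theorem specialFun_self (o : G.J x) (X : TangentSpace (𝓡 4) x) (c : ℝ) :
    specialFun κ o X c o = c := by
  simp [specialFun, Spacetime.J.sub_self]

theorem hasSpecialForm_iff (o : G.J x) (X : TangentSpace (𝓡 4) x) (c : ℝ) (f : G.J x → ℝ) :
    HasSpecialForm κ o (G.dt x X) (-(o.contact X)) c f ↔ ∀ v, f v = specialFun κ o X c v := by
  simp only [HasSpecialForm, specialFun, LinearMap.BilinForm.neg_left, mul_neg, sub_eq_add_neg]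

theorem HasSpecialForm.eq_specialFun {o : G.J x} {a : ℝ} {b : G.V x} {c : ℝ} {f : G.J x → ℝ}
    (h : HasSpecialForm κ o a b c f) (v : G.J x) :
    f v = specialFun κ o (a • o.1 - (b : TangentSpace (𝓡 4) x)) c v := by
  have h1 : G.dt x o.1 = 1 := o.2
  have h2 : G.dt x (a • o.1 - (b : TangentSpace (𝓡 4) x)) = a := by simp [h1]
  have h3 : o.contact (a • o.1 - (b : TangentSpace (𝓡 4) x)) = -b :=
    Subtype.ext (by simp [h1])
  refine (hasSpecialForm_iff o _ c f).1 ?_ v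
  rw [h2, h3, neg_neg]
  exact h

/-- Re-expanding the quadratic polynomial about `o'` changes the linear coefficient by `dt(X)(o' -
o)`, which is how `contact X` changes between the two velocities. Hence `X` stays the same and only
the constant is adjusted. -/
theorem specialFun_change (o o' : G.J x) (X : TangentSpace (𝓡 4) x) (c : ℝ) (v : G.J x) :
    specialFun κ o X c v = specialFun κ o' X (specialFun κ o X c o') v := by
  have h1 : v.sub o = v.sub o' + o'.sub o := Subtype.ext (by simp)
  have h2 : o'.contact X = o.contact X - G.dt x X • o'.sub o :=
    Subtype.ext (by
      simp only [Spacetime.J.coe_contact, Submodule.coe_sub, Submodule.coe_smul,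
        Spacetime.J.coe_sub]
      module)
  simp only [specialFun, h1, h2, map_add, map_sub, map_smul, LinearMap.add_apply,
    LinearMap.sub_apply, LinearMap.smul_apply, smul_eq_mul]
  rw [G.metric_symm x (o'.sub o) (v.sub o')]
  ring

/-- The quadratic and the linear coefficients of a polynomial are determined by its values, and
together they give `dt X` and `contact X`. -/
theorem specialFun_injective (hκ : κ ≠ 0) {o o' : G.J x} {X X' : TangentSpace (𝓡 4) x} {c c' : ℝ}
    (h : ∀ v, specialFun κ o X c v = specialFun κ o' X' c' v) : X = X' := by
  have h' : ∀ v, specialFun κ o X c v = specialFun κ o X' c v := by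
    intro v
    rw [h v, specialFun_change o' o, ← h o, specialFun_self]
  have key : ∀ w : G.V x, G.dt x X * (1 / 2) * G.metric x w w - G.metric x (o.contact X) w =
      G.dt x X' * (1 / 2) * G.metric x w w - G.metric x (o.contact X') w := by
    intro w
    have := h' (o.add w)
    simp only [specialFun, Spacetime.J.add_sub] at this
    apply mul_left_cancel₀ hκ
    linear_combination this
  -- Comparing `w` with `-w` isolates the odd part; a unit vector then isolates the quadratic
  -- coefficient.
  have hθ : o.contact X = o.contact X' := by
    refine metric_ext fun w => ?_
    have h1 := key w
    have h2 := key (-w)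
    simp only [map_neg, LinearMap.neg_apply, neg_neg] at h2
    linarith
  have ha : G.dt x X = G.dt x X' := by
    obtain ⟨e, he⟩ := exists_orthonormal G x
    have h1 := key (e 0)
    rw [hθ, he, if_pos rfl] at h1
    linarith
  rw [o.eq_contact_add X, o.eq_contact_add X', hθ, ha]

/-- `fieldOf` takes some coefficients satisfying the special form; injectivity shows that any other
presentation gives the same field. -/
theorem fieldOf_eq (hκ : κ ≠ 0) {f : ∀ x, G.J x → ℝ} {o : G.J x} {X : TangentSpace (𝓡 4) x}
    {c : ℝ} (h : ∀ v, f x v = specialFun κ o X c v) : fieldOf κ f x = X := by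
  have hex : ∃ p : G.J x × ℝ × G.V x × ℝ, HasSpecialForm κ p.1 p.2.1 p.2.2.1 p.2.2.2 (f x) :=
    ⟨(o, G.dt x X, -(o.contact X), c), (hasSpecialForm_iff o X c (f x)).2 h⟩
  rw [fieldOf, dif_pos hex]
  refine specialFun_injective hκ (o := hex.choose.1) (o' := o) (c := hex.choose.2.2.2)
    (c' := c) fun v => ?_
  rw [← h v, hex.choose_spec.eq_specialFun v]

/-- A reformulation of `IsSpecial` in which the observer is arbitrary. -/
structure SpecialOn (κ : ℝ) (U : Set E) (f : ∀ x, G.J x → ℝ) : Prop where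
  form : ∀ x ∈ U, ∀ o v : G.J x, f x v = specialFun κ o (fieldOf κ f x) (f x o) v
  field : SmoothFieldOn (fieldOf κ f) U
  value : ∀ W : Set E, IsOpen W → W ⊆ U → ∀ o : ∀ y, G.J y, SmoothObsOn o W →
    SmoothFunOn (fun y => f y (o y)) W

theorem smoothFunOn_specialFun {W : Set E} (hW : IsOpen W) {o o' : ∀ y, G.J y}
    {X : ∀ y : E, TangentSpace (𝓡 4) y} {c : E → ℝ} (ho : SmoothObsOn o W)
    (hX : SmoothFieldOn X W) (hc : SmoothFunOn c W) (ho' : SmoothObsOn o' W) :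
    SmoothFunOn (fun y => specialFun κ (o y) (X y) (c y) (o' y)) W := by
  have hd : SmoothVertOn (fun y => (o' y).sub (o y)) W := ho'.sub ho
  have hθ : SmoothVertOn (fun y => (o y).contact (X y)) W := SmoothFieldOn.contact hW ho hX
  exact ((((Spacetime.dt_smooth hW hX).mul (SmoothFunOn.const _)).mul
    (SmoothVertOn.metric hW hd hd)).sub
    ((SmoothFunOn.const _).mul (SmoothVertOn.metric hW hθ hd))).add hc

/-- Coefficients relative to one local observer suffice: `specialFun_change` passes to any velocity,
and the value along any smooth observer is a polynomial expression in smooth data. -/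
theorem SpecialOn.of_local (hκ : κ ≠ 0) {U : Set E} {f : ∀ x, G.J x → ℝ}
    (h : ∀ x ∈ U, ∃ W : Set E, IsOpen W ∧ x ∈ W ∧ ∃ (o : ∀ y, G.J y)
      (X : ∀ y : E, TangentSpace (𝓡 4) y) (c : E → ℝ), SmoothObsOn o W ∧ SmoothFieldOn X W ∧
      SmoothFunOn c W ∧ ∀ y ∈ W, ∀ v, f y v = specialFun κ (o y) (X y) (c y) v) :
    SpecialOn κ U f where
  form x hx o v := by
    obtain ⟨W, hW, hxW, o', X, c, -, -, -, hf⟩ := h x hx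
    rw [fieldOf_eq hκ (hf x hxW), hf x hxW, specialFun_change _ o, hf x hxW]
  field := smoothFieldOn_of_forall fun x hx => by
    obtain ⟨W, hW, hxW, o', X, c, -, hX, -, hf⟩ := h x hx
    exact ⟨W, hW, hxW, (hX.mono Set.inter_subset_right).congr fun y hy =>
      fieldOf_eq hκ (hf y hy.2)⟩
  value V hV hVU o ho := smoothFunOn_of_forall fun x hx => by
    obtain ⟨W, hW, hxW, o', X, c, ho', hX, hc, hf⟩ := h x (hVU hx)
    refine ⟨W, hW, hxW, SmoothFunOn.congr (smoothFunOn_specialFun (κ := κ) (hV.inter hW)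
      (ho'.mono Set.inter_subset_right) (hX.mono Set.inter_subset_right)
      (hc.mono Set.inter_subset_right) (ho.mono Set.inter_subset_left)) fun y hy => hf y hy.2 _⟩

theorem IsSpecial.specialOn (hκ : κ ≠ 0) {U : Set E} {f : ∀ x, G.J x → ℝ}
    (h : IsSpecial κ U f) : SpecialOn κ U f := by
  refine SpecialOn.of_local hκ fun x hx => ?_
  obtain ⟨W, hW, hxW, -, o, a, b, c, ho, ha, hb, hc, hf⟩ := h x hx
  exact ⟨W, hW, hxW, o, _, c, ho, (SmoothFieldOn.smul ha ho).sub hb, hc,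
    fun y hy v => (hf y hy).eq_specialFun v⟩

theorem SpecialOn.isSpecial {U : Set E} (hU : IsOpen U) {f : ∀ x, G.J x → ℝ}
    (h : SpecialOn κ U f) : IsSpecial κ U f := by
  intro x hx
  obtain ⟨W, hW, hxW, o, ho, -⟩ := exists_observer x (Classical.arbitrary (G.J x))
  have hO := hU.inter hW
  have ho' := ho.mono (Set.inter_subset_right (s := U))
  have hX := h.field.mono (Set.inter_subset_left (t := W))
  refine ⟨U ∩ W, hO, ⟨hx, hxW⟩, Set.inter_subset_left, o, fun y => G.dt y (fieldOf κ f y),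
    fun y => -((o y).contact (fieldOf κ f y)), fun y => f y (o y), ho',
    Spacetime.dt_smooth hO hX, SmoothFieldOn.neg (SmoothFieldOn.contact hO ho' hX),
    h.value _ hO Set.inter_subset_left o ho', fun y hy => ?_⟩
  exact (hasSpecialForm_iff _ _ _ _).2 (h.form y hy.1 (o y))

theorem SpecialOn.mono {U V : Set E} {f : ∀ x, G.J x → ℝ} (h : SpecialOn κ U f) (hV : V ⊆ U) :
    SpecialOn κ V f :=
  ⟨fun x hx => h.form x (hV hx), h.field.mono hV, fun W hW hWV => h.value W hW (hWV.trans hV)⟩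

theorem SpecialOn.congr (hκ : κ ≠ 0) {U : Set E} {f f' : ∀ x, G.J x → ℝ}
    (h : SpecialOn κ U f) (e : ∀ x ∈ U, f' x = f x) : SpecialOn κ U f' := by
  have e' : ∀ x ∈ U, fieldOf κ f' x = fieldOf κ f x := fun x hx =>
    fieldOf_eq hκ (o := Classical.arbitrary _) fun v => by rw [e x hx, ← h.form x hx]
  exact ⟨fun x hx o v => by rw [e' x hx, e x hx]; exact h.form x hx o v, h.field.congr e',
    fun W hW hWU o ho => (h.value W hW hWU o ho).congr fun y hy => by rw [e y (hWU hy)]⟩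

end Special

/-! ### Derivatives of special functions and the scalar bracket -/

section ScalarBracket

variable {G : Spacetime E} (K : SpacetimeConnection G) {κ : ℝ} {x : E} {W : Set E}
  {f f' : ∀ x, G.J x → ℝ} {o : ∀ y, G.J y}

/-- Every linear form on the vertical space is represented by a vector. -/
theorem exists_metric_eq {φ : G.V x → ℝ} (hφ : IsLinearMap ℝ φ) :
    ∃ a : G.V x, ∀ w, G.metric x a w = φ w := by
  obtain ⟨e, he⟩ := exists_orthonormal G x
  refine ⟨∑ i, φ (e i) • e i, fun w => ?_⟩
  have h : φ w = hφ.mk' φ (∑ i, G.metric x w (e i) • e i) := by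
    rw [← eq_sum_of_orthonormal he w]; rfl
  rw [h, map_sum, map_sum, LinearMap.sum_apply]
  refine Finset.sum_congr rfl fun i _ => ?_
  rw [map_smul, map_smul, LinearMap.smul_apply, smul_eq_mul, smul_eq_mul, mul_comm, G.metric_symm]
  rfl

/-- Expanded about `v` itself the quadratic term has no first derivative, so only the linear
coefficient remains. -/
theorem SpecialOn.vertDeriv_eq (h : SpecialOn κ W f) (hx : x ∈ W) (v : G.J x) (w : G.V x) :
    vertDeriv f x v w = -(κ * G.metric x (v.contact (fieldOf κ f x)) w) := by
  have e : (fun s : ℝ => f x (v.add (s • w))) = fun s : ℝ =>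
      G.dt x (fieldOf κ f x) * (κ / 2) * (s * (s * G.metric x w w))
        - κ * (s * G.metric x (v.contact (fieldOf κ f x)) w) + f x v := by
    funext s
    rw [h.form x hx v, specialFun, Spacetime.J.add_sub]
    simp only [map_smul, LinearMap.smul_apply, smul_eq_mul]
  have hd : HasDerivAt (fun s : ℝ =>
      G.dt x (fieldOf κ f x) * (κ / 2) * (s * (s * G.metric x w w))
        - κ * (s * G.metric x (v.contact (fieldOf κ f x)) w) + f x v)
      (-(κ * G.metric x (v.contact (fieldOf κ f x)) w)) 0 := by
    have h1 := (hasDerivAt_id (0 : ℝ)).mul ((hasDerivAt_id (0 : ℝ)).mul_const (G.metric x w w))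
    have h2 := (hasDerivAt_id (0 : ℝ)).mul_const (G.metric x (v.contact (fieldOf κ f x)) w)
    have h3 := ((h1.const_mul (G.dt x (fieldOf κ f x) * (κ / 2))).sub
      (h2.const_mul κ)).add_const (f x v)
    convert! h3 using 1
    simp
  rw [vertDeriv, e, hd.deriv]

/-- Of the chosen observer only its value and its differentiability at `x` are ever used; the
results below then show that the choice is immaterial. -/
theorem observerThrough_spec (x : E) (v : G.J x) :
    DiffFieldAt (fun y => (observerThrough x v y).1) x ∧ observerThrough x v x = v := by
  have h : ∃ o : ∀ y, G.J y, ContMDiffAt (𝓡 4) (𝓡 4).tangent ∞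
      (fun y => (⟨y, (o y).1⟩ : TangentBundle (𝓡 4) E)) x ∧ o x = v := by
    obtain ⟨W, hW, hx, o, ho, hv⟩ := exists_observer x v
    exact ⟨o, ho.contMDiffAt hW hx, hv⟩
  have hs := Classical.epsilon_spec h
  exact ⟨hs.1.mdifferentiableAt (by simp), hs.2⟩

/-- The derivative of a special function along an observer, in terms of another observer. -/
theorem SpecialOn.mvfderiv_comp (h : SpecialOn κ W f) (hW : IsOpen W) (hx : x ∈ W)
    (ho : SmoothObsOn o W) {q : ∀ y, G.J y} (hq : DiffFieldAt (fun y => (q y).1) x)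
    (Y : TangentSpace (𝓡 4) x) :
    mvfderiv (𝓡 4) (fun y => f y (q y)) x Y =
      mvfderiv (𝓡 4) (fun y => G.dt y (fieldOf κ f y)) x Y * (κ / 2) *
        G.metric x ((q x).sub (o x)) ((q x).sub (o x)) +
      κ * (G.dt x (fieldOf κ f x) *
        G.metric x (K.cov (fun y => ((q y).sub (o y) : TangentSpace (𝓡 4) y)) x Y)
          ((q x).sub (o x))) -
      κ * (G.metric x (K.cov (fun y => ((o y).contact (fieldOf κ f y) :
          TangentSpace (𝓡 4) y)) x Y) ((q x).sub (o x)) +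
        G.metric x ((o x).contact (fieldOf κ f x))
          (K.cov (fun y => ((q y).sub (o y) : TangentSpace (𝓡 4) y)) x Y)) +
      mvfderiv (𝓡 4) (fun y => f y (o y)) x Y := by
  have ho' := ho.diffAt hW hx
  have hδ : DiffVertAt (fun y => (q y).sub (o y)) x := hq.sub ho'
  have hθ : DiffVertAt (fun y => (o y).contact (fieldOf κ f y)) x :=
    (SmoothFieldOn.contact hW ho h.field).diffAt hW hx
  have hA : MDifferentiableAt (𝓡 4) 𝓘(ℝ, ℝ) (fun y => G.dt y (fieldOf κ f y)) x :=
    (Spacetime.dt_smooth hW h.field).mdiffAt hW hx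
  have hc : MDifferentiableAt (𝓡 4) 𝓘(ℝ, ℝ) (fun y => f y (o y)) x :=
    (h.value W hW subset_rfl o ho).mdiffAt hW hx
  have hδδ := hδ.metric hδ
  have hθδ := hθ.metric hδ
  rw [mvfderiv_congr hW hx fun y hy => h.form y hy (o y) (q y)]
  have e : (fun y => specialFun κ (o y) (fieldOf κ f y) (f y (o y)) (q y)) = fun y =>
      ((κ / 2) * (G.dt y (fieldOf κ f y) * G.metric y ((q y).sub (o y)) ((q y).sub (o y))) -
        κ * G.metric y ((o y).contact (fieldOf κ f y)) ((q y).sub (o y))) + f y (o y) := by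
    funext y; simp only [specialFun]; ring
  have d1 : MDifferentiableAt (𝓡 4) 𝓘(ℝ, ℝ) (fun y => G.dt y (fieldOf κ f y) *
    G.metric y ((q y).sub (o y)) ((q y).sub (o y))) x := hA.mul hδδ
  have d2 : MDifferentiableAt (𝓡 4) 𝓘(ℝ, ℝ) (fun y => (κ / 2) * (G.dt y (fieldOf κ f y) *
    G.metric y ((q y).sub (o y)) ((q y).sub (o y)))) x := mdifferentiableAt_const.mul d1
  have d3 : MDifferentiableAt (𝓡 4) 𝓘(ℝ, ℝ) (fun y => κ *
    G.metric y ((o y).contact (fieldOf κ f y)) ((q y).sub (o y))) x :=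
    mdifferentiableAt_const.mul hθδ
  have d4 : MDifferentiableAt (𝓡 4) 𝓘(ℝ, ℝ) (fun y => (κ / 2) * (G.dt y (fieldOf κ f y) *
    G.metric y ((q y).sub (o y)) ((q y).sub (o y))) - κ *
    G.metric y ((o y).contact (fieldOf κ f y)) ((q y).sub (o y))) x := d2.sub d3
  rw [e, mvfderiv_add_apply _ d4 hc, mvfderiv_sub_apply _ d2 d3,
    mvfderiv_const_mul_apply _ _ d1, mvfderiv_const_mul_apply _ _ hθδ,
    mvfderiv_mul_apply _ hA hδδ, K.mvfderiv_metric hδ hδ, K.mvfderiv_metric hθ hδ,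
    G.metric_symm x ((q x).sub (o x)) (K.cov _ x Y)]
  ring

/-- The horizontal derivative of a special function, by means of any smooth observer. -/
theorem SpecialOn.horDeriv_eq (h : SpecialOn κ W f) (hW : IsOpen W) (hx : x ∈ W)
    (ho : SmoothObsOn o W) (Y : TangentSpace (𝓡 4) x) :
    horDeriv K f x (o x) Y = mvfderiv (𝓡 4) (fun y => f y (o y)) x Y +
      κ * G.metric x ((o x).contact (fieldOf κ f x)) (K.cov (fun y => (o y).1) x Y) := by
  obtain ⟨hq, hqx⟩ := observerThrough_spec x (o x)
  -- The chosen observer and `o` agree at `x`, so their difference enters only through its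
  -- derivative; the part involving the chosen observer cancels against the vertical correction in
  -- `horDeriv`.
  rw [horDeriv, h.mvfderiv_comp K hW hx ho hq, h.vertDeriv_eq hx, hqx, Spacetime.J.sub_self,
    K.cov_obs_sub hq (ho.diffAt hW hx)]
  simp only [map_zero, map_sub, mul_zero, SpacetimeConnection.cov]
  ring

theorem exists_observer_within (hW : IsOpen W) (hx : x ∈ W) (v : G.J x) :
    ∃ V : Set E, IsOpen V ∧ x ∈ V ∧ V ⊆ W ∧ ∃ o : ∀ y, G.J y, SmoothObsOn o V ∧ o x = v := by
  obtain ⟨V, hV, hxV, o, ho, hv⟩ := exists_observer x v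
  exact ⟨W ∩ V, hW.inter hV, ⟨hx, hxV⟩, Set.inter_subset_left, o,
    ho.mono Set.inter_subset_right, hv⟩

/-- A single smooth observer through `v` computes all directions at once, and `∇_Y o` is linear in
`Y`. -/
theorem SpecialOn.horDeriv_linear (h : SpecialOn κ W f) (hW : IsOpen W) (hx : x ∈ W) (v : G.J x) :
    IsLinearMap ℝ (horDeriv K f x v) := by
  obtain ⟨V, hV, hxV, hVW, o, ho, rfl⟩ := exists_observer_within hW hx v
  have ho' := ho.diffAt hV hxV
  have e : ∀ (a : ℝ) (Y Z : TangentSpace (𝓡 4) x), K.cov (fun y => (o y).1) x (a • Y + Z) =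
      a • K.cov (fun y => (o y).1) x Y + K.cov (fun y => (o y).1) x Z := fun a Y Z =>
    Subtype.ext (by
      simp only [Submodule.coe_add, Submodule.coe_smul, K.coe_cov_obs ho', map_add, map_smul])
  constructor
  · intro Y Z
    have h1 := e 1 Y Z
    rw [one_smul, one_smul] at h1
    simp only [(h.mono hVW).horDeriv_eq K hV hxV ho, map_add, h1]
    ring
  · intro a Y
    have h0 : K.cov (fun y => (o y).1) x 0 = 0 :=
      Subtype.ext (by simp only [K.coe_cov_obs ho', map_zero, Submodule.coe_zero])
    have h1 := e a Y 0
    rw [add_zero, h0, add_zero] at h1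
    simp only [(h.mono hVW).horDeriv_eq K hV hxV ho, map_smul, h1, smul_eq_mul]
    ring

theorem SpecialOn.vertDeriv_linear (h : SpecialOn κ W f) (hx : x ∈ W) (v : G.J x) :
    IsLinearMap ℝ (vertDeriv f x v) := by
  constructor
  · intro u w
    simp only [h.vertDeriv_eq hx, map_add]; ring
  · intro a u
    simp only [h.vertDeriv_eq hx, map_smul, smul_eq_mul]; ring

/-- The Hamiltonian lift of a special function. -/
theorem SpecialOn.hamiltonianLift_spec (hκ : κ ≠ 0) (h : SpecialOn κ W f) (hW : IsOpen W)
    (hx : x ∈ W) (v : G.J x) :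
    (hamiltonianLift K κ f x v).1 = (v.contact (fieldOf κ f x) : TangentSpace (𝓡 4) x) ∧
    ∀ w : G.V x, κ * G.metric x (hamiltonianLift K κ f x v).2 w =
      horDeriv K f x v (w : TangentSpace (𝓡 4) x) := by
  have hl := h.horDeriv_linear K hW hx v
  have hv := h.vertDeriv_linear hx v
  have v0 : vertDeriv f x v 0 = 0 := hv.map_zero
  have l0 : horDeriv K f x v 0 = 0 := hl.map_zero
  have hφ : IsLinearMap ℝ fun w : G.V x => κ⁻¹ * horDeriv K f x v (w : TangentSpace (𝓡 4) x) := by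
    constructor
    · intro u w
      simp only [Submodule.coe_add, hl.map_add]; ring
    · intro a u
      simp only [Submodule.coe_smul, hl.map_smul, smul_eq_mul]; ring
  obtain ⟨b, hb⟩ := exists_metric_eq hφ
  have hex : ∃ ξ : PhaseTangent G x, G.dt x ξ.1 = 0 ∧ ∀ η : PhaseTangent G x,
      Omega κ v ξ η = phaseDeriv K f x v η - phaseDeriv K f x v (gammaField v) * G.dt x η.1 := by
    -- The horizontal part of the witness is read off from the fibre derivative of `f`; its vertical
    -- part `b` represents `κ⁻¹` times the horizontal derivative in vertical directions.
    refine ⟨((v.contact (fieldOf κ f x) : TangentSpace (𝓡 4) x), b), Spacetime.dt_vert _,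
      fun η => ?_⟩
    have e1 : horDeriv K f x v η.1 = horDeriv K f x v (v.contact η.1 : TangentSpace (𝓡 4) x) +
        G.dt x η.1 * horDeriv K f x v v.1 := by
      conv_lhs => rw [v.eq_contact_add η.1, hl.map_add, hl.map_smul, smul_eq_mul]
    simp only [Omega, phaseDeriv, gammaField, hb, v0, Spacetime.J.contact_vert, e1,
      h.vertDeriv_eq hx v η.2]
    rw [G.metric_symm x η.2]
    field_simp
    ring
  obtain ⟨h1, h2⟩ := Classical.epsilon_spec hex
  change G.dt x (hamiltonianLift K κ f x v).1 = 0 at h1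
  change ∀ η : PhaseTangent G x, Omega κ v (hamiltonianLift K κ f x v) η = _ at h2
  revert h1 h2
  generalize hamiltonianLift K κ f x v = ξ
  intro h1 h2
  -- Whichever solution is chosen, testing it against `(0, w)` fixes its first component and testing
  -- against `(w, 0)` fixes its second.
  constructor
  · have h3 : v.contact ξ.1 = v.contact (fieldOf κ f x) := by
      refine metric_ext fun w => ?_
      have h4 := h2 (0, w)
      have c0 : v.contact (0 : TangentSpace (𝓡 4) x) = 0 := Subtype.ext (by simp)
      simp only [Omega, phaseDeriv, c0, map_zero, l0, h.vertDeriv_eq hx v w] at h4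
      apply mul_left_cancel₀ hκ
      rw [G.metric_symm x (v.contact ξ.1)]
      linear_combination -h4
    rw [← h3]
    simp [h1]
  · intro w
    have h4 := h2 ((w : TangentSpace (𝓡 4) x), 0)
    simp only [Omega, phaseDeriv, v0, Spacetime.J.contact_vert, map_zero, LinearMap.zero_apply,
      Spacetime.dt_vert] at h4
    linear_combination h4

/-- The scalar bracket of special functions, in terms of horizontal derivatives. -/
theorem scalarBracket_eq (hκ : κ ≠ 0) (h : SpecialOn κ W f) (h' : SpecialOn κ W f')
    (hW : IsOpen W) (hx : x ∈ W) (v : G.J x) :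
    scalarBracket K κ f f' x v =
      horDeriv K f' x v (fieldOf κ f x) - horDeriv K f x v (fieldOf κ f' x) := by
  obtain ⟨h1, h2⟩ := h.hamiltonianLift_spec K hκ hW hx v
  have hl := h.horDeriv_linear K hW hx v
  have hl' := h'.horDeriv_linear K hW hx v
  have v0 : vertDeriv f x v 0 = 0 := (h.vertDeriv_linear hx v).map_zero
  have v0' : vertDeriv f' x v 0 = 0 := (h'.vertDeriv_linear hx v).map_zero
  have e : horDeriv K f' x v (fieldOf κ f x) =
      horDeriv K f' x v (v.contact (fieldOf κ f x) : TangentSpace (𝓡 4) x) +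
        G.dt x (fieldOf κ f x) * horDeriv K f' x v v.1 := by
    conv_lhs => rw [v.eq_contact_add (fieldOf κ f x), hl'.map_add, hl'.map_smul, smul_eq_mul]
  have e' : horDeriv K f x v (fieldOf κ f' x) =
      horDeriv K f x v (v.contact (fieldOf κ f' x) : TangentSpace (𝓡 4) x) +
        G.dt x (fieldOf κ f' x) * horDeriv K f x v v.1 := by
    conv_lhs => rw [v.eq_contact_add (fieldOf κ f' x), hl.map_add, hl.map_smul, smul_eq_mul]
  -- The fibre derivative of `f'` along the lift of `f` is, by the defining property of the lift,
  -- minus the horizontal derivative of `f` along the vertical part of `X[f']`. The two `γ`-terms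
  -- then supply the parts along `v`.
  rw [scalarBracket, poisson, phaseDeriv, h1, h'.vertDeriv_eq hx, G.metric_symm x _
    (hamiltonianLift K κ f x v).2, h2, e, e']
  simp only [timeCoeff, phaseDeriv, gammaField, v0, v0']
  ring

/-- The horizontal derivative of a special function along a vector, as a special function. -/
theorem SpecialOn.horDeriv_eq_specialFun (h : SpecialOn κ W f) (hW : IsOpen W) (hx : x ∈ W)
    (ho : SmoothObsOn o W) (Y : TangentSpace (𝓡 4) x) (v : G.J x) :
    horDeriv K f x v Y = specialFun κ (o x) (K.toConn (fieldOf κ f) x Y)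
      (mvfderiv (𝓡 4) (fun y => f y (o y)) x Y +
        κ * G.metric x ((o x).contact (fieldOf κ f x)) (K.cov (fun y => (o y).1) x Y)) v := by
  obtain ⟨V, hV, hxV, hVW, q, hq, rfl⟩ := exists_observer_within hW hx v
  have ho' := ho.diffAt hW hx
  have hq' := hq.diffAt hV hxV
  have hX := h.field.diffAt hW hx
  have hA := (Spacetime.dt_smooth (G := G) hW h.field).mdiffAt hW hx
  rw [(h.mono hVW).horDeriv_eq K hV hxV hq, h.mvfderiv_comp K hW hx ho hq',
    K.cov_contact ho' hX hA, K.cov_obs_sub hq' ho', K.dt_parallel _ _ _ hX, specialFun]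
  -- Moving the base velocity from `q` to `o` makes all `∇q` terms cancel, so the result is a
  -- polynomial in `q - o` with coefficients taken along `o`.
  have e : (q x).contact (fieldOf κ f x) =
      (o x).contact (fieldOf κ f x) - G.dt x (fieldOf κ f x) • (q x).sub (o x) :=
    Subtype.ext (by
      simp only [Spacetime.J.coe_contact, Submodule.coe_sub, Submodule.coe_smul,
        Spacetime.J.coe_sub]
      module)
  simp only [e, map_sub, map_smul, LinearMap.sub_apply, LinearMap.smul_apply, smul_eq_mul]
  rw [G.metric_symm x ((q x).sub (o x)) (K.cov (fun y => (q y).1) x Y)]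
  ring

theorem specialFun_sub (o : G.J x) (X X' : TangentSpace (𝓡 4) x) (c c' : ℝ) (v : G.J x) :
    specialFun κ o X c v - specialFun κ o X' c' v = specialFun κ o (X - X') (c - c') v := by
  simp only [specialFun, Spacetime.J.contact_sub, map_sub, LinearMap.sub_apply]
  ring

/-- The value along an observer of the scalar bracket. -/
def bracketValue (κ : ℝ) (o : ∀ y, G.J y) (X X' : ∀ y : E, TangentSpace (𝓡 4) y)
    (c c' : E → ℝ) (x : E) : ℝ :=
  mvfderiv (𝓡 4) c' x (X x) - mvfderiv (𝓡 4) c x (X' x) +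
    κ * (G.metric x ((o x).contact (X' x)) (K.cov (fun y => (o y).1) x (X x)) -
      G.metric x ((o x).contact (X x)) (K.cov (fun y => (o y).1) x (X' x)))

/-- The scalar bracket of special functions is special, with the Lie bracket of the two fields as
its vector field. -/
theorem scalarBracket_eq_specialFun (hκ : κ ≠ 0) (h : SpecialOn κ W f) (h' : SpecialOn κ W f')
    (hW : IsOpen W) (hx : x ∈ W) (ho : SmoothObsOn o W) (v : G.J x) :
    scalarBracket K κ f f' x v =
      specialFun κ (o x) (VectorField.mlieBracket (𝓡 4) (fieldOf κ f) (fieldOf κ f') x)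
        (bracketValue K κ o (fieldOf κ f) (fieldOf κ f') (fun y => f y (o y))
          (fun y => f' y (o y)) x) v := by
  -- The fields of the two horizontal derivatives are `∇_X X'` and `∇_{X'} X`; torsion-freeness
  -- identifies their difference with the Lie bracket.
  rw [scalarBracket_eq K hκ h h' hW hx, h'.horDeriv_eq_specialFun K hW hx ho,
    h.horDeriv_eq_specialFun K hW hx ho, specialFun_sub,
    K.torsion_free _ _ _ (h.field.diffAt hW hx) (h'.field.diffAt hW hx)]
  congr 1
  simp only [bracketValue]
  ring

variable {K} in
theorem smoothFunOn_bracketValue [T2Space E] {X X' : ∀ y : E, TangentSpace (𝓡 4) y}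
    {c c' : E → ℝ} (hW : IsOpen W) (ho : SmoothObsOn o W) (hX : SmoothFieldOn X W)
    (hX' : SmoothFieldOn X' W) (hc : SmoothFunOn c W) (hc' : SmoothFunOn c' W) :
    SmoothFunOn (bracketValue K κ o X X' c c') W :=
  ((hc'.deriv hW hX).sub (hc.deriv hW hX')).add ((SmoothFunOn.const κ).mul
    ((SmoothVertOn.metric hW (SmoothFieldOn.contact hW ho hX') (SmoothObsOn.cov hW hX ho)).sub
      (SmoothVertOn.metric hW (SmoothFieldOn.contact hW ho hX) (SmoothObsOn.cov hW hX' ho))))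

variable {K} in
theorem SpecialOn.scalarBracket [T2Space E] (hκ : κ ≠ 0) (h : SpecialOn κ W f)
    (h' : SpecialOn κ W f') (hW : IsOpen W) : SpecialOn κ W (scalarBracket K κ f f') := by
  refine SpecialOn.of_local hκ fun x hx => ?_
  obtain ⟨V, hV, hxV, hVW, o, ho, -⟩ := exists_observer_within hW hx (Classical.arbitrary (G.J x))
  have k := h.mono hVW
  have k' := h'.mono hVW
  exact ⟨V, hV, hxV, o, _, _, ho, k.field.mlieBracket hV k'.field,
    smoothFunOn_bracketValue (κ := κ) hV ho k.field k'.field (k.value V hV subset_rfl o ho)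
      (k'.value V hV subset_rfl o ho),
    fun y hy v => scalarBracket_eq_specialFun K hκ k k' hV hy ho v⟩

theorem fieldOf_scalarBracket (hκ : κ ≠ 0) (h : SpecialOn κ W f)
    (h' : SpecialOn κ W f') (hW : IsOpen W) (hx : x ∈ W) :
    fieldOf κ (scalarBracket K κ f f') x =
      VectorField.mlieBracket (𝓡 4) (fieldOf κ f) (fieldOf κ f') x := by
  obtain ⟨V, hV, hxV, hVW, o, ho, -⟩ := exists_observer_within hW hx (Classical.arbitrary (G.J x))
  exact fieldOf_eq hκ fun v => scalarBracket_eq_specialFun K hκ (h.mono hVW) (h'.mono hVW) hV hxV ho v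

theorem scalarBracket_comp (hκ : κ ≠ 0) (h : SpecialOn κ W f) (h' : SpecialOn κ W f')
    (hW : IsOpen W) (hx : x ∈ W) (ho : SmoothObsOn o W) :
    scalarBracket K κ f f' x (o x) = bracketValue K κ o (fieldOf κ f) (fieldOf κ f')
      (fun y => f y (o y)) (fun y => f' y (o y)) x := by
  rw [scalarBracket_eq_specialFun K hκ h h' hW hx ho, specialFun_self]

end ScalarBracket

/-! ### The Jacobi identity of the scalar bracket -/

section ScalarJacobi

variable [T2Space E] {G : Spacetime E} (K : SpacetimeConnection G) {κ : ℝ} {x : E} {W : Set E}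
  {o : ∀ y, G.J y} {X₁ X₂ X₃ : ∀ y : E, TangentSpace (𝓡 4) y} {c₁ c₂ c₃ : E → ℝ}

/-- The metric product rule applied to the twisting two-form. The terms with `dt(X₂)` and `dt(X₃)`
come from differentiating the projection along `o`, and drop out of the cyclic sum by symmetry of
the metric. -/
theorem mvfderiv_bracketValue (hW : IsOpen W) (hx : x ∈ W) (ho : SmoothObsOn o W)
    (hX₂ : SmoothFieldOn X₂ W) (hX₃ : SmoothFieldOn X₃ W) (hc₂ : SmoothFunOn c₂ W)
    (hc₃ : SmoothFunOn c₃ W) (Y : TangentSpace (𝓡 4) x) :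
    mvfderiv (𝓡 4) (bracketValue K κ o X₂ X₃ c₂ c₃) x Y =
      mvfderiv (𝓡 4) (fun y => mvfderiv (𝓡 4) c₃ y (X₂ y)) x Y -
        mvfderiv (𝓡 4) (fun y => mvfderiv (𝓡 4) c₂ y (X₃ y)) x Y +
      κ * (G.metric x ((o x).contact (K.toConn X₃ x Y) - G.dt x (X₃ x) • K.cov (fun y => (o y).1) x Y)
            (K.cov (fun y => (o y).1) x (X₂ x)) +
          G.metric x ((o x).contact (X₃ x)) (K.cov (fun y =>
            (K.cov (fun y => (o y).1) y (X₂ y) : TangentSpace (𝓡 4) y)) x Y) -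
          (G.metric x ((o x).contact (K.toConn X₂ x Y) - G.dt x (X₂ x) • K.cov (fun y => (o y).1) x Y)
            (K.cov (fun y => (o y).1) x (X₃ x)) +
          G.metric x ((o x).contact (X₂ x)) (K.cov (fun y =>
            (K.cov (fun y => (o y).1) y (X₃ y) : TangentSpace (𝓡 4) y)) x Y))) := by
  have t₂ := SmoothFieldOn.contact hW ho hX₂
  have t₃ := SmoothFieldOn.contact hW ho hX₃
  have n₂ := SmoothObsOn.cov (K := K) hW hX₂ ho
  have n₃ := SmoothObsOn.cov (K := K) hW hX₃ ho
  have m₃₂ := (SmoothVertOn.metric hW t₃ n₂).mdiffAt hW hx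
  have m₂₃ := (SmoothVertOn.metric hW t₂ n₃).mdiffAt hW hx
  have d₃ := (hc₃.deriv hW hX₂).mdiffAt hW hx
  have d₂ := (hc₂.deriv hW hX₃).mdiffAt hW hx
  have e1 : MDifferentiableAt (𝓡 4) 𝓘(ℝ, ℝ) (fun y => mvfderiv (𝓡 4) c₃ y (X₂ y) -
      mvfderiv (𝓡 4) c₂ y (X₃ y)) x := d₃.sub d₂
  have e2 : MDifferentiableAt (𝓡 4) 𝓘(ℝ, ℝ) (fun y =>
      G.metric y ((o y).contact (X₃ y)) (K.cov (fun y => (o y).1) y (X₂ y)) -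
        G.metric y ((o y).contact (X₂ y)) (K.cov (fun y => (o y).1) y (X₃ y))) x := m₃₂.sub m₂₃
  have e3 : MDifferentiableAt (𝓡 4) 𝓘(ℝ, ℝ) (fun y => κ *
      (G.metric y ((o y).contact (X₃ y)) (K.cov (fun y => (o y).1) y (X₂ y)) -
        G.metric y ((o y).contact (X₂ y)) (K.cov (fun y => (o y).1) y (X₃ y)))) x :=
    mdifferentiableAt_const.mul e2
  have ho' := ho.diffAt hW hx
  have k₂ := K.cov_contact ho' (hX₂.diffAt hW hx)
    ((Spacetime.dt_smooth (G := G) hW hX₂).mdiffAt hW hx) Y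
  have k₃ := K.cov_contact ho' (hX₃.diffAt hW hx)
    ((Spacetime.dt_smooth (G := G) hW hX₃).mdiffAt hW hx) Y
  have h1 := mvfderiv_add_apply Y e1 e3
  rw [mvfderiv_sub_apply Y d₃ d₂, mvfderiv_const_mul_apply Y κ e2, mvfderiv_sub_apply Y m₃₂ m₂₃,
    K.mvfderiv_metric (t₃.diffAt hW hx) (n₂.diffAt hW hx),
    K.mvfderiv_metric (t₂.diffAt hW hx) (n₃.diffAt hW hx), k₂, k₃] at h1
  exact h1

theorem contact_mlieBracket (hW : IsOpen W) (hx : x ∈ W)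
    (hX₁ : SmoothFieldOn X₁ W) (hX₂ : SmoothFieldOn X₂ W) (v : G.J x) :
    v.contact (VectorField.mlieBracket (𝓡 4) X₁ X₂ x) =
      v.contact (K.toConn X₂ x (X₁ x)) - v.contact (K.toConn X₁ x (X₂ x)) := by
  rw [← K.torsion_free _ _ _ (hX₁.diffAt hW hx) (hX₂.diffAt hW hx), Spacetime.J.contact_sub]

/-- The derivatives of the `c` cancel because Lie brackets act as commutators. What remains is the
exterior derivative of the twisting form: the second derivatives of `o` assemble into curvature
applied to `o`, and the cyclic sum vanishes by `curvature_cyclic`. -/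
theorem bracketValue_jacobi (hW : IsOpen W) (hx : x ∈ W) (ho : SmoothObsOn o W)
    (hX₁ : SmoothFieldOn X₁ W) (hX₂ : SmoothFieldOn X₂ W) (hX₃ : SmoothFieldOn X₃ W)
    (hc₁ : SmoothFunOn c₁ W) (hc₂ : SmoothFunOn c₂ W) (hc₃ : SmoothFunOn c₃ W) :
    bracketValue K κ o X₁ (VectorField.mlieBracket (𝓡 4) X₂ X₃) c₁
        (bracketValue K κ o X₂ X₃ c₂ c₃) x +
      bracketValue K κ o X₂ (VectorField.mlieBracket (𝓡 4) X₃ X₁) c₂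
        (bracketValue K κ o X₃ X₁ c₃ c₁) x +
      bracketValue K κ o X₃ (VectorField.mlieBracket (𝓡 4) X₁ X₂) c₃
        (bracketValue K κ o X₁ X₂ c₁ c₂) x = 0 := by
  have R := K.curvature_cyclic (o x) (X₁ x) (X₂ x) (X₃ x)
  rw [Spacetime.toVert_eq (K.curvature_obs hW hx hX₂ hX₃ ho),
    Spacetime.toVert_eq (K.curvature_obs hW hx hX₃ hX₁ ho),
    Spacetime.toVert_eq (K.curvature_obs hW hx hX₁ hX₂ ho)] at R
  rw [bracketValue, bracketValue, bracketValue,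
    mvfderiv_bracketValue K hW hx ho hX₂ hX₃ hc₂ hc₃,
    mvfderiv_bracketValue K hW hx ho hX₃ hX₁ hc₃ hc₁,
    mvfderiv_bracketValue K hW hx ho hX₁ hX₂ hc₁ hc₂,
    mvfderiv_mlieBracket hW hx hc₁ hX₂ hX₃, mvfderiv_mlieBracket hW hx hc₂ hX₃ hX₁,
    mvfderiv_mlieBracket hW hx hc₃ hX₁ hX₂, contact_mlieBracket K hW hx hX₂ hX₃,
    contact_mlieBracket K hW hx hX₃ hX₁, contact_mlieBracket K hW hx hX₁ hX₂]
  simp only [map_sub, map_smul, LinearMap.sub_apply, LinearMap.smul_apply, smul_eq_mul] at R ⊢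
  have s12 := G.metric_symm x (K.cov (fun y => (o y).1) x (X₁ x)) (K.cov (fun y => (o y).1) x (X₂ x))
  have s13 := G.metric_symm x (K.cov (fun y => (o y).1) x (X₁ x)) (K.cov (fun y => (o y).1) x (X₃ x))
  have s23 := G.metric_symm x (K.cov (fun y => (o y).1) x (X₂ x)) (K.cov (fun y => (o y).1) x (X₃ x))
  rw [s12, s13, s23]
  linear_combination κ * R

/-- It is enough to evaluate along one smooth observer through the given velocity. The inner bracket
equals its `bracketValue` on a whole neighbourhood and may therefore be differentiated in that form.
-/
theorem scalarBracket_jacobi (hκ : κ ≠ 0) {f₁ f₂ f₃ : ∀ x, G.J x → ℝ} (hW : IsOpen W)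
    (h₁ : SpecialOn κ W f₁) (h₂ : SpecialOn κ W f₂) (h₃ : SpecialOn κ W f₃) (hx : x ∈ W)
    (v : G.J x) :
    scalarBracket K κ f₁ (scalarBracket K κ f₂ f₃) x v +
      scalarBracket K κ f₂ (scalarBracket K κ f₃ f₁) x v +
      scalarBracket K κ f₃ (scalarBracket K κ f₁ f₂) x v = 0 := by
  obtain ⟨V, hV, hxV, hVW, o, ho, rfl⟩ := exists_observer_within hW hx v
  replace h₁ := h₁.mono hVW
  replace h₂ := h₂.mono hVW
  replace h₃ := h₃.mono hVW
  have key : ∀ {f g h : ∀ x, G.J x → ℝ}, SpecialOn κ V f → SpecialOn κ V g → SpecialOn κ V h →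
      scalarBracket K κ f (scalarBracket K κ g h) x (o x) =
        bracketValue K κ o (fieldOf κ f)
          (VectorField.mlieBracket (𝓡 4) (fieldOf κ g) (fieldOf κ h)) (fun y => f y (o y))
          (bracketValue K κ o (fieldOf κ g) (fieldOf κ h) (fun y => g y (o y))
            (fun y => h y (o y))) x := by
    intro f g h hf hg hh
    rw [scalarBracket_comp K hκ hf (hg.scalarBracket hκ hh hV) hV hxV ho, bracketValue,
      bracketValue, fieldOf_scalarBracket K hκ hg hh hV hxV,
      mvfderiv_congr hV hxV fun y hy => scalarBracket_comp K hκ hg hh hV hy ho]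
  rw [key h₁ h₂ h₃, key h₂ h₃ h₁, key h₃ h₁ h₂]
  exact bracketValue_jacobi K hV hxV ho h₁.field h₂.field h₃.field
    (h₁.value V hV subset_rfl o ho) (h₂.value V hV subset_rfl o ho) (h₃.value V hV subset_rfl o ho)

end ScalarJacobi

/-! ### The cross product of vertical vectors -/

section CrossProduct

variable {G : Spacetime E} {x : E} {e : Fin 3 → G.V x}

theorem sharp_spec {φ : G.V x → ℝ} (hφ : IsLinearMap ℝ φ) (w : G.V x) :
    G.metric x (sharp φ) w = φ w :=
  Classical.epsilon_spec (exists_metric_eq hφ) w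

theorem sharp_eq {φ : G.V x → ℝ} {a : G.V x} (h : ∀ w, G.metric x a w = φ w) : sharp φ = a :=
  metric_ext fun w => by
    rw [h, sharp_spec (φ := φ)]
    exact ⟨fun u w => by simp only [← h, map_add], fun c u => by simp only [← h, map_smul]⟩

theorem isLinearMap_metric (a : G.V x) : IsLinearMap ℝ fun w => G.metric x a w :=
  ⟨fun u w => map_add _ u w, fun c u => map_smul _ c u⟩

theorem isLinearMap_vol (u w : G.V x) : IsLinearMap ℝ fun z => G.vol x ![u, w, z] := by
  have e : ∀ z, ![u, w, z] = Function.update ![u, w, u] 2 z := by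
    intro z; funext i; fin_cases i <;> rfl
  constructor
  · intro z z'
    rw [e (z + z'), AlternatingMap.map_update_add, ← e z, ← e z']
  · intro c z
    rw [e (c • z), AlternatingMap.map_update_smul, ← e z]

/-- The cross product of vertical vectors. -/
def vcross (u w : G.V x) : G.V x := sharp fun z => G.vol x ![u, w, z]

theorem metric_vcross (u w z : G.V x) : G.metric x (vcross u w) z = G.vol x ![u, w, z] :=
  sharp_spec (isLinearMap_vol u w) z

theorem cross_eq (φ ψ : G.V x → ℝ) (z : G.V x) :
    cross φ ψ z = G.metric x (vcross (sharp φ) (sharp ψ)) z := (metric_vcross _ _ _).symm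

variable (he : ∀ i j, G.metric x (e i) (e j) = if i = j then 1 else 0)
include he

theorem metric_frame :
    (G.metric x (e 0) (e 0) = 1 ∧ G.metric x (e 0) (e 1) = 0 ∧ G.metric x (e 0) (e 2) = 0) ∧
    (G.metric x (e 1) (e 0) = 0 ∧ G.metric x (e 1) (e 1) = 1 ∧ G.metric x (e 1) (e 2) = 0) ∧
    G.metric x (e 2) (e 0) = 0 ∧ G.metric x (e 2) (e 1) = 0 ∧ G.metric x (e 2) (e 2) = 1 := by
  simp [he]

theorem metric_eq_sum (u w : G.V x) : G.metric x u w =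
    G.metric x u (e 0) * G.metric x w (e 0) + G.metric x u (e 1) * G.metric x w (e 1) +
      G.metric x u (e 2) * G.metric x w (e 2) := by
  conv_lhs => rw [eq_sum_of_orthonormal he w]
  simp only [map_add, map_smul, smul_eq_mul, Fin.sum_univ_three]
  ring

theorem ext_of_orthonormal {u w : G.V x} (h0 : G.metric x u (e 0) = G.metric x w (e 0))
    (h1 : G.metric x u (e 1) = G.metric x w (e 1))
    (h2 : G.metric x u (e 2) = G.metric x w (e 2)) : u = w :=
  metric_ext fun z => by rw [metric_eq_sum he u, metric_eq_sum he w, h0, h1, h2]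

theorem vol_sq_of_orthonormal : G.vol x e ^ 2 = 1 := by
  rw [G.vol_sq, Matrix.det_fin_three]
  simp [he]

/-- A top-degree alternating form is a multiple of the determinant of coordinates. The factor `G.vol
x e` is the sign of the frame, kept as an unknown so that no frame need be positively oriented. -/
theorem vol_eq (u w z : G.V x) : G.vol x ![u, w, z] = G.vol x e *
    (G.metric x u (e 0) * (G.metric x w (e 1) * G.metric x z (e 2)) -
      G.metric x u (e 0) * (G.metric x w (e 2) * G.metric x z (e 1)) -
      G.metric x u (e 1) * (G.metric x w (e 0) * G.metric x z (e 2)) +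
      G.metric x u (e 1) * (G.metric x w (e 2) * G.metric x z (e 0)) +
      G.metric x u (e 2) * (G.metric x w (e 0) * G.metric x z (e 1)) -
      G.metric x u (e 2) * (G.metric x w (e 1) * G.metric x z (e 0))) := by
  have := finite_V G x
  have hli : LinearIndependent ℝ e := by
    rw [Fintype.linearIndependent_iff]
    intro g hg i
    have h := congrArg (fun w => G.metric x w (e i)) hg
    simpa [map_sum, he] using h
  have hspan : ⊤ ≤ Submodule.span ℝ (Set.range e) :=
    (hli.span_eq_top_of_card_eq_finrank (by rw [finrank_V]; simp)).ge
  let b := Module.Basis.mk hli hspan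
  have hb : ⇑b = e := by funext i; simp [b]
  have hr : ∀ (u : G.V x) i, b.repr u i = G.metric x u (e i) := by
    intro u i
    have hu := b.sum_repr u
    rw [hb] at hu
    conv_rhs => rw [← hu]
    simp [map_sum, he]
  have h := congrArg (fun L => L ![u, w, z]) ((G.vol x).eq_smul_basis_det b)
  simp only [AlternatingMap.smul_apply, Module.Basis.det_apply, hb, Matrix.det_fin_three,
    smul_eq_mul, Module.Basis.toMatrix_apply, hr, Matrix.cons_val] at h
  rw [h]
  ring

theorem metric_vcross_zero (u w : G.V x) : G.metric x (vcross u w) (e 0) = G.vol x e *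
    (G.metric x u (e 1) * G.metric x w (e 2) - G.metric x u (e 2) * G.metric x w (e 1)) := by
  rw [metric_vcross, vol_eq he, he 0 0, he 0 1, he 0 2, if_pos rfl, if_neg (by decide),
    if_neg (by decide)]
  ring

theorem metric_vcross_one (u w : G.V x) : G.metric x (vcross u w) (e 1) = G.vol x e *
    (G.metric x u (e 2) * G.metric x w (e 0) - G.metric x u (e 0) * G.metric x w (e 2)) := by
  rw [metric_vcross, vol_eq he, he 1 1, he 1 0, he 1 2, if_pos rfl, if_neg (by decide),
    if_neg (by decide)]
  ring

theorem metric_vcross_two (u w : G.V x) : G.metric x (vcross u w) (e 2) = G.vol x e *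
    (G.metric x u (e 0) * G.metric x w (e 1) - G.metric x u (e 1) * G.metric x w (e 0)) := by
  rw [metric_vcross, vol_eq he, he 2 2, he 2 0, he 2 1, if_pos rfl, if_neg (by decide),
    if_neg (by decide)]
  ring

omit he

theorem vcross_add_left (u u' w : G.V x) : vcross (u + u') w = vcross u w + vcross u' w := by
  obtain ⟨e, he⟩ := exists_orthonormal G x
  refine ext_of_orthonormal he ?_ ?_ ?_ <;>
  · simp only [map_add, LinearMap.add_apply, metric_vcross_zero he, metric_vcross_one he,
      metric_vcross_two he]
    ring

theorem vcross_smul_left (a : ℝ) (u w : G.V x) : vcross (a • u) w = a • vcross u w := by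
  obtain ⟨e, he⟩ := exists_orthonormal G x
  refine ext_of_orthonormal he ?_ ?_ ?_ <;>
  · simp only [map_smul, LinearMap.smul_apply, smul_eq_mul, metric_vcross_zero he,
      metric_vcross_one he, metric_vcross_two he]
    ring

theorem vcross_antisymm (u w : G.V x) : vcross u w = -vcross w u := by
  obtain ⟨e, he⟩ := exists_orthonormal G x
  refine ext_of_orthonormal he ?_ ?_ ?_ <;>
  · simp only [map_neg, LinearMap.neg_apply, metric_vcross_zero he, metric_vcross_one he,
      metric_vcross_two he]
    ring

theorem vcross_add_right (u w w' : G.V x) : vcross u (w + w') = vcross u w + vcross u w' := by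
  rw [vcross_antisymm, vcross_add_left, vcross_antisymm w, vcross_antisymm w']; abel

theorem vcross_smul_right (a : ℝ) (u w : G.V x) : vcross u (a • w) = a • vcross u w := by
  rw [vcross_antisymm, vcross_smul_left, vcross_antisymm w, smul_neg, neg_neg]

theorem vcross_neg_left (u w : G.V x) : vcross (-u) w = -vcross u w := by
  rw [← neg_one_smul ℝ u, vcross_smul_left, neg_one_smul]

theorem vcross_sub_left (u u' w : G.V x) : vcross (u - u') w = vcross u w - vcross u' w := by
  rw [sub_eq_add_neg, vcross_add_left, vcross_neg_left, ← sub_eq_add_neg]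

theorem vcross_sub_right (u w w' : G.V x) : vcross u (w - w') = vcross u w - vcross u w' := by
  rw [vcross_antisymm, vcross_sub_left, vcross_antisymm w, vcross_antisymm w']; abel

/-- Each double product carries the square of the orientation sign as a common factor, so the
identity is polynomial in the coordinates. -/
theorem vcross_jacobi (p q u : G.V x) :
    vcross p (vcross q u) - vcross q (vcross p u) = vcross (vcross p q) u := by
  obtain ⟨e, he⟩ := exists_orthonormal G x
  refine ext_of_orthonormal he ?_ ?_ ?_ <;>
  · simp only [map_sub, LinearMap.sub_apply, metric_vcross_zero he, metric_vcross_one he,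
      metric_vcross_two he]
    ring

/-- Faithfulness of the cross-product action. It lets identities between vertical vectors be checked
on endomorphisms. -/
theorem eq_zero_of_vcross {p : G.V x} (h : ∀ u, vcross p u = 0) : p = 0 := by
  obtain ⟨e, he⟩ := exists_orthonormal G x
  have hs : G.vol x e ≠ 0 := fun h0 => by
    have := vol_sq_of_orthonormal he
    rw [h0] at this
    norm_num at this
  have h1 := metric_vcross_zero he p (e 1)
  have h2 := metric_vcross_one he p (e 2)
  have h3 := metric_vcross_two he p (e 0)
  simp [h, he, hs] at h1 h2 h3
  exact ext_of_orthonormal he (by simpa using h2) (by simpa using h3) (by simpa using h1)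

theorem orthonormalFrame_spec (G : Spacetime E) (x : E) (i j : Fin 3) :
    G.metric x (orthonormalFrame G x i) (orthonormalFrame G x j) = if i = j then 1 else 0 :=
  Classical.epsilon_spec (exists_orthonormal G x) i j

theorem isLinearMap_triangle (A : G.V x → G.V x) : IsLinearMap ℝ (triangle A) := by
  constructor
  · intro u w
    simp only [triangle, (isLinearMap_vol _ _).map_add, Finset.sum_add_distrib]
  · intro a u
    simp only [triangle, (isLinearMap_vol _ _).map_smul, ← Finset.smul_sum]

/-- An antisymmetric endomorphism `A` is the cross product with the vector `-½ ▷A`. -/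
theorem vcross_sharp_triangle {A : G.V x → G.V x} (hA : IsLinearMap ℝ A)
    (hs : ∀ u w, G.metric x (A u) w = -G.metric x u (A w)) (w : G.V x) :
    vcross (sharp fun z => -(1 / 2) * triangle A z) w = A w := by
  have hl : IsLinearMap ℝ fun z => -(1 / 2) * triangle A z := by
    have h := isLinearMap_triangle A
    constructor
    · intro u w; rw [h.map_add]; ring
    · intro a u; rw [h.map_smul, smul_eq_mul, smul_eq_mul]; ring
  have he := orthonormalFrame_spec G x
  generalize hr : (sharp fun z => -(1 / 2) * triangle A z) = r
  have hz : ∀ z, G.metric x r z = -(1 / 2) * triangle A z := fun z => by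
    rw [← hr, sharp_spec hl]
  have z0 := hz (orthonormalFrame G x 0)
  have z1 := hz (orthonormalFrame G x 1)
  have z2 := hz (orthonormalFrame G x 2)
  have hw : A w = ∑ i, G.metric x w (orthonormalFrame G x i) • A (orthonormalFrame G x i) := by
    conv_lhs => rw [eq_sum_of_orthonormal he w]
    change hA.mk' A _ = _
    rw [map_sum]
    simp only [map_smul]
    rfl
  simp only [triangle] at z0 z1 z2
  generalize orthonormalFrame G x = e at *
  -- The matrix of `A` is antisymmetric, hence given by three entries. The remaining products
  -- contain the orientation sign squared, which `hv` evaluates to `1`.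
  have a : ∀ i j, G.metric x (A (e i)) (e j) = -G.metric x (A (e j)) (e i) := fun i j => by
    rw [hs, G.metric_symm]
  have a' : ∀ i, G.metric x (A (e i)) (e i) = 0 := fun i => by linarith [a i i]
  obtain ⟨⟨e00, e01, e02⟩, ⟨e10, e11, e12⟩, e20, e21, e22⟩ := metric_frame he
  have hv := vol_sq_of_orthonormal he
  simp only [Fin.sum_univ_three, ← metric_vcross, metric_vcross_zero he, metric_vcross_one he,
    metric_vcross_two he, e00, e11, e22, e01, e02, e10, e12, e20, e21, a', a 1 0, a 2 0,
    a 2 1] at z0 z1 z2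
  refine ext_of_orthonormal he ?_ ?_ ?_
  · rw [metric_vcross_zero he, hw, z1, z2]
    simp only [Fin.sum_univ_three, map_add, map_smul, LinearMap.add_apply, LinearMap.smul_apply,
      smul_eq_mul, a', a 1 0, a 2 0]
    linear_combination (-G.metric x w (e 2) * G.metric x (A (e 0)) (e 2) -
      G.metric x w (e 1) * G.metric x (A (e 0)) (e 1)) * hv
  · rw [metric_vcross_one he, hw, z0, z2]
    simp only [Fin.sum_univ_three, map_add, map_smul, LinearMap.add_apply, LinearMap.smul_apply,
      smul_eq_mul, a', a 2 1]
    linear_combination (G.metric x w (e 0) * G.metric x (A (e 0)) (e 1) -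
      G.metric x w (e 2) * G.metric x (A (e 1)) (e 2)) * hv
  · rw [metric_vcross_two he, hw, z0, z1]
    simp only [Fin.sum_univ_three, map_add, map_smul, LinearMap.add_apply, LinearMap.smul_apply,
      smul_eq_mul, a']
    linear_combination (G.metric x w (e 0) * G.metric x (A (e 0)) (e 2) +
      G.metric x w (e 1) * G.metric x (A (e 1)) (e 2)) * hv

/-- The vector of an antisymmetric endomorphism, in an arbitrary orthonormal frame. -/
theorem sum_vcross_vcross (he : ∀ i j, G.metric x (e i) (e j) = if i = j then 1 else 0)
    (r : G.V x) : r = (1 / 2 : ℝ) • ∑ i, vcross (e i) (vcross r (e i)) := by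
  obtain ⟨⟨e00, e01, e02⟩, ⟨e10, e11, e12⟩, e20, e21, e22⟩ := metric_frame he
  have hv := vol_sq_of_orthonormal he
  -- The double cross product contributes the squared orientation sign; inserting it on the other
  -- side makes the identity polynomial.
  have h : ∀ a b : ℝ, b = G.vol x e ^ 2 * a → a = b := fun a b h => by rw [h, hv, one_mul]
  refine ext_of_orthonormal he ?_ ?_ ?_ <;>
  · apply h
    simp only [Fin.sum_univ_three, map_add, map_smul, LinearMap.add_apply, LinearMap.smul_apply,
      smul_eq_mul, metric_vcross_zero he, metric_vcross_one he, metric_vcross_two he,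
      e00, e11, e22, e01, e02, e10, e12, e20, e21]
    ring

end CrossProduct

/-! ### The vertical volume form is parallel -/

section VolumeParallel

variable {G : Spacetime E} {W : Set E} {x : E}

/-- In a smooth local orthonormal frame the coefficients of `P` are its scalar products with the
frame. -/
theorem smoothVertOn_of_metric {P : ∀ y, G.V y} (hW : IsOpen W)
    (h : ∀ V : Set E, IsOpen V → V ⊆ W → ∀ u : ∀ y, G.V y, SmoothVertOn u V →
      SmoothFunOn (fun y => G.metric y (P y) (u y)) V) : SmoothVertOn P W :=
  smoothFieldOn_of_forall fun x _ => by
    obtain ⟨U, hU, hxU, e, he, hon⟩ := exists_orthonormalFrame G x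
    have he' : ∀ i, SmoothVertOn (e i) (W ∩ U) := fun i => (he i).mono Set.inter_subset_right
    refine ⟨U, hU, hxU, SmoothFieldOn.congr (SmoothFieldOn.sum (s := Finset.univ) fun i _ =>
      SmoothFieldOn.smul (h _ (hW.inter hU) Set.inter_subset_left (e i) (he' i)) (he' i))
      fun y hy => ?_⟩
    conv_lhs => rw [eq_sum_of_orthonormal (hon y hy.2) (P y)]
    simp

theorem IsCovectorFieldOn.sharp {φ : ∀ x, G.V x → ℝ} (hW : IsOpen W)
    (h : IsCovectorFieldOn W φ) : SmoothVertOn (fun y => sharp (φ y)) W :=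
  smoothVertOn_of_metric hW fun V hV hVW u hu => (h.2 V hV hVW u hu).congr fun y hy =>
    sharp_spec (h.1 y (hVW hy)) _

theorem SmoothVertOn.isCovectorFieldOn {P : ∀ y, G.V y} (h : SmoothVertOn P W)
    {φ : ∀ x, G.V x → ℝ} (hφ : ∀ x ∈ W, ∀ w, φ x w = G.metric x (P x) w) :
    IsCovectorFieldOn W φ := by
  refine ⟨fun x hx => ?_, fun V hV hVW w hw => ?_⟩
  · rw [show φ x = fun w => G.metric x (P x) w from funext (hφ x hx)]
    exact isLinearMap_metric _
  · exact (SmoothVertOn.metric hV (h.mono hVW) hw).congr fun y hy => hφ y (hVW hy) _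

theorem SmoothVertOn.vol {P Q R : ∀ y, G.V y} (hW : IsOpen W) (hP : SmoothVertOn P W)
    (hQ : SmoothVertOn Q W) (hR : SmoothVertOn R W) :
    SmoothFunOn (fun y => G.vol y ![P y, Q y, R y]) W := by
  have h := G.vol_smooth W hW ![P, Q, R] (by
    intro i; fin_cases i; exacts [hP, hQ, hR])
  refine h.congr fun y _ => ?_
  congr 1
  funext i
  fin_cases i <;> rfl

theorem SmoothVertOn.vcross {P Q : ∀ y, G.V y} (hW : IsOpen W) (hP : SmoothVertOn P W)
    (hQ : SmoothVertOn Q W) : SmoothVertOn (fun y => vcross (P y) (Q y)) W :=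
  smoothVertOn_of_metric hW fun _ hV hVW _ hu =>
    (SmoothVertOn.vol hV (hP.mono hVW) (hQ.mono hVW) hu).congr fun _ _ => metric_vcross _ _ _

theorem mvfderiv_triple_mul {f g h : E → ℝ} (v : TangentSpace (𝓡 4) x)
    (hf : MDifferentiableAt (𝓡 4) 𝓘(ℝ, ℝ) f x) (hg : MDifferentiableAt (𝓡 4) 𝓘(ℝ, ℝ) g x)
    (hh : MDifferentiableAt (𝓡 4) 𝓘(ℝ, ℝ) h x) :
    mvfderiv (𝓡 4) (fun y => f y * (g y * h y)) x v =
      f x * (g x * mvfderiv (𝓡 4) h x v + h x * mvfderiv (𝓡 4) g x v) +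
        g x * h x * mvfderiv (𝓡 4) f x v := by
  have hgh : MDifferentiableAt (𝓡 4) 𝓘(ℝ, ℝ) (fun y => g y * h y) x := hg.mul hh
  rw [mvfderiv_mul_apply v hf hgh, mvfderiv_mul_apply v hg hh]

theorem mvfderiv_det {a b c : Fin 3 → E → ℝ} (v : TangentSpace (𝓡 4) x)
    (ha : ∀ i, MDifferentiableAt (𝓡 4) 𝓘(ℝ, ℝ) (a i) x)
    (hb : ∀ i, MDifferentiableAt (𝓡 4) 𝓘(ℝ, ℝ) (b i) x)
    (hc : ∀ i, MDifferentiableAt (𝓡 4) 𝓘(ℝ, ℝ) (c i) x) :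
    MDifferentiableAt (𝓡 4) 𝓘(ℝ, ℝ) (fun y =>
      a 0 y * (b 1 y * c 2 y) - a 0 y * (b 2 y * c 1 y) - a 1 y * (b 0 y * c 2 y) +
        a 1 y * (b 2 y * c 0 y) + a 2 y * (b 0 y * c 1 y) - a 2 y * (b 1 y * c 0 y)) x ∧
    mvfderiv (𝓡 4) (fun y =>
      a 0 y * (b 1 y * c 2 y) - a 0 y * (b 2 y * c 1 y) - a 1 y * (b 0 y * c 2 y) +
        a 1 y * (b 2 y * c 0 y) + a 2 y * (b 0 y * c 1 y) - a 2 y * (b 1 y * c 0 y)) x v =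
      mvfderiv (𝓡 4) (fun y => a 0 y * (b 1 y * c 2 y)) x v -
      mvfderiv (𝓡 4) (fun y => a 0 y * (b 2 y * c 1 y)) x v -
      mvfderiv (𝓡 4) (fun y => a 1 y * (b 0 y * c 2 y)) x v +
      mvfderiv (𝓡 4) (fun y => a 1 y * (b 2 y * c 0 y)) x v +
      mvfderiv (𝓡 4) (fun y => a 2 y * (b 0 y * c 1 y)) x v -
      mvfderiv (𝓡 4) (fun y => a 2 y * (b 1 y * c 0 y)) x v := by
  have t : ∀ i j k, MDifferentiableAt (𝓡 4) 𝓘(ℝ, ℝ) (fun y => a i y * (b j y * c k y)) x :=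
    fun i j k => (ha i).mul ((hb j).mul (hc k))
  have t1 : MDifferentiableAt (𝓡 4) 𝓘(ℝ, ℝ) (fun y =>
      a 0 y * (b 1 y * c 2 y) - a 0 y * (b 2 y * c 1 y)) x := (t 0 1 2).sub (t 0 2 1)
  have t2 : MDifferentiableAt (𝓡 4) 𝓘(ℝ, ℝ) (fun y =>
      a 0 y * (b 1 y * c 2 y) - a 0 y * (b 2 y * c 1 y) - a 1 y * (b 0 y * c 2 y)) x :=
    t1.sub (t 1 0 2)
  have t3 : MDifferentiableAt (𝓡 4) 𝓘(ℝ, ℝ) (fun y =>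
      a 0 y * (b 1 y * c 2 y) - a 0 y * (b 2 y * c 1 y) - a 1 y * (b 0 y * c 2 y) +
        a 1 y * (b 2 y * c 0 y)) x := t2.add (t 1 2 0)
  have t4 : MDifferentiableAt (𝓡 4) 𝓘(ℝ, ℝ) (fun y =>
      a 0 y * (b 1 y * c 2 y) - a 0 y * (b 2 y * c 1 y) - a 1 y * (b 0 y * c 2 y) +
        a 1 y * (b 2 y * c 0 y) + a 2 y * (b 0 y * c 1 y)) x := t3.add (t 2 0 1)
  exact ⟨t4.sub (t 2 1 0), by
    rw [mvfderiv_sub_apply v t4 (t 2 1 0), mvfderiv_add_apply v t3 (t 2 0 1),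
      mvfderiv_add_apply v t2 (t 1 2 0), mvfderiv_sub_apply v t1 (t 1 0 2),
      mvfderiv_sub_apply v (t 0 1 2) (t 0 2 1)]⟩

theorem SmoothVertOn.vol_frame {e : Fin 3 → ∀ y, G.V y} (hW : IsOpen W)
    (he : ∀ i, SmoothVertOn (e i) W) : SmoothFunOn (fun y => G.vol y fun i => e i y) W :=
  G.vol_smooth W hW e he

variable (K : SpacetimeConnection G)

/-- The value `s` on an orthonormal frame satisfies `s² = 1`, so `2 s ds = 0` with `s ≠ 0`. -/
theorem mvfderiv_vol_frame {e : Fin 3 → ∀ y, G.V y} (hW : IsOpen W) (hx : x ∈ W)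
    (he : ∀ i, SmoothVertOn (e i) W)
    (hon : ∀ y ∈ W, ∀ i j, G.metric y (e i y) (e j y) = if i = j then 1 else 0)
    (v : TangentSpace (𝓡 4) x) : mvfderiv (𝓡 4) (fun y => G.vol y fun i => e i y) x v = 0 := by
  have hs := (SmoothVertOn.vol_frame hW he).mdiffAt hW hx
  have h1 := mvfderiv_mul_apply v hs hs
  rw [mvfderiv_congr hW hx (h := fun _ => 1) fun y hy => by
    rw [← sq, vol_sq_of_orthonormal (hon y hy)], mvfderiv_const] at h1
  have h2 := vol_sq_of_orthonormal (hon x hx)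
  have h3 : (0 : ℝ) = 2 * ((G.vol x fun i => e i x) *
      mvfderiv (𝓡 4) (fun y => G.vol y fun i => e i y) x v) := by
    rw [two_mul]; exact h1
  have h4 : (G.vol x fun i => e i x) ≠ 0 := fun h0 => by
    change (G.vol x fun i => e i x) ^ 2 = 1 at h2
    rw [h0] at h2
    norm_num at h2
  have h5 := h3.symm
  simpa [h4] using h5

/-- In a smooth orthonormal frame the volume is a sign with zero derivative times the determinant of
coordinates. The derivatives of the frame contribute only the trace of the connection matrix, which
is zero. -/
theorem SpacetimeConnection.mvfderiv_vol {P Q R : ∀ y, G.V y} (hW : IsOpen W) (hx : x ∈ W)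
    (hP : SmoothVertOn P W) (hQ : SmoothVertOn Q W) (hR : SmoothVertOn R W)
    (v : TangentSpace (𝓡 4) x) :
    mvfderiv (𝓡 4) (fun y => G.vol y ![P y, Q y, R y]) x v =
      G.vol x ![K.cov (fun y => (P y : TangentSpace (𝓡 4) y)) x v, Q x, R x] +
      G.vol x ![P x, K.cov (fun y => (Q y : TangentSpace (𝓡 4) y)) x v, R x] +
      G.vol x ![P x, Q x, K.cov (fun y => (R y : TangentSpace (𝓡 4) y)) x v] := by
  obtain ⟨U, hU, hxU, e, he, hon⟩ := exists_orthonormalFrame G x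
  replace he := fun i => (he i).mono (Set.inter_subset_right (s := W))
  replace hP := hP.mono (Set.inter_subset_left (t := U))
  replace hQ := hQ.mono (Set.inter_subset_left (t := U))
  replace hR := hR.mono (Set.inter_subset_left (t := U))
  replace hon : ∀ y ∈ W ∩ U, _ := fun y hy => hon y hy.2
  have hO := hW.inter hU
  have hxO : x ∈ W ∩ U := ⟨hx, hxU⟩
  generalize W ∩ U = V at *
  have hs := (SmoothVertOn.vol_frame hO he).mdiffAt hO hxO
  have hs0 := mvfderiv_vol_frame hO hxO he hon v
  have cd : ∀ {A : ∀ y, G.V y}, SmoothVertOn A V → ∀ i, MDifferentiableAt (𝓡 4) 𝓘(ℝ, ℝ)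
      (fun y => G.metric y (A y) (e i y)) x := fun hA i =>
    (SmoothVertOn.metric hO hA (he i)).mdiffAt hO hxO
  -- Differentiating the orthonormality relations shows that the connection matrix of the frame is
  -- antisymmetric.
  have n : ∀ i j, G.metric x (K.cov (fun y => (e i y : TangentSpace (𝓡 4) y)) x v) (e j x) =
      -G.metric x (K.cov (fun y => (e j y : TangentSpace (𝓡 4) y)) x v) (e i x) := by
    intro i j
    have h := K.mvfderiv_metric ((he i).diffAt hO hxO) ((he j).diffAt hO hxO) v
    rw [mvfderiv_congr hO hxO (h := fun _ => if i = j then (1 : ℝ) else 0) fun y hy =>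
      hon y hy i j, mvfderiv_const] at h
    rw [G.metric_symm x (e i x)] at h
    exact eq_neg_of_add_eq_zero_left h.symm
  have n0 : ∀ i, G.metric x (K.cov (fun y => (e i y : TangentSpace (𝓡 4) y)) x v) (e i x) = 0 :=
    fun i => by linarith [n i i]
  have dd : ∀ {A : ∀ y, G.V y}, SmoothVertOn A V → ∀ i,
      mvfderiv (𝓡 4) (fun y => G.metric y (A y) (e i y)) x v =
        G.metric x (K.cov (fun y => (A y : TangentSpace (𝓡 4) y)) x v) (e i x) +
        (G.metric x (A x) (e 0 x) *
          G.metric x (K.cov (fun y => (e i y : TangentSpace (𝓡 4) y)) x v) (e 0 x) +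
        G.metric x (A x) (e 1 x) *
          G.metric x (K.cov (fun y => (e i y : TangentSpace (𝓡 4) y)) x v) (e 1 x) +
        G.metric x (A x) (e 2 x) *
          G.metric x (K.cov (fun y => (e i y : TangentSpace (𝓡 4) y)) x v) (e 2 x)) := by
    intro A hA i
    rw [K.mvfderiv_metric (hA.diffAt hO hxO) ((he i).diffAt hO hxO) v,
      metric_eq_sum (hon x hxO) (A x)]
  obtain ⟨m1, m2⟩ := mvfderiv_det v (cd hP) (cd hQ) (cd hR)
  rw [mvfderiv_congr hO hxO fun y hy => vol_eq (hon y hy) (P y) (Q y) (R y)]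
  refine (mvfderiv_mul_apply v hs m1).trans ?_
  rw [hs0, mul_zero, add_zero, m2]
  simp only [mvfderiv_triple_mul v (cd hP _) (cd hQ _) (cd hR _), dd hP, dd hQ, dd hR,
    vol_eq (hon x hxO), n0, n 1 0, n 2 0, n 2 1]
  ring

/-- The covariant derivative is a derivation of the cross product. -/
theorem SpacetimeConnection.cov_vcross [T2Space E] {P Q : ∀ y, G.V y} (hW : IsOpen W) (hx : x ∈ W)
    (hP : SmoothVertOn P W) (hQ : SmoothVertOn Q W) (v : TangentSpace (𝓡 4) x) :
    K.cov (fun y => (vcross (P y) (Q y) : TangentSpace (𝓡 4) y)) x v =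
      vcross (K.cov (fun y => (P y : TangentSpace (𝓡 4) y)) x v) (Q x) +
        vcross (P x) (K.cov (fun y => (Q y : TangentSpace (𝓡 4) y)) x v) := by
  refine metric_ext fun z => ?_
  obtain ⟨U, hU, hxU, R, hR, rfl⟩ := exists_vert x z
  replace hR := hR.mono (Set.inter_subset_right (s := W))
  replace hP := hP.mono (Set.inter_subset_left (t := U))
  replace hQ := hQ.mono (Set.inter_subset_left (t := U))
  have hO := hW.inter hU
  have hxO : x ∈ W ∩ U := ⟨hx, hxU⟩
  -- The derivative of `g(P × Q, R)` is computed twice, by the metric product rule and by the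
  -- product rule for the volume; the terms with `∇R` cancel.
  have h := K.mvfderiv_metric ((SmoothVertOn.vcross hO hP hQ).diffAt hO hxO)
    (hR.diffAt hO hxO) v
  rw [mvfderiv_congr hO hxO fun y _ => metric_vcross (P y) (Q y) (R y),
    K.mvfderiv_vol hO hxO hP hQ hR, metric_vcross] at h
  rw [map_add, LinearMap.add_apply, metric_vcross, metric_vcross]
  linear_combination -h

end VolumeParallel

/-! ### The spin curvature -/

section SpinCurvature

variable [T2Space E] {G : Spacetime E} (K : SpacetimeConnection G) {W : Set E} {x : E}

/-- Bianchi moves the last argument into the first slot, where linearity is already known. -/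
theorem SpacetimeConnection.isLinearMap_vertCurvature (X Y : TangentSpace (𝓡 4) x) :
    IsLinearMap ℝ (vertCurvature K x X Y) := by
  have e : ∀ Z, curvature K.toConn x X Y Z =
      curvature K.toConn x Z Y X - curvature K.toConn x Z X Y := by
    intro Z
    have h := K.curvature_bianchi X Y Z
    rw [K.curvature_antisymm Y Z] at h
    linear_combination (norm := module) h
  constructor
  · intro u w
    refine Subtype.ext ?_
    simp only [vertCurvature, Submodule.coe_add, K.coe_toVert_curvature]
    simp only [e, K.curvature_add_left]
    module
  · intro a u
    refine Subtype.ext ?_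
    simp only [vertCurvature, Submodule.coe_smul, K.coe_toVert_curvature]
    simp only [e, K.curvature_smul_left]
    module

theorem SpacetimeConnection.vertCurvature_eq {X Y : ∀ y : E, TangentSpace (𝓡 4) y}
    {u : ∀ y, G.V y} (hW : IsOpen W) (hx : x ∈ W)
    (hX : SmoothFieldOn X W) (hY : SmoothFieldOn Y W) (hu : SmoothVertOn u W) :
    vertCurvature K x (X x) (Y x) (u x) =
      K.cov (fun y => (K.cov (fun y => (u y : TangentSpace (𝓡 4) y)) y (Y y) :
          TangentSpace (𝓡 4) y)) x (X x) -
        K.cov (fun y => (K.cov (fun y => (u y : TangentSpace (𝓡 4) y)) y (X y) :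
          TangentSpace (𝓡 4) y)) x (Y x) -
        K.cov (fun y => (u y : TangentSpace (𝓡 4) y)) x
          (VectorField.mlieBracket (𝓡 4) X Y x) :=
  Spacetime.toVert_eq (K.curvature_vert hW hx hX hY hu)

/-- The commutator of two derivatives applied to `g(p, q)`: the mixed first-order terms are
symmetric in `A` and `B` and cancel. Antisymmetry is what allows `Ř` to be represented by a vector.
-/
theorem SpacetimeConnection.metric_vertCurvature (X Y : TangentSpace (𝓡 4) x) (u w : G.V x) :
    G.metric x (vertCurvature K x X Y u) w = -G.metric x u (vertCurvature K x X Y w) := by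
  obtain ⟨U, hU, hxU, A, B, -, hA, hB, -, rfl, rfl, -⟩ := exists_three_fields x X Y Y
  obtain ⟨U₁, hU₁, hxU₁, p, hp, rfl⟩ := exists_vert x u
  obtain ⟨U₂, hU₂, hxU₂, q, hq, rfl⟩ := exists_vert x w
  have hO : IsOpen (U ∩ (U₁ ∩ U₂)) := hU.inter (hU₁.inter hU₂)
  have hxO : x ∈ U ∩ (U₁ ∩ U₂) := ⟨hxU, hxU₁, hxU₂⟩
  replace hA := hA.mono (W' := U ∩ (U₁ ∩ U₂)) fun y hy => hy.1
  replace hB := hB.mono (W' := U ∩ (U₁ ∩ U₂)) fun y hy => hy.1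
  replace hp := hp.mono (W' := U ∩ (U₁ ∩ U₂)) fun y hy => hy.2.1
  replace hq := hq.mono (W' := U ∩ (U₁ ∩ U₂)) fun y hy => hy.2.2
  generalize U ∩ (U₁ ∩ U₂) = V at *
  have hpd := hp.diffAt hO hxO
  have hqd := hq.diffAt hO hxO
  have key : ∀ {A B : ∀ y : E, TangentSpace (𝓡 4) y}, SmoothFieldOn A V → SmoothFieldOn B V →
      mvfderiv (𝓡 4) (fun y => mvfderiv (𝓡 4) (fun y => G.metric y (p y) (q y)) y (B y)) x (A x) =
      G.metric x (K.cov (fun y => (K.cov (fun y => (p y : TangentSpace (𝓡 4) y)) y (B y) :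
          TangentSpace (𝓡 4) y)) x (A x)) (q x) +
        G.metric x (K.cov (fun y => (p y : TangentSpace (𝓡 4) y)) x (B x))
          (K.cov (fun y => (q y : TangentSpace (𝓡 4) y)) x (A x)) +
        (G.metric x (K.cov (fun y => (p y : TangentSpace (𝓡 4) y)) x (A x))
          (K.cov (fun y => (q y : TangentSpace (𝓡 4) y)) x (B x)) +
        G.metric x (p x) (K.cov (fun y => (K.cov (fun y => (q y : TangentSpace (𝓡 4) y)) y (B y) :
          TangentSpace (𝓡 4) y)) x (A x))) := by
    intro A B hA hB
    have n1 := SmoothVertOn.cov (K := K) hO hB hp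
    have n2 := SmoothVertOn.cov (K := K) hO hB hq
    rw [mvfderiv_congr hO hxO fun y hy =>
      K.mvfderiv_metric (hp.diffAt hO hy) (hq.diffAt hO hy) (B y),
      mvfderiv_add_apply _ ((SmoothVertOn.metric hO n1 hq).mdiffAt hO hxO)
        ((SmoothVertOn.metric hO hp n2).mdiffAt hO hxO),
      K.mvfderiv_metric (n1.diffAt hO hxO) hqd, K.mvfderiv_metric hpd (n2.diffAt hO hxO)]
  have h := mvfderiv_mlieBracket hO hxO (SmoothVertOn.metric hO hp hq) hA hB
  rw [key hA hB, key hB hA, K.mvfderiv_metric hpd hqd] at h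
  rw [K.vertCurvature_eq hO hxO hA hB hp, K.vertCurvature_eq hO hxO hA hB hq]
  simp only [map_sub, LinearMap.sub_apply]
  linear_combination -h

theorem SpacetimeConnection.isLinearMap_rho (X Y : TangentSpace (𝓡 4) x) :
    IsLinearMap ℝ (rho K x X Y) := by
  have h := isLinearMap_triangle (vertCurvature K x X Y)
  constructor
  · intro u w; simp only [rho, h.map_add]; ring
  · intro a u; simp only [rho, h.map_smul, smul_eq_mul]; ring

/-- The vector of the antisymmetric endomorphism `Ř(X, Y)`. -/
def SpacetimeConnection.rotation (x : E) (X Y : TangentSpace (𝓡 4) x) : G.V x :=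
  sharp (rho K x X Y)

/-- This property of `ρ` is what the bracket identities use; the orthonormal frame chosen in its
definition no longer matters. -/
theorem SpacetimeConnection.vcross_rotation (X Y : TangentSpace (𝓡 4) x) (w : G.V x) :
    vcross (K.rotation x X Y) w = vertCurvature K x X Y w :=
  vcross_sharp_triangle (K.isLinearMap_vertCurvature X Y) (K.metric_vertCurvature X Y) w

variable {K} in
theorem SmoothFieldOn.vertCurvature_apply {X Y : ∀ y : E, TangentSpace (𝓡 4) y} {u : ∀ y, G.V y}
    (hW : IsOpen W) (hX : SmoothFieldOn X W) (hY : SmoothFieldOn Y W) (hu : SmoothVertOn u W) :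
    SmoothVertOn (fun y => vertCurvature K y (X y) (Y y) (u y)) W := by
  have h : SmoothVertOn (fun x => K.cov (fun y => (K.cov (fun y => (u y : TangentSpace (𝓡 4) y))
      y (Y y) : TangentSpace (𝓡 4) y)) x (X x) -
        K.cov (fun y => (K.cov (fun y => (u y : TangentSpace (𝓡 4) y)) y (X y) :
          TangentSpace (𝓡 4) y)) x (Y x) -
        K.cov (fun y => (u y : TangentSpace (𝓡 4) y)) x
          (VectorField.mlieBracket (𝓡 4) X Y x)) W :=
    ((SmoothVertOn.cov (K := K) hW hX (SmoothVertOn.cov (K := K) hW hY hu)).sub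
      (SmoothVertOn.cov (K := K) hW hY (SmoothVertOn.cov (K := K) hW hX hu))).sub
      (SmoothVertOn.cov (K := K) hW (hX.mlieBracket hW hY) hu)
  exact h.congr fun y hy => congrArg Subtype.val (K.vertCurvature_eq hW hy hX hY hu)

variable {K} in
-- The frame in the definition of `triangle` is chosen point by point and need not be smooth. The
-- vector is therefore rewritten as `½ ∑ eᵢ × Ř eᵢ` in a smooth local frame.
theorem SmoothFieldOn.rotation {X Y : ∀ y : E, TangentSpace (𝓡 4) y}
    (hW : IsOpen W) (hX : SmoothFieldOn X W) (hY : SmoothFieldOn Y W) :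
    SmoothVertOn (fun y => K.rotation y (X y) (Y y)) W :=
  smoothFieldOn_of_forall fun x _ => by
    obtain ⟨U, hU, hxU, e, he, hon⟩ := exists_orthonormalFrame G x
    have he' : ∀ i, SmoothVertOn (e i) (W ∩ U) := fun i => (he i).mono Set.inter_subset_right
    have hO := hW.inter hU
    have h : SmoothFieldOn (fun y => (1 / 2 : ℝ) • ∑ i, (vcross (e i y)
        (vertCurvature K y (X y) (Y y) (e i y)) : TangentSpace (𝓡 4) y)) (W ∩ U) :=
      SmoothFieldOn.smul (SmoothFunOn.const _) (SmoothFieldOn.sum (s := Finset.univ) fun i _ =>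
        SmoothVertOn.vcross hO (he' i) (SmoothFieldOn.vertCurvature_apply hO
          (hX.mono Set.inter_subset_left) (hY.mono Set.inter_subset_left) (he' i)))
    refine ⟨U, hU, hxU, h.congr fun y hy => ?_⟩
    change (K.rotation y (X y) (Y y) : TangentSpace (𝓡 4) y) = _
    conv_lhs => rw [sum_vcross_vcross (hon y hy.2) (K.rotation y (X y) (Y y))]
    simp [K.vcross_rotation]

end SpinCurvature

/-! ### The spin part of the bracket -/

section SpinBracket

variable [T2Space E] {G : Spacetime E} (K : SpacetimeConnection G) {W : Set E} {x : E}
  {X X₁ X₂ X₃ : ∀ y : E, TangentSpace (𝓡 4) y} {P P₁ P₂ P₃ U : ∀ y, G.V y}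

/-- The vector field of the spin part of the bracket. -/
def spinValue (X X' : ∀ y : E, TangentSpace (𝓡 4) y) (P P' : ∀ y, G.V y) (x : E) : G.V x :=
  -K.rotation x (X x) (X' x) + K.cov (fun y => (P' y : TangentSpace (𝓡 4) y)) x (X x) -
    K.cov (fun y => (P y : TangentSpace (𝓡 4) y)) x (X' x) + vcross (P' x) (P x)

variable {K} in
theorem smoothVertOn_spinValue (hW : IsOpen W) (hX₁ : SmoothFieldOn X₁ W)
    (hX₂ : SmoothFieldOn X₂ W) (hP₁ : SmoothVertOn P₁ W) (hP₂ : SmoothVertOn P₂ W) :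
    SmoothVertOn (spinValue K X₁ X₂ P₁ P₂) W :=
  (((SmoothFieldOn.neg (SmoothFieldOn.rotation hW hX₁ hX₂)).add (SmoothVertOn.cov hW hX₁ hP₂)).sub
    (SmoothVertOn.cov hW hX₂ hP₁)).add (SmoothVertOn.vcross hW hP₂ hP₁)

/-- The action of the pair of a vector field and a vertical field on vertical fields. -/
def lieOp (X : ∀ y : E, TangentSpace (𝓡 4) y) (P U : ∀ y, G.V y) (x : E) : G.V x :=
  K.cov (fun y => (U y : TangentSpace (𝓡 4) y)) x (X x) - vcross (P x) (U x)

variable {K} in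
theorem smoothVertOn_lieOp (hW : IsOpen W) (hX : SmoothFieldOn X W) (hP : SmoothVertOn P W)
    (hU : SmoothVertOn U W) : SmoothVertOn (lieOp K X P U) W :=
  (SmoothVertOn.cov hW hX hU).sub (SmoothVertOn.vcross hW hP hU)

variable {K} in
theorem lieOp_congr {U U' : ∀ y, G.V y} (hW : IsOpen W) (hx : x ∈ W) (hU : SmoothVertOn U W)
    (h : ∀ y ∈ W, U' y = U y) : lieOp K X P U' x = lieOp K X P U x := by
  rw [lieOp, lieOp, K.cov_congr hW hx (hU.diffAt hW hx) (fun y hy => by rw [h y hy]), h x hx]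

variable {K} in
theorem lieOp_sub {U U' : ∀ y, G.V y} (hW : IsOpen W) (hx : x ∈ W) (hU : SmoothVertOn U W)
    (hU' : SmoothVertOn U' W) :
    lieOp K X P (fun y => U y - U' y) x = lieOp K X P U x - lieOp K X P U' x := by
  rw [lieOp, lieOp, lieOp, K.cov_sub (hU.diffAt hW hx) (hU'.diffAt hW hx), vcross_sub_right]
  abel

/-- The action turns the bracket of pairs into the commutator. -/
theorem lieOp_bracket (hW : IsOpen W) (hx : x ∈ W) (hX₁ : SmoothFieldOn X₁ W)
    (hX₂ : SmoothFieldOn X₂ W) (hP₁ : SmoothVertOn P₁ W) (hP₂ : SmoothVertOn P₂ W)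
    (hU : SmoothVertOn U W) :
    lieOp K (VectorField.mlieBracket (𝓡 4) X₁ X₂) (spinValue K X₁ X₂ P₁ P₂) U x =
      lieOp K X₁ P₁ (lieOp K X₂ P₂ U) x - lieOp K X₂ P₂ (lieOp K X₁ P₁ U) x := by
  -- The commutator of covariant derivatives contributes `∇` along the Lie bracket and `r × U`. The
  -- derivation rule gives the terms in `∇P₁` and `∇P₂`, and the Jacobi identity of the cross
  -- product gives the quadratic one.
  have R := K.vertCurvature_eq hW hx hX₁ hX₂ hU
  rw [← K.vcross_rotation] at R
  have e : ∀ {X X' : ∀ y : E, TangentSpace (𝓡 4) y} {P : ∀ y, G.V y}, SmoothFieldOn X' W →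
      SmoothVertOn P W →
      K.cov (fun y => (lieOp K X' P U y : TangentSpace (𝓡 4) y)) x (X x) =
        K.cov (fun y => (K.cov (fun y => (U y : TangentSpace (𝓡 4) y)) y (X' y) :
          TangentSpace (𝓡 4) y)) x (X x) -
        (vcross (K.cov (fun y => (P y : TangentSpace (𝓡 4) y)) x (X x)) (U x) +
          vcross (P x) (K.cov (fun y => (U y : TangentSpace (𝓡 4) y)) x (X x))) := by
    intro X X' P hX' hP
    rw [← K.cov_vcross hW hx hP hU]
    exact K.cov_sub ((SmoothVertOn.cov (K := K) hW hX' hU).diffAt hW hx)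
      ((SmoothVertOn.vcross hW hP hU).diffAt hW hx) _
  have j := vcross_jacobi (P₁ x) (P₂ x) (U x)
  have s : vcross (P₂ x) (P₁ x) = -vcross (P₁ x) (P₂ x) := vcross_antisymm _ _
  have e₁ := e (X := X₁) hX₂ hP₂
  have e₂ := e (X := X₂) hX₁ hP₁
  have t : ∀ X P U, lieOp K X P U x =
    K.cov (fun y => (U y : TangentSpace (𝓡 4) y)) x (X x) - vcross (P x) (U x) :=
    fun _ _ _ => rfl
  rw [t _ _ U, t X₁ P₁ (lieOp K X₂ P₂ U), t X₂ P₂ (lieOp K X₁ P₁ U), e₁, e₂, spinValue, s]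
  simp only [lieOp, vcross_sub_right, vcross_sub_left, vcross_add_left, vcross_neg_left]
  linear_combination (norm := module) R - j

/-- The operators `lieOp` represent the bracket by commutators, for which Jacobi is automatic. The
derivative parts vanish by the Jacobi identity of vector fields, so the cyclic sum acts as zero
under the cross product and hence is zero. -/
theorem spinValue_jacobi (hW : IsOpen W) (hx : x ∈ W) (hX₁ : SmoothFieldOn X₁ W)
    (hX₂ : SmoothFieldOn X₂ W) (hX₃ : SmoothFieldOn X₃ W) (hP₁ : SmoothVertOn P₁ W)
    (hP₂ : SmoothVertOn P₂ W) (hP₃ : SmoothVertOn P₃ W) :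
    spinValue K X₁ (VectorField.mlieBracket (𝓡 4) X₂ X₃) P₁ (spinValue K X₂ X₃ P₂ P₃) x +
      spinValue K X₂ (VectorField.mlieBracket (𝓡 4) X₃ X₁) P₂ (spinValue K X₃ X₁ P₃ P₁) x +
      spinValue K X₃ (VectorField.mlieBracket (𝓡 4) X₁ X₂) P₃ (spinValue K X₁ X₂ P₁ P₂) x = 0 := by
  refine eq_zero_of_vcross fun u => ?_
  obtain ⟨V, hV, hxV, U, hU, rfl⟩ := exists_vert x u
  have hO := hW.inter hV
  have hxO : x ∈ W ∩ V := ⟨hx, hxV⟩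
  replace hX₁ := hX₁.mono (Set.inter_subset_left (t := V))
  replace hX₂ := hX₂.mono (Set.inter_subset_left (t := V))
  replace hX₃ := hX₃.mono (Set.inter_subset_left (t := V))
  replace hP₁ := hP₁.mono (Set.inter_subset_left (t := V))
  replace hP₂ := hP₂.mono (Set.inter_subset_left (t := V))
  replace hP₃ := hP₃.mono (Set.inter_subset_left (t := V))
  replace hU := hU.mono (Set.inter_subset_right (s := W))
  generalize W ∩ V = V at *
  -- Each summand acts as `∇_{[X,[Y,Z]]}` minus a double commutator of operators; in the cyclic sum
  -- the double commutators cancel identically.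
  have key : ∀ {X Y Z : ∀ y : E, TangentSpace (𝓡 4) y} {P Q R : ∀ y, G.V y},
      SmoothFieldOn X V → SmoothFieldOn Y V → SmoothFieldOn Z V → SmoothVertOn P V →
      SmoothVertOn Q V → SmoothVertOn R V →
      vcross (spinValue K X (VectorField.mlieBracket (𝓡 4) Y Z) P (spinValue K Y Z Q R) x) (U x) =
        K.cov (fun y => (U y : TangentSpace (𝓡 4) y)) x (VectorField.mlieBracket (𝓡 4) X
          (VectorField.mlieBracket (𝓡 4) Y Z) x) -
        (lieOp K X P (lieOp K Y Q (lieOp K Z R U)) x - lieOp K X P (lieOp K Z R (lieOp K Y Q U)) x -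
          (lieOp K Y Q (lieOp K Z R (lieOp K X P U)) x -
            lieOp K Z R (lieOp K Y Q (lieOp K X P U)) x)) := by
    intro X Y Z P Q R hX hY hZ hP hQ hR
    have lX := fun {U : ∀ y, G.V y} => smoothVertOn_lieOp (K := K) (U := U) hO hX hP
    have lY := fun {U : ∀ y, G.V y} => smoothVertOn_lieOp (K := K) (U := U) hO hY hQ
    have lZ := fun {U : ∀ y, G.V y} => smoothVertOn_lieOp (K := K) (U := U) hO hZ hR
    have h := lieOp_bracket K hO hxO hX (hY.mlieBracket hO hZ) hP
      (smoothVertOn_spinValue (K := K) hO hY hZ hQ hR) hU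
    rw [lieOp_bracket K hO hxO hY hZ hQ hR (lX hU),
      lieOp_congr hO hxO ((lY (lZ hU)).sub (lZ (lY hU)))
        (fun y hy => lieOp_bracket K hO hy hY hZ hQ hR hU),
      lieOp_sub hO hxO (lY (lZ hU)) (lZ (lY hU)), lieOp] at h
    rw [← h]
    abel
  have c := mlieBracket_cyclic hO hX₁ hX₂ hX₃ hxO
  -- The cyclic identity is brought to the nesting in which `key` produces the brackets, the outer
  -- bracket having its single field on the left.
  rw [VectorField.mlieBracket_swap_apply (V := VectorField.mlieBracket (𝓡 4) X₁ X₂),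
    VectorField.mlieBracket_swap_apply (V := VectorField.mlieBracket (𝓡 4) X₂ X₃),
    VectorField.mlieBracket_swap_apply (V := VectorField.mlieBracket (𝓡 4) X₃ X₁),
    ← neg_add, ← neg_add, neg_eq_zero] at c
  have d := congrArg (fun v => K.cov (fun y => (U y : TangentSpace (𝓡 4) y)) x v) c
  have d0 : K.cov (fun y => (U y : TangentSpace (𝓡 4) y)) x 0 = 0 :=
    Subtype.ext (by rw [K.coe_cov_vert (hU.diffAt hO hxO), map_zero]; rfl)
  simp only [K.cov_add_right (hU.diffAt hO hxO), d0] at d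
  rw [vcross_add_left, vcross_add_left, key hX₁ hX₂ hX₃ hP₁ hP₂ hP₃, key hX₂ hX₃ hX₁ hP₂ hP₃ hP₁,
    key hX₃ hX₁ hX₂ hP₃ hP₁ hP₂]
  linear_combination (norm := module) d

theorem vertExtension_spec (x : E) (w : G.V x) :
    DiffVertAt (vertExtension x w) x ∧ vertExtension x w x = w := by
  have h : ∃ u : ∀ y, G.V y, ContMDiffAt (𝓡 4) (𝓡 4).tangent ∞
      (fun y => (⟨y, (u y : TangentSpace (𝓡 4) y)⟩ : TangentBundle (𝓡 4) E)) x ∧ u x = w := by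
    obtain ⟨W, hW, hx, u, hu, hux⟩ := exists_vert x w
    exact ⟨u, hu.contMDiffAt hW hx, hux⟩
  have hs := Classical.epsilon_spec h
  exact ⟨hs.1.mdifferentiableAt (by simp), hs.2⟩

/-- With `φ(u) = g(φ♯, u)` the metric product rule cancels the term in `∇u`. This replaces the dual
connection by the vertical one and removes the chosen extension. -/
theorem covDual_eq {φ : ∀ x, G.V x → ℝ} (hW : IsOpen W) (hx : x ∈ W)
    (h : IsCovectorFieldOn W φ) (Y : TangentSpace (𝓡 4) x) (w : G.V x) :
    covDual K φ x Y w =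
      G.metric x (K.cov (fun y => (sharp (φ y) : TangentSpace (𝓡 4) y)) x Y) w := by
  obtain ⟨hu, hux⟩ := vertExtension_spec x w
  rw [covDual, mvfderiv_congr hW hx fun y hy => (sharp_spec (h.1 y hy) _).symm,
    K.mvfderiv_metric ((h.sharp hW).diffAt hW hx) hu, sharp_spec (h.1 x hx), hux,
    SpacetimeConnection.cov, SpacetimeConnection.cov, add_sub_cancel_right]

theorem spinPartBracket_eq (κ : ℝ) (f f' : ∀ x, G.J x → ℝ) {φ φ' : ∀ x, G.V x → ℝ}
    (hW : IsOpen W) (hx : x ∈ W) (h : IsCovectorFieldOn W φ) (h' : IsCovectorFieldOn W φ')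
    (w : G.V x) :
    spinPartBracket K κ f φ f' φ' x w = G.metric x (spinValue K (fieldOf κ f) (fieldOf κ f')
      (fun y => sharp (φ y)) (fun y => sharp (φ' y)) x) w := by
  rw [spinPartBracket, covDual_eq K hW hx h, covDual_eq K hW hx h', cross_eq, spinValue]
  simp only [map_add, map_sub, map_neg, LinearMap.add_apply, LinearMap.sub_apply,
    LinearMap.neg_apply]
  rw [SpacetimeConnection.rotation, sharp_spec (K.isLinearMap_rho _ _)]

end SpinBracket

/-! ### The brackets depend on the germs of their arguments -/

section Germs

variable {G : Spacetime E} (K : SpacetimeConnection G) {κ : ℝ} {x : E} {W : Set E}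
  {f g f' g' : ∀ x, G.J x → ℝ} {φ ψ φ' ψ' : ∀ x, G.V x → ℝ}

theorem fieldOf_congr (h : f x = g x) : fieldOf κ f x = fieldOf κ g x := by
  unfold fieldOf
  rw [h]

/-- The auxiliary observer is chosen from `(x, v)` alone, so functions agreeing near `x` are
differentiated along the same observer. -/
theorem phaseDeriv_congr (hW : IsOpen W) (hx : x ∈ W) (h : ∀ y ∈ W, f y = g y) (v : G.J x) :
    phaseDeriv K f x v = phaseDeriv K g x v := by
  have e : vertDeriv f x v = vertDeriv g x v := by
    funext w
    simp only [vertDeriv, h x hx]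
  funext ξ
  rw [phaseDeriv, phaseDeriv, horDeriv, horDeriv, e,
    mvfderiv_congr hW hx fun y hy => by rw [h y hy]]

theorem scalarBracket_congr (hW : IsOpen W) (hx : x ∈ W) (h : ∀ y ∈ W, f y = g y)
    (h' : ∀ y ∈ W, f' y = g' y) (v : G.J x) :
    scalarBracket K κ f f' x v = scalarBracket K κ g g' x v := by
  simp only [scalarBracket, poisson, hamiltonianLift, timeCoeff, phaseDeriv_congr K hW hx h,
    phaseDeriv_congr K hW hx h', fieldOf_congr (h x hx), fieldOf_congr (h' x hx)]

theorem covDual_congr (hW : IsOpen W) (hx : x ∈ W) (h : ∀ y ∈ W, φ y = ψ y)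
    (Y : TangentSpace (𝓡 4) x) (w : G.V x) : covDual K φ x Y w = covDual K ψ x Y w := by
  rw [covDual, covDual, mvfderiv_congr hW hx fun y hy => by rw [h y hy], h x hx]

theorem spinPartBracket_congr (hW : IsOpen W) (hx : x ∈ W) (h : ∀ y ∈ W, f y = g y)
    (h' : ∀ y ∈ W, f' y = g' y) (k : ∀ y ∈ W, φ y = ψ y) (k' : ∀ y ∈ W, φ' y = ψ' y)
    (w : G.V x) :
    spinPartBracket K κ f φ f' φ' x w = spinPartBracket K κ g ψ g' ψ' x w := by
  rw [spinPartBracket, spinPartBracket, fieldOf_congr (h x hx), fieldOf_congr (h' x hx),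
    covDual_congr K hW hx k, covDual_congr K hW hx k', k x hx, k' x hx]

theorem IsCovectorFieldOn.congr (h : IsCovectorFieldOn W φ) (e : ∀ y ∈ W, ψ y = φ y) :
    IsCovectorFieldOn W ψ :=
  ⟨fun x hx => by rw [e x hx]; exact h.1 x hx, fun V hV hVW w hw =>
    (h.2 V hV hVW w hw).congr fun y hy => by rw [e y (hVW hy)]⟩

theorem IsCovectorFieldOn.of_local (h : ∀ x ∈ W, ∃ V : Set E, IsOpen V ∧ x ∈ V ∧
    IsCovectorFieldOn V φ) : IsCovectorFieldOn W φ := by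
  refine ⟨fun x hx => ?_, fun U hU hUW w hw => smoothFunOn_of_forall fun x hx => ?_⟩
  · obtain ⟨V, -, hxV, k⟩ := h x hx
    exact k.1 x hxV
  · obtain ⟨V, hV, hxV, k⟩ := h x (hUW hx)
    exact ⟨V, hV, hxV, k.2 _ (hU.inter hV) Set.inter_subset_right w
      (hw.mono Set.inter_subset_left)⟩

end Germs

/-! ### Linearity and antisymmetry of the brackets -/

section Linearity

variable {G : Spacetime E} (K : SpacetimeConnection G) {κ : ℝ} {x : E} {W : Set E}
  {f f₁ f₂ : ∀ x, G.J x → ℝ} {φ φ₁ φ₂ : ∀ x, G.V x → ℝ}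

theorem specialFun_linear (o : G.J x) (a : ℝ) (X X' : TangentSpace (𝓡 4) x) (c c' : ℝ)
    (v : G.J x) : a * specialFun κ o X c v + specialFun κ o X' c' v =
      specialFun κ o (a • X + X') (a * c + c') v := by
  simp only [specialFun, Spacetime.J.contact_add, Spacetime.J.contact_smul, map_add, map_smul,
    LinearMap.add_apply, LinearMap.smul_apply, smul_eq_mul]
  ring

theorem SpecialOn.fieldOf_linear (hκ : κ ≠ 0) (h₁ : SpecialOn κ W f₁) (h₂ : SpecialOn κ W f₂)
    (a : ℝ) (hx : x ∈ W) : fieldOf κ (fun x v => a * f₁ x v + f₂ x v) x =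
      a • fieldOf κ f₁ x + fieldOf κ f₂ x :=
  fieldOf_eq hκ (o := Classical.arbitrary _) fun v => by
    rw [← specialFun_linear, ← h₁.form x hx, ← h₂.form x hx]

theorem SpecialOn.linear (hκ : κ ≠ 0) (h₁ : SpecialOn κ W f₁) (h₂ : SpecialOn κ W f₂) (a : ℝ) :
    SpecialOn κ W fun x v => a * f₁ x v + f₂ x v where
  form x hx o v := by
    rw [h₁.fieldOf_linear hκ h₂ a hx, ← specialFun_linear, ← h₁.form x hx, ← h₂.form x hx]
  field := SmoothFieldOn.congr ((SmoothFieldOn.const_smul a h₁.field).add h₂.field) fun x hx =>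
    h₁.fieldOf_linear hκ h₂ a hx
  value V hV hVW o ho :=
    ((SmoothFunOn.const a).mul (h₁.value V hV hVW o ho)).add (h₂.value V hV hVW o ho)

theorem specialOn_zero (hκ : κ ≠ 0) : SpecialOn κ W (fun x (_ : G.J x) => 0) := by
  have z : ∀ {x : E} (o : G.J x), o.contact (0 : TangentSpace (𝓡 4) x) = 0 := fun o =>
    Subtype.ext (by simp)
  have e : ∀ x, fieldOf κ (fun x (_ : G.J x) => (0 : ℝ)) x = 0 := fun x =>
    fieldOf_eq hκ (o := Classical.arbitrary _) (c := 0) fun v => by simp [specialFun, z]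
  refine ⟨fun x _ o v => ?_, SmoothFieldOn.zero.congr fun x _ => e x, fun _ _ _ _ _ =>
    SmoothFunOn.const 0⟩
  simp [e, specialFun, z]

theorem isCovectorFieldOn_zero : IsCovectorFieldOn W (fun x (_ : G.V x) => 0) :=
  ⟨fun _ _ => ⟨fun _ _ => (add_zero 0).symm, fun _ _ => (smul_zero _).symm⟩,
    fun _ _ _ _ _ => SmoothFunOn.const 0⟩

theorem IsCovectorFieldOn.linear (h₁ : IsCovectorFieldOn W φ₁) (h₂ : IsCovectorFieldOn W φ₂)
    (a : ℝ) : IsCovectorFieldOn W fun x w => a * φ₁ x w + φ₂ x w := by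
  refine ⟨fun x hx => ⟨fun u w => ?_, fun c u => ?_⟩, fun V hV hVW w hw =>
    ((SmoothFunOn.const a).mul (h₁.2 V hV hVW w hw)).add (h₂.2 V hV hVW w hw)⟩
  · change a * φ₁ x (u + w) + φ₂ x (u + w) = _
    rw [(h₁.1 x hx).map_add, (h₂.1 x hx).map_add]; ring
  · change a * φ₁ x (c • u) + φ₂ x (c • u) = _
    rw [(h₁.1 x hx).map_smul, (h₂.1 x hx).map_smul]
    simp only [smul_eq_mul]; ring

theorem IsCovectorFieldOn.sharp_linear (h₁ : IsCovectorFieldOn W φ₁)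
    (h₂ : IsCovectorFieldOn W φ₂) (a : ℝ) (hx : x ∈ W) :
    Galilei.sharp (fun w => a * φ₁ x w + φ₂ x w) =
      a • Galilei.sharp (φ₁ x) + Galilei.sharp (φ₂ x) :=
  sharp_eq fun w => by
    rw [map_add, map_smul, LinearMap.add_apply, LinearMap.smul_apply, sharp_spec (h₁.1 x hx),
      sharp_spec (h₂.1 x hx), smul_eq_mul]

theorem scalarBracket_antisymm (hκ : κ ≠ 0) (hW : IsOpen W) (h₁ : SpecialOn κ W f₁)
    (h₂ : SpecialOn κ W f₂) (hx : x ∈ W) (v : G.J x) :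
    scalarBracket K κ f₁ f₂ x v = -scalarBracket K κ f₂ f₁ x v := by
  rw [scalarBracket_eq K hκ h₁ h₂ hW hx, scalarBracket_eq K hκ h₂ h₁ hW hx, neg_sub]

/-- The first argument enters through its field and through its horizontal derivative, both linear;
linearity in the other argument follows from antisymmetry. -/
theorem scalarBracket_linear (hκ : κ ≠ 0) (hW : IsOpen W) (h : SpecialOn κ W f)
    (h₁ : SpecialOn κ W f₁) (h₂ : SpecialOn κ W f₂) (a : ℝ) (hx : x ∈ W) (v : G.J x) :
    scalarBracket K κ (fun x v => a * f₁ x v + f₂ x v) f x v =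
      a * scalarBracket K κ f₁ f x v + scalarBracket K κ f₂ f x v := by
  obtain ⟨V, hV, hxV, hVW, o, ho, rfl⟩ := exists_observer_within hW hx v
  replace h := h.mono hVW
  replace h₁ := h₁.mono hVW
  replace h₂ := h₂.mono hVW
  have h₁₂ := h₁.linear hκ h₂ a
  have hl := h.horDeriv_linear K hV hxV (o x)
  have d₁ := (h₁.value V hV subset_rfl o ho).mdiffAt hV hxV
  have d₂ := (h₂.value V hV subset_rfl o ho).mdiffAt hV hxV
  have d₃ : MDifferentiableAt (𝓡 4) 𝓘(ℝ, ℝ) (fun y => a * f₁ y (o y)) x :=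
    mdifferentiableAt_const.mul d₁
  rw [scalarBracket_eq K hκ h₁₂ h hV hxV, scalarBracket_eq K hκ h₁ h hV hxV,
    scalarBracket_eq K hκ h₂ h hV hxV, h₁.fieldOf_linear hκ h₂ a hxV, hl.map_add, hl.map_smul,
    h₁₂.horDeriv_eq K hV hxV ho, h₁.horDeriv_eq K hV hxV ho, h₂.horDeriv_eq K hV hxV ho,
    h₁.fieldOf_linear hκ h₂ a hxV, mvfderiv_add_apply _ d₃ d₂, mvfderiv_const_mul_apply _ _ d₁]
  simp only [Spacetime.J.contact_add, Spacetime.J.contact_smul, map_add, map_smul,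
    LinearMap.add_apply, LinearMap.smul_apply, smul_eq_mul]
  ring

variable [T2Space E]

/-- Checked on the endomorphism `r × ·`, where it is the antisymmetry of the curvature. -/
theorem SpacetimeConnection.rotation_antisymm (X Y : TangentSpace (𝓡 4) x) :
    K.rotation x X Y = -K.rotation x Y X := by
  rw [← sub_eq_zero, sub_neg_eq_add]
  refine eq_zero_of_vcross fun u => ?_
  rw [vcross_add_left, K.vcross_rotation, K.vcross_rotation]
  refine Subtype.ext ?_
  simp only [vertCurvature, Submodule.coe_add, K.coe_toVert_curvature]
  rw [K.curvature_antisymm]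
  simp

theorem SpacetimeConnection.rotation_linear (a : ℝ) (X X' Y : TangentSpace (𝓡 4) x) :
    K.rotation x (a • X + X') Y = a • K.rotation x X Y + K.rotation x X' Y := by
  rw [← sub_eq_zero]
  refine eq_zero_of_vcross fun u => ?_
  rw [vcross_sub_left, vcross_add_left, vcross_smul_left, K.vcross_rotation, K.vcross_rotation,
    K.vcross_rotation]
  refine Subtype.ext ?_
  simp only [vertCurvature, Submodule.coe_add, Submodule.coe_sub, Submodule.coe_smul,
    K.coe_toVert_curvature]
  rw [K.curvature_add_left, K.curvature_smul_left]
  simp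

theorem spinValue_antisymm (X X' : ∀ y : E, TangentSpace (𝓡 4) y) (P P' : ∀ y, G.V y) :
    spinValue K X X' P P' x = -spinValue K X' X P' P x := by
  rw [spinValue, spinValue, K.rotation_antisymm, vcross_antisymm (P' x)]
  abel

theorem spinPartBracket_antisymm (hW : IsOpen W) (hx : x ∈ W) (k₁ : IsCovectorFieldOn W φ₁)
    (k₂ : IsCovectorFieldOn W φ₂) (w : G.V x) :
    spinPartBracket K κ f₁ φ₁ f₂ φ₂ x w = -spinPartBracket K κ f₂ φ₂ f₁ φ₁ x w := by
  rw [spinPartBracket_eq K κ f₁ f₂ hW hx k₁ k₂, spinPartBracket_eq K κ f₂ f₁ hW hx k₂ k₁,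
    spinValue_antisymm, map_neg, LinearMap.neg_apply]

theorem spinPartBracket_linear (hκ : κ ≠ 0) (hW : IsOpen W) (hx : x ∈ W)
    (h₁ : SpecialOn κ W f₁) (h₂ : SpecialOn κ W f₂)
    (k : IsCovectorFieldOn W φ) (k₁ : IsCovectorFieldOn W φ₁) (k₂ : IsCovectorFieldOn W φ₂)
    (a : ℝ) (w : G.V x) :
    spinPartBracket K κ (fun x v => a * f₁ x v + f₂ x v) (fun x w => a * φ₁ x w + φ₂ x w) f φ x w =
      a * spinPartBracket K κ f₁ φ₁ f φ x w + spinPartBracket K κ f₂ φ₂ f φ x w := by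
  have p : DiffVertAt (fun y => sharp (φ y)) x := (k.sharp hW).diffAt hW hx
  have p₁ : DiffVertAt (fun y => sharp (φ₁ y)) x := (k₁.sharp hW).diffAt hW hx
  have p₂ : DiffVertAt (fun y => sharp (φ₂ y)) x := (k₂.sharp hW).diffAt hW hx
  have p₃ : DiffVertAt (fun y => a • sharp (φ₁ y)) x :=
    DiffFieldAt.smul (f := fun _ => a) mdifferentiableAt_const p₁
  have p₁₂ : DiffVertAt (fun y => a • sharp (φ₁ y) + sharp (φ₂ y)) x := p₃.add p₂
  -- The rule for constant multiples is obtained by testing against smooth vertical fields with the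
  -- metric product rule.
  have e : ∀ v, K.cov (fun y => ((a • sharp (φ₁ y) : G.V y) : TangentSpace (𝓡 4) y)) x v =
      a • K.cov (fun y => (sharp (φ₁ y) : TangentSpace (𝓡 4) y)) x v := fun v => by
    refine metric_ext fun z => ?_
    obtain ⟨V, hV, hxV, u, hu, rfl⟩ := exists_vert x z
    have q := hu.diffAt hV hxV
    have m := K.mvfderiv_metric p₃ q v
    simp only [map_smul, LinearMap.smul_apply, smul_eq_mul] at m ⊢
    rw [mvfderiv_const_mul_apply _ _ (DiffVertAt.metric p₁ q), K.mvfderiv_metric p₁ q] at m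
    linear_combination -m
  have s : spinValue K (fieldOf κ fun x v => a * f₁ x v + f₂ x v) (fieldOf κ f)
      (fun y => sharp fun w => a * φ₁ y w + φ₂ y w) (fun y => sharp (φ y)) x =
      a • spinValue K (fieldOf κ f₁) (fieldOf κ f) (fun y => sharp (φ₁ y)) (fun y => sharp (φ y)) x +
      spinValue K (fieldOf κ f₂) (fieldOf κ f) (fun y => sharp (φ₂ y)) (fun y => sharp (φ y)) x := by
    have c : ∀ v, K.cov (fun y => (sharp (fun w => a * φ₁ y w + φ₂ y w) : TangentSpace (𝓡 4) y))
        x v = a • K.cov (fun y => (sharp (φ₁ y) : TangentSpace (𝓡 4) y)) x v +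
          K.cov (fun y => (sharp (φ₂ y) : TangentSpace (𝓡 4) y)) x v := fun v => by
      rw [K.cov_congr hW hx p₁₂ (fun y hy => by rw [k₁.sharp_linear k₂ a hy]), K.cov_add p₃ p₂, e]
    have l : ∀ v v', K.cov (fun y => (sharp (φ y) : TangentSpace (𝓡 4) y)) x (a • v + v') =
        a • K.cov (fun y => (sharp (φ y) : TangentSpace (𝓡 4) y)) x v +
          K.cov (fun y => (sharp (φ y) : TangentSpace (𝓡 4) y)) x v' := fun v v' =>
      Subtype.ext (by
        simp only [Submodule.coe_add, Submodule.coe_smul, K.coe_cov_vert p, map_add, map_smul])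
    simp only [spinValue]
    rw [h₁.fieldOf_linear hκ h₂ a hx, K.rotation_linear, c, l, k₁.sharp_linear k₂ a hx,
      vcross_add_right, vcross_smul_right]
    module
  rw [spinPartBracket_eq K κ _ _ hW hx (k₁.linear k₂ a) k, spinPartBracket_eq K κ _ _ hW hx k₁ k,
    spinPartBracket_eq K κ _ _ hW hx k₂ k, s]
  simp only [map_add, map_smul, LinearMap.add_apply, LinearMap.smul_apply, smul_eq_mul]

theorem isCovectorFieldOn_spinPartBracket (hW : IsOpen W) (h₁ : SpecialOn κ W f₁)
    (h₂ : SpecialOn κ W f₂) (k₁ : IsCovectorFieldOn W φ₁) (k₂ : IsCovectorFieldOn W φ₂) :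
    IsCovectorFieldOn W (spinPartBracket K κ f₁ φ₁ f₂ φ₂) :=
  (smoothVertOn_spinValue hW h₁.field h₂.field (k₁.sharp hW) (k₂.sharp hW)).isCovectorFieldOn
    fun _ hx w => spinPartBracket_eq K κ f₁ f₂ hW hx k₁ k₂ w

theorem spinPartBracket_jacobi (hκ : κ ≠ 0) {f₃ : ∀ x, G.J x → ℝ} {φ₃ : ∀ x, G.V x → ℝ}
    (hW : IsOpen W) (hx : x ∈ W)
    (h₁ : SpecialOn κ W f₁) (h₂ : SpecialOn κ W f₂) (h₃ : SpecialOn κ W f₃)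
    (k₁ : IsCovectorFieldOn W φ₁) (k₂ : IsCovectorFieldOn W φ₂) (k₃ : IsCovectorFieldOn W φ₃)
    (w : G.V x) :
    spinPartBracket K κ f₁ φ₁ (scalarBracket K κ f₂ f₃) (spinPartBracket K κ f₂ φ₂ f₃ φ₃) x w +
      spinPartBracket K κ f₂ φ₂ (scalarBracket K κ f₃ f₁) (spinPartBracket K κ f₃ φ₃ f₁ φ₁) x w +
      spinPartBracket K κ f₃ φ₃ (scalarBracket K κ f₁ f₂) (spinPartBracket K κ f₁ φ₁ f₂ φ₂) x w =
      0 := by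
  have key : ∀ {f g h : ∀ x, G.J x → ℝ} {φ ψ χ : ∀ x, G.V x → ℝ}, SpecialOn κ W f →
      SpecialOn κ W g → SpecialOn κ W h → IsCovectorFieldOn W φ → IsCovectorFieldOn W ψ →
      IsCovectorFieldOn W χ →
      spinPartBracket K κ f φ (scalarBracket K κ g h) (spinPartBracket K κ g ψ h χ) x w =
        G.metric x (spinValue K (fieldOf κ f)
          (VectorField.mlieBracket (𝓡 4) (fieldOf κ g) (fieldOf κ h)) (fun y => sharp (φ y))
          (spinValue K (fieldOf κ g) (fieldOf κ h) (fun y => sharp (ψ y))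
            (fun y => sharp (χ y))) x) w := by
    intro f g h φ ψ χ hf hg hh kφ kψ kχ
    -- The equality is needed on all of `W`, since the outer bracket differentiates the inner one.
    have e : ∀ y ∈ W, sharp (spinPartBracket K κ g ψ h χ y) = spinValue K (fieldOf κ g)
        (fieldOf κ h) (fun y => sharp (ψ y)) (fun y => sharp (χ y)) y := fun y hy =>
      sharp_eq fun z => (spinPartBracket_eq K κ g h hW hy kψ kχ z).symm
    rw [spinPartBracket_eq K κ _ _ hW hx kφ (isCovectorFieldOn_spinPartBracket K hW hg hh kψ kχ),
      spinValue, spinValue, fieldOf_scalarBracket K hκ hg hh hW hx, e x hx,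
      K.cov_congr hW hx ((smoothVertOn_spinValue (K := K) hW hg.field hh.field (kψ.sharp hW)
        (kχ.sharp hW)).diffAt hW hx) (fun y hy => by rw [e y hy])]
  rw [key h₁ h₂ h₃ k₁ k₂ k₃, key h₂ h₃ h₁ k₂ k₃ k₁, key h₃ h₁ h₂ k₃ k₁ k₂, ← LinearMap.add_apply,
    ← map_add, ← LinearMap.add_apply, ← map_add,
    spinValue_jacobi K hW hx h₁.field h₂.field h₃.field (k₁.sharp hW) (k₂.sharp hW) (k₃.sharp hW),
    map_zero, LinearMap.zero_apply]

end Linearity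

/-! ### Local spin special functions -/

section LocalFunctions

variable {G : Spacetime E} {κ : ℝ} {U W : Opens E}

/-- A reformulation of `IsSpinSpecial` by means of the two components. -/
structure SpinSpecial (κ : ℝ) (F : LocalFun G U) : Prop where
  scalar : SpecialOn κ (U : Set E) (scalarPart F)
  spin : IsCovectorFieldOn (U : Set E) (spinPart F)
  eq : ∀ p : {p : SpinPhase G // p.pt ∈ U},
    F p = scalarPart F p.1.pt p.1.vel + spinPart F p.1.pt p.1.spin

theorem scalarPart_apply (F : LocalFun G U) {x : E} (h : x ∈ U) (v : G.J x) :
    scalarPart F x v = F ⟨⟨x, v, 0⟩, h⟩ := dif_pos h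

theorem spinPart_apply (F : LocalFun G U) {x : E} (h : x ∈ U) (w : G.V x) :
    spinPart F x w = F ⟨⟨x, Classical.arbitrary (G.J x), w⟩, h⟩ -
      F ⟨⟨x, Classical.arbitrary (G.J x), 0⟩, h⟩ := dif_pos h

/-! ### Uniqueness of the two components -/

section Parts

variable {F : LocalFun G U} {f : ∀ x, G.J x → ℝ} {φ : ∀ x, G.V x → ℝ}
  (hφ : IsCovectorFieldOn (U : Set E) φ)
  (hF : ∀ p : {p : SpinPhase G // p.pt ∈ U}, F p = f p.1.pt p.1.vel + φ p.1.pt p.1.spin)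
include hφ hF

/-- A linear form vanishes at the zero spin vector, so the scalar component is recovered there and
the decomposition is unique. -/
theorem scalarPart_eq : ∀ x ∈ (U : Set E), scalarPart F x = f x := fun x hx => by
  funext v
  rw [scalarPart_apply F hx, hF]
  simp only [(hφ.1 x hx).map_zero, add_zero]

theorem spinPart_eq : ∀ x ∈ (U : Set E), spinPart F x = φ x := fun x hx => by
  funext w
  rw [spinPart_apply F hx, hF, hF]
  simp only [(hφ.1 x hx).map_zero, add_zero, add_sub_cancel_left]

theorem SpinSpecial.of_parts (hκ : κ ≠ 0) (hf : SpecialOn κ (U : Set E) f) :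
    SpinSpecial κ F where
  scalar := hf.congr hκ (scalarPart_eq hφ hF)
  spin := hφ.congr (spinPart_eq hφ hF)
  eq p := by rw [scalarPart_eq hφ hF _ p.2, spinPart_eq hφ hF _ p.2, hF]

end Parts

theorem isSpinSpecial_iff (hκ : κ ≠ 0) (F : LocalFun G U) :
    IsSpinSpecial κ F ↔ SpinSpecial κ F := by
  constructor
  · rintro ⟨f, φ, hf, hφ, hF⟩
    exact SpinSpecial.of_parts hφ hF hκ (hf.specialOn hκ)
  · exact fun h => ⟨_, _, h.scalar.isSpecial U.isOpen, h.spin, h.eq⟩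

/-- The space of spin special functions over an open set. -/
def spinSpecialSubmodule (G : Spacetime E) (hκ : κ ≠ 0) (U : Opens E) :
    Submodule ℝ (LocalFun G U) :=
  -- Closure under `a • F + F'` gives both vector space operations, with `a = 1` and with `F' = 0`.
  have lin : ∀ (a : ℝ) {F F' : LocalFun G U}, SpinSpecial κ F → SpinSpecial κ F' →
      SpinSpecial κ (a • F + F') := fun a F F' h h' =>
    SpinSpecial.of_parts (h.spin.linear h'.spin a) (fun p => by
      rw [Pi.add_apply, Pi.smul_apply, h.eq, h'.eq, smul_eq_mul]; ring) hκ
      (h.scalar.linear hκ h'.scalar a)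
  have zero : SpinSpecial κ (0 : LocalFun G U) :=
    SpinSpecial.of_parts isCovectorFieldOn_zero (fun _ => by simp) hκ (specialOn_zero hκ)
  { carrier := {F | SpinSpecial κ F}
    add_mem' := fun {F F'} h h' => by
      have k := lin 1 h h'
      rwa [one_smul] at k
    zero_mem' := zero
    smul_mem' := fun a F h => by
      have k := lin a h zero
      rwa [add_zero] at k }

theorem scalarPart_linear (a : ℝ) (F F' : LocalFun G U) :
    ∀ x ∈ (U : Set E), scalarPart (a • F + F') x =
      fun v => a * scalarPart F x v + scalarPart F' x v := fun x hx => by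
  funext v
  simp only [scalarPart_apply _ hx, Pi.add_apply, Pi.smul_apply, smul_eq_mul]

theorem spinPart_linear (a : ℝ) (F F' : LocalFun G U) :
    ∀ x ∈ (U : Set E), spinPart (a • F + F') x =
      fun w => a * spinPart F x w + spinPart F' x w := fun x hx => by
  funext w
  simp only [spinPart_apply _ hx, Pi.add_apply, Pi.smul_apply, smul_eq_mul]
  ring

theorem scalarPart_res (h : W ≤ U) (F : LocalFun G U) :
    ∀ x ∈ (W : Set E), scalarPart (LocalFun.res h F) x = scalarPart F x := fun x hx => by
  funext v
  rw [scalarPart_apply _ hx, scalarPart_apply _ (h hx), LocalFun.res]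

theorem spinPart_res (h : W ≤ U) (F : LocalFun G U) :
    ∀ x ∈ (W : Set E), spinPart (LocalFun.res h F) x = spinPart F x := fun x hx => by
  funext w
  rw [spinPart_apply _ hx, spinPart_apply _ (h hx), LocalFun.res, LocalFun.res]

theorem SpinSpecial.res (hκ : κ ≠ 0) {F : LocalFun G U} (hF : SpinSpecial κ F) (h : W ≤ U) :
    SpinSpecial κ (LocalFun.res h F) :=
  SpinSpecial.of_parts ⟨fun x hx => hF.spin.1 x (h hx), fun V hV hVW => hF.spin.2 V hV
    (hVW.trans h)⟩ (fun _ => hF.eq _) hκ (hF.scalar.mono h)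

/-- Both components are computed point by point and agree on `V` with those of the restriction to
`V`; smoothness and the pointwise form are then local conditions. -/
theorem SpinSpecial.of_local (hκ : κ ≠ 0) {F : LocalFun G U}
    (h : ∀ x ∈ U, ∃ (V : Opens E) (hV : V ≤ U), x ∈ V ∧ SpinSpecial κ (LocalFun.res hV F)) :
    SpinSpecial κ F where
  scalar := by
    refine IsSpecial.specialOn hκ fun x hx => ?_
    obtain ⟨V, hV, hxV, k⟩ := h x hx
    obtain ⟨W, hW, hxW, hWV, r⟩ := (k.scalar.congr hκ fun y hy =>
      (scalarPart_res hV F y hy).symm).isSpecial V.isOpen x hxV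
    exact ⟨W, hW, hxW, hWV.trans hV, r⟩
  spin := IsCovectorFieldOn.of_local fun x hx => by
    obtain ⟨V, hV, hxV, k⟩ := h x hx
    exact ⟨V, V.isOpen, hxV, k.spin.congr fun y hy => (spinPart_res hV F y hy).symm⟩
  eq p := by
    obtain ⟨V, hV, hxV, k⟩ := h p.1.pt p.2
    rw [← scalarPart_res hV F _ hxV, ← spinPart_res hV F _ hxV]
    exact k.eq ⟨p.1, hxV⟩

/-! ### The extended bracket on local functions -/

section Bracket

variable (K : SpacetimeConnection G)

/-- The components of a function and of its restriction agree over `W`, although their extensions by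
zero may differ outside it. The bracket sees only germs at points of `W`. -/
theorem spinBracket_res (h : W ≤ U) (F F' : LocalFun G U) :
    LocalFun.res h (spinBracket K κ F F') =
      spinBracket K κ (LocalFun.res h F) (LocalFun.res h F') := by
  funext p
  simp only [LocalFun.res, spinBracket]
  rw [scalarBracket_congr K W.isOpen p.2 (fun y hy => (scalarPart_res h F y hy).symm)
      (fun y hy => (scalarPart_res h F' y hy).symm),
    spinPartBracket_congr K W.isOpen p.2 (fun y hy => (scalarPart_res h F y hy).symm)
      (fun y hy => (scalarPart_res h F' y hy).symm) (fun y hy => (spinPart_res h F y hy).symm)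
      (fun y hy => (spinPart_res h F' y hy).symm)]

variable [T2Space E] {F F₁ F₂ F₃ : LocalFun G U}

theorem scalarPart_spinBracket (h₁ : SpinSpecial κ F₁) (h₂ : SpinSpecial κ F₂) :
    ∀ x ∈ (U : Set E), scalarPart (spinBracket K κ F₁ F₂) x =
      scalarBracket K κ (scalarPart F₁) (scalarPart F₂) x :=
  scalarPart_eq (isCovectorFieldOn_spinPartBracket K U.isOpen h₁.scalar h₂.scalar h₁.spin h₂.spin)
    fun _ => rfl

theorem spinPart_spinBracket (h₁ : SpinSpecial κ F₁) (h₂ : SpinSpecial κ F₂) :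
    ∀ x ∈ (U : Set E), spinPart (spinBracket K κ F₁ F₂) x =
      spinPartBracket K κ (scalarPart F₁) (spinPart F₁) (scalarPart F₂) (spinPart F₂) x :=
  spinPart_eq (isCovectorFieldOn_spinPartBracket K U.isOpen h₁.scalar h₂.scalar h₁.spin h₂.spin)
    (f := scalarBracket K κ (scalarPart F₁) (scalarPart F₂)) fun _ => rfl

theorem SpinSpecial.spinBracket (hκ : κ ≠ 0) (h₁ : SpinSpecial κ F₁) (h₂ : SpinSpecial κ F₂) :
    SpinSpecial κ (spinBracket K κ F₁ F₂) :=
  SpinSpecial.of_parts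
    (isCovectorFieldOn_spinPartBracket K U.isOpen h₁.scalar h₂.scalar h₁.spin h₂.spin)
    (fun _ => rfl) hκ (h₁.scalar.scalarBracket hκ h₂.scalar U.isOpen)

theorem spinBracket_antisymm (hκ : κ ≠ 0) (h₁ : SpinSpecial κ F₁) (h₂ : SpinSpecial κ F₂) :
    spinBracket K κ F₁ F₂ = -spinBracket K κ F₂ F₁ := by
  funext p
  simp only [spinBracket, Pi.neg_apply]
  rw [scalarBracket_antisymm K hκ U.isOpen h₁.scalar h₂.scalar p.2,
    spinPartBracket_antisymm K U.isOpen p.2 h₁.spin h₂.spin]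
  ring

theorem spinBracket_linear (hκ : κ ≠ 0) (h : SpinSpecial κ F) (h₁ : SpinSpecial κ F₁)
    (h₂ : SpinSpecial κ F₂) (a : ℝ) : spinBracket K κ (a • F₁ + F₂) F =
      a • spinBracket K κ F₁ F + spinBracket K κ F₂ F := by
  funext p
  simp only [spinBracket, Pi.add_apply, Pi.smul_apply, smul_eq_mul]
  rw [scalarBracket_congr K U.isOpen p.2 (scalarPart_linear a F₁ F₂) (fun _ _ => rfl),
    spinPartBracket_congr K U.isOpen p.2 (scalarPart_linear a F₁ F₂) (fun _ _ => rfl)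
      (spinPart_linear a F₁ F₂) (fun _ _ => rfl),
    scalarBracket_linear K hκ U.isOpen h.scalar h₁.scalar h₂.scalar a p.2,
    spinPartBracket_linear K hκ U.isOpen p.2 h₁.scalar h₂.scalar h.spin h₁.spin h₂.spin]
  ring

theorem spinBracket_jacobi (hκ : κ ≠ 0) (h₁ : SpinSpecial κ F₁) (h₂ : SpinSpecial κ F₂)
    (h₃ : SpinSpecial κ F₃) :
    spinBracket K κ F₁ (spinBracket K κ F₂ F₃) + spinBracket K κ F₂ (spinBracket K κ F₃ F₁) +
      spinBracket K κ F₃ (spinBracket K κ F₁ F₂) = 0 := by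
  funext p
  have key : ∀ {F F' F'' : LocalFun G U}, SpinSpecial κ F' → SpinSpecial κ F'' →
      Galilei.spinBracket K κ F (Galilei.spinBracket K κ F' F'') p =
        scalarBracket K κ (scalarPart F) (scalarBracket K κ (scalarPart F') (scalarPart F''))
          p.1.pt p.1.vel +
        spinPartBracket K κ (scalarPart F) (spinPart F)
          (scalarBracket K κ (scalarPart F') (scalarPart F''))
          (spinPartBracket K κ (scalarPart F') (spinPart F') (scalarPart F'') (spinPart F''))
          p.1.pt p.1.spin := by
    intro F F' F'' h' h''
    rw [Galilei.spinBracket,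
      scalarBracket_congr K U.isOpen p.2 (fun _ _ => rfl) (scalarPart_spinBracket K h' h''),
      spinPartBracket_congr K U.isOpen p.2 (fun _ _ => rfl) (scalarPart_spinBracket K h' h'')
        (fun _ _ => rfl) (spinPart_spinBracket K h' h'')]
  have j := scalarBracket_jacobi K hκ U.isOpen h₁.scalar h₂.scalar h₃.scalar p.2 p.1.vel
  have k := spinPartBracket_jacobi K hκ U.isOpen p.2 h₁.scalar h₂.scalar h₃.scalar h₁.spin h₂.spin
    h₃.spin p.1.spin
  simp only [Pi.add_apply, Pi.zero_apply, key h₂ h₃, key h₃ h₁, key h₁ h₂]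
  linear_combination j + k

/-- The extended special bracket, as a bilinear operation. -/
def spinBracketBilin (hκ : κ ≠ 0) (U : Opens E) :
    spinSpecialSubmodule G hκ U →ₗ[ℝ] spinSpecialSubmodule G hκ U →ₗ[ℝ]
      spinSpecialSubmodule G hκ U :=
  have lin : ∀ (a : ℝ) (F₁ F₂ F : spinSpecialSubmodule G hκ U),
      spinBracket K κ (a • F₁.1 + F₂.1) F.1 =
        a • spinBracket K κ F₁.1 F.1 + spinBracket K κ F₂.1 F.1 := fun a F₁ F₂ F =>
    spinBracket_linear K hκ F.2 F₁.2 F₂.2 a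
  have zero : ∀ F : spinSpecialSubmodule G hκ U, spinBracket K κ 0 F.1 = 0 := fun F => by
    have h := lin 1 0 0 F
    simpa using h
  have anti : ∀ F F' : spinSpecialSubmodule G hκ U,
      spinBracket K κ F.1 F'.1 = -spinBracket K κ F'.1 F.1 := fun F F' =>
    spinBracket_antisymm K hκ F.2 F'.2
  have add : ∀ F₁ F₂ F : spinSpecialSubmodule G hκ U,
      spinBracket K κ (F₁ + F₂).1 F.1 = spinBracket K κ F₁.1 F.1 + spinBracket K κ F₂.1 F.1 :=
    fun F₁ F₂ F => by
      have h := lin 1 F₁ F₂ F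
      rwa [one_smul, one_smul] at h
  have smul : ∀ (a : ℝ) (F₁ F : spinSpecialSubmodule G hκ U),
      spinBracket K κ (a • F₁).1 F.1 = a • spinBracket K κ F₁.1 F.1 := fun a F₁ F => by
    have h := lin a F₁ 0 F
    rw [Submodule.coe_zero, add_zero, zero, add_zero] at h
    exact h
  LinearMap.mk₂ ℝ (fun F F' => ⟨spinBracket K κ F.1 F'.1, SpinSpecial.spinBracket K hκ F.2 F'.2⟩)
    (fun F₁ F₂ F => Subtype.ext (add F₁ F₂ F)) (fun a F₁ F => Subtype.ext (smul a F₁ F))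
    (fun F F₁ F₂ => Subtype.ext (by
      change spinBracket K κ F.1 (F₁ + F₂).1 = spinBracket K κ F.1 F₁.1 + spinBracket K κ F.1 F₂.1
      rw [anti, add, anti F F₁, anti F F₂, neg_add]))
    (fun a F F₁ => Subtype.ext (by
      change spinBracket K κ F.1 (a • F₁).1 = a • spinBracket K κ F.1 F₁.1
      rw [anti, smul, anti F F₁, smul_neg]))

end Bracket

/-- Compatible spin special functions glue. -/
theorem existsUnique_glue (hκ : κ ≠ 0) {ι : Type*} (U : ι → Opens E) (F : ∀ i, LocalFun G (U i))
    (hF : ∀ i, SpinSpecial κ (F i))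
    (hc : ∀ i j, LocalFun.res (inf_le_left : U i ⊓ U j ≤ U i) (F i) =
      LocalFun.res (inf_le_right : U i ⊓ U j ≤ U j) (F j)) :
    ∃! H : LocalFun G (⨆ i, U i), SpinSpecial κ H ∧
      ∀ i, LocalFun.res (le_iSup U i) H = F i := by
  have hc' : ∀ i j (p : SpinPhase G) (hi : p.pt ∈ U i) (hj : p.pt ∈ U j),
      F i ⟨p, hi⟩ = F j ⟨p, hj⟩ := fun i j p hi hj => congrFun (hc i j) ⟨p, hi, hj⟩
  have hi : ∀ p : {p : SpinPhase G // p.pt ∈ ⨆ i, U i}, ∃ i, p.1.pt ∈ U i := fun p =>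
    Opens.mem_iSup.1 p.2
  -- For each phase point some member of the cover is picked; by compatibility the value there is
  -- the same for every other choice.
  choose idx hidx using hi
  let H : LocalFun G (⨆ i, U i) := fun p => F (idx p) ⟨p.1, hidx p⟩
  have hH : ∀ i, LocalFun.res (le_iSup U i) H = F i := fun i => by
    funext p
    exact hc' _ _ p.1 _ p.2
  refine ⟨H, ⟨SpinSpecial.of_local hκ fun x hx => ?_, hH⟩, fun H' h' => ?_⟩
  · obtain ⟨i, hxi⟩ := Opens.mem_iSup.1 hx
    exact ⟨U i, le_iSup U i, hxi, by rw [hH i]; exact hF i⟩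
  · funext p
    exact congrFun (h'.2 (idx p)) ⟨p.1, hidx p⟩

end LocalFunctions

end Galilei

end

/-! ### The sheaf of real Lie algebras -/

theorem mainTheorem2 {E : Type*} [TopologicalSpace E] [T2Space E] [SecondCountableTopology E]
    [ChartedSpace (EuclideanSpace ℝ (Fin 4)) E] [IsManifold (𝓡 4) ∞ E]
    (G : Galilei.Spacetime E) (K : Galilei.SpacetimeConnection G)
    (m hbar : ℝ) (hm : 0 < m) (hhbar : 0 < hbar) :
    -- the spin special functions over each open set form a real vector space
    ∃ S : ∀ U : Opens E, Submodule ℝ (Galilei.LocalFun G U),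
      (∀ (U : Opens E) (F : Galilei.LocalFun G U),
        F ∈ S U ↔ Galilei.IsSpinSpecial (m / hbar) F) ∧
      -- the bracket is a bilinear operation on it
      (∃ B : ∀ U : Opens E, S U →ₗ[ℝ] S U →ₗ[ℝ] S U,
        (∀ (U : Opens E) (F F' : S U),
          (B U F F' : Galilei.LocalFun G U) =
            Galilei.spinBracket K (m / hbar) (F : Galilei.LocalFun G U) F') ∧
        -- it is alternating and obeys the Jacobi identity
        (∀ (U : Opens E) (F : S U), B U F F = 0) ∧
        (∀ (U : Opens E) (F₁ F₂ F₃ : S U),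
          B U F₁ (B U F₂ F₃) + B U F₂ (B U F₃ F₁) + B U F₃ (B U F₁ F₂) = 0)) ∧
      -- restriction preserves special functions and the bracket
      (∀ (U W : Opens E) (h : W ≤ U) (F : Galilei.LocalFun G U), F ∈ S U →
        Galilei.LocalFun.res h F ∈ S W) ∧
      (∀ (U W : Opens E) (h : W ≤ U) (F F' : Galilei.LocalFun G U), F ∈ S U → F' ∈ S U →
        Galilei.LocalFun.res h (Galilei.spinBracket K (m / hbar) F F') =
          Galilei.spinBracket K (m / hbar) (Galilei.LocalFun.res h F)
            (Galilei.LocalFun.res h F')) ∧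
      -- compatible local special functions glue uniquely
      (∀ {ι : Type*} (U : ι → Opens E) (F : ∀ i, Galilei.LocalFun G (U i)),
        (∀ i, F i ∈ S (U i)) →
        (∀ i j, Galilei.LocalFun.res (inf_le_left : U i ⊓ U j ≤ U i) (F i) =
          Galilei.LocalFun.res (inf_le_right : U i ⊓ U j ≤ U j) (F j)) →
        ∃! H : Galilei.LocalFun G (⨆ i, U i), H ∈ S (⨆ i, U i) ∧
          ∀ i, Galilei.LocalFun.res (le_iSup U i) H = F i) := by 
  have hκ : m / hbar ≠ 0 := (div_pos hm hhbar).ne'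
  refine ⟨Galilei.spinSpecialSubmodule G hκ, fun U F => (Galilei.isSpinSpecial_iff hκ F).symm,
    ⟨Galilei.spinBracketBilin K hκ, fun U F F' => rfl, fun U F => ?_, fun U F₁ F₂ F₃ => ?_⟩,
    fun U W h F hF => Galilei.SpinSpecial.res hκ hF h,
    fun U W h F F' _ _ => Galilei.spinBracket_res K h F F',
    fun U F hF hc => Galilei.existsUnique_glue hκ U F hF hc⟩
  · refine Subtype.ext (funext fun p => ?_)
    -- A real number equal to its own negative is zero, so antisymmetry gives the alternating
    -- property.
    have h := congrFun (Galilei.spinBracket_antisymm K hκ F.2 F.2) p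
    exact self_eq_neg.1 h
  · exact Subtype.ext (Galilei.spinBracket_jacobi K hκ F₁.2 F₂.2 F₃.2)
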